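/- Let $\Bbbk$ be a field. For $n\ge 0$ let $H^-_n$ be the dg $\Bbbk$-algebra with generators $\sigma_1,\dots,\sigma_{n-1}$ of cohomological degree $-1$, relations $\sigma_i^2=0$, $\sigma_i\sigma_j+\sigma_j\sigma_i=0$ for $|i-j|>1$, $\sigma_i\sigma_{i+1}\sigma_i=\sigma_{i+1}\sigma_i\sigma_{i+1}$, and differential of degree $1$ determined by $d(\sigma_i)=1$ and $d(ab)=d(a)b+(-1)^{\deg a}a\,d(b)$. View it as a graded dg algebra placed in $q$-degree $0$. Graded dg modules are left dg modules with an additional $q$-grading preserved by the action and the differential. Such a module $P$ over a dg algebra $A$ is called projective if the complex $\mathrm{Hom}_A(P,M)$ is acyclic for every acyclic graded dg module $M$; it is called compact if $\bigoplus_i \mathrm{Hom}(P,N_i)\to \mathrm{Hom}(P,\bigoplus_i N_i)$ is an isomorphism in the homotopy category for every family of projective $N_i$. Let $K_0(A)$ be the $\mathbb Z[q,q^{-1}]$-module with generators $[P]$, for compact projective graded dg $A$-modules $P$, and relations $[P[1]]=-[P]$, $[P\{n\}]=q^n[P]$ (where $\{n\}$ is the $q$-grading shift by $n$ up), and $[P_2]=[P_1]+[P_3]$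 for each distinguished triangle $P_1\to P_2\to P_3\to P_1[1]$ in the homotopy category. Let $H^-_n\otimes H^-_m\to H^-_{n+m}$ be the dg algebra homomorphism $\sigma_i\otimes 1\mapsto \sigma_i$, $1\otimes\sigma_j\mapsto\sigma_{n+j}$ (super tensor product), and put $\mathrm{Ind}(P,Q)=H^-_{n+m}\otimes_{H^-_n\otimes H^-_m}(P\otimes_{\Bbbk} Q)$; let $\mathrm{Res}$ be the restriction of $H^-_{n+m}$-modules to $H^-_n\otimes H^-_m$. Then: 1. The free modules $H^-_n$ are compact projective; $K_0(H^-_0)$ and $K_0(H^-_1)$ are free $\mathbb Z[q,q^{-1}]$-modules of rank one generated by $[H^-_0]$ and $[H^-_1]$ respectively, and $K_0(H^-_n)=0$ for $n\ge 2$. 2. $\mathrm{Ind}$, $\mathrm{Res}$ and the outer tensor product $(P,Q)\mapsto P\otimes_\Bbbk Q$ preserve compact projective modules and descend to $\mathbb Z[q,q^{-1}]$-(bi)linear maps on $K_0$; the outer tensor product induces isomorphisms $K_0(H^-_n)\otimes_{\mathbb Z[q,q^{-1}]}K_0(H^-_m)\cong K_0(H^-_n\otimes H^-_m)$. Hence induction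 and restriction give a multiplication and a comultiplication on $K_0(H^-):=\bigoplus_{n\ge 0}K_0(H^-_n)$. 3. There is an isomorphism of $\mathbb Z[q,q^{-1}]$-modules $K_0(H^-)\cong \mathbb Z[q,q^{-1},E_1]/(E_1^2)$ that takes $[H^-_0]$ to $1$ and $[H^-_1]$ to $E_1$, the multiplication to the multiplication, and the comultiplication to the one determined by $\Delta(E_1)=E_1\otimes 1+1\otimes E_1$, an algebra homomorphism to the super tensor square ($E_1$ odd). Moreover $\mathbb Z[q,q^{-1},E_1]/(E_1^2)$ is the integral form of $U_q^+(\mathfrak{gl}(1|1))=\mathbb Q(q)[E_1]/(E_1^2)$: it is identified with the $\mathbb Z[q,q^{-1}]$-subalgebra generated by $E_1$. -/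

import Mathlib

open scoped TensorProduct DirectSum

universe u

noncomputable section

namespace LOTCat

/-! ### Gradings of modules -/

section Grading

variable {R : Type*} {ι : Type*} {κ : Type*} {τ : Type*} {M : Type*} {N : Type*}
variable [CommRing R] [AddCommGroup M] [Module R M] [AddCommGroup N] [Module R N]

/-- The grading of a tensor product in which `x ⊗ y`, for `x` of degree `i` and `y` of
degree `j`, has degree `s i j`. -/
def tensorGr (s : ι → κ → τ) (grM : ι → Submodule R M) (grN : κ → Submodule R N) (t : τ) :
    Submodule R (M ⊗[R] N) :=
  Submodule.span R {z | ∃ i j, ∃ x ∈ grM i, ∃ y ∈ grN j, s i j = t ∧ x ⊗ₜ[R] y = z}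

theorem tmul_mem_tensorGr {s : ι → κ → τ} {grM : ι → Submodule R M} {grN : κ → Submodule R N}
    {i : ι} {j : κ} {t : τ} {x : M} {y : N} (hx : x ∈ grM i) (hy : y ∈ grN j) (ht : s i j = t) :
    x ⊗ₜ[R] y ∈ tensorGr s grM grN t :=
  Submodule.subset_span ⟨i, j, x, hx, y, hy, ht, rfl⟩

variable [DecidableEq ι] [DecidableEq κ] [DecidableEq τ]

theorem isInternal_of_coaction (gr : ι → Submodule R M) (hsup : ∀ x, x ∈ ⨆ i, gr i)
    (ρ : M →ₗ[R] (ι →₀ M)) (h : ∀ i, ∀ x ∈ gr i, ρ x = Finsupp.single i x) :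
    DirectSum.IsInternal gr := by
  refine DirectSum.isInternal_submodule_of_iSupIndep_of_iSup_eq_top ?_
    (eq_top_iff.2 fun x _ => hsup x)
  rw [iSupIndep_def]
  intro i
  rw [Submodule.disjoint_def]
  intro x hx hx'
  have h0 : ρ x i = 0 := by
    have hle : (⨆ j, ⨆ (_ : j ≠ i), gr j) ≤ LinearMap.ker ((Finsupp.lapply i).comp ρ) := by
      refine iSup_le fun j => iSup_le fun hj => fun y hy => ?_
      rw [LinearMap.mem_ker, LinearMap.comp_apply, h j y hy]
      exact Finsupp.single_eq_of_ne (Ne.symm hj)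
    exact hle hx'
  rw [h i x hx, Finsupp.single_eq_same] at h0
  exact h0

/-- The decomposition of a vector into homogeneous components. -/
def coact {gr : ι → Submodule R M} (h : DirectSum.IsInternal gr) : M →ₗ[R] (ι →₀ M) :=
  (DirectSum.toModule R ι (ι →₀ M) fun i => (Finsupp.lsingle i).comp (gr i).subtype).comp
    (LinearEquiv.ofBijective (DirectSum.coeLinearMap gr)
      (show Function.Bijective (DirectSum.coeLinearMap gr) from h)).symm.toLinearMap

theorem coact_of_mem {gr : ι → Submodule R M} (h : DirectSum.IsInternal gr) {i : ι} {x : M}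
    (hx : x ∈ gr i) : coact h x = Finsupp.single i x := by
  have e : (LinearEquiv.ofBijective (DirectSum.coeLinearMap gr)
      (show Function.Bijective (DirectSum.coeLinearMap gr) from h)).symm x
      = DirectSum.lof R ι (fun i => gr i) i ⟨x, hx⟩ := by
    rw [LinearEquiv.symm_apply_eq]
    exact (DirectSum.coeLinearMap_lof gr i ⟨x, hx⟩).symm
  simp only [coact, LinearMap.comp_apply, LinearEquiv.coe_coe, e, DirectSum.toModule_lof]
  simp

theorem hom_induction {gr : ι → Submodule R M} (h : DirectSum.IsInternal gr) {p : M → Prop}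
    (h0 : p 0) (hadd : ∀ x y, p x → p y → p (x + y)) (hom : ∀ i, ∀ x ∈ gr i, p x) (x : M) :
    p x :=
  Submodule.iSup_induction gr (motive := p)
    (by rw [h.submodule_iSup_eq_top]; trivial : x ∈ ⨆ i, gr i) hom h0 hadd

theorem hom_ext {gr : ι → Submodule R M} (h : DirectSum.IsInternal gr) {f g : M →ₗ[R] N}
    (hfg : ∀ i, ∀ x ∈ gr i, f x = g x) : f = g := by
  ext x
  refine hom_induction h (p := fun x => f x = g x) (by simp) (fun x y hx hy => ?_) hfg x
  simp [hx, hy]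

/-- The operator that multiplies a homogeneous vector of degree `i` by the scalar `c i`. -/
def gscale {gr : ι → Submodule R M} (h : DirectSum.IsInternal gr) (c : ι → R) : M →ₗ[R] M :=
  (Finsupp.lsum R fun i => c i • (LinearMap.id : M →ₗ[R] M)).comp (coact h)

theorem gscale_of_mem {gr : ι → Submodule R M} (h : DirectSum.IsInternal gr) (c : ι → R) {i : ι}
    {x : M} (hx : x ∈ gr i) : gscale h c x = c i • x := by
  simp [gscale, coact_of_mem h hx]

theorem tensor_hom_induction {grM : ι → Submodule R M} {grN : κ → Submodule R N}
    (hM : DirectSum.IsInternal grM) (hN : DirectSum.IsInternal grN) {p : M ⊗[R] N → Prop}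
    (h0 : p 0) (hadd : ∀ x y, p x → p y → p (x + y))
    (hom : ∀ i j, ∀ x ∈ grM i, ∀ y ∈ grN j, p (x ⊗ₜ y)) (z : M ⊗[R] N) : p z := by
  induction z using TensorProduct.induction_on with
  | zero => exact h0
  | add x y hx hy => exact hadd _ _ hx hy
  | tmul x y =>
    refine hom_induction hM (p := fun x => p (x ⊗ₜ y)) (by simpa) (fun a b ha hb => ?_)
      (fun i x hx => ?_) x
    · rw [TensorProduct.add_tmul]; exact hadd _ _ ha hb
    refine hom_induction hN (p := fun y => p (x ⊗ₜ y)) (by simpa) (fun a b ha hb => ?_)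
      (fun j y hy => hom i j x hx y hy) y
    rw [TensorProduct.tmul_add]; exact hadd _ _ ha hb

theorem tensor_isInternal (s : ι → κ → τ) {grM : ι → Submodule R M} {grN : κ → Submodule R N}
    (hM : DirectSum.IsInternal grM) (hN : DirectSum.IsInternal grN) :
    DirectSum.IsInternal (tensorGr s grM grN) := by
  refine isInternal_of_coaction _ (fun z => ?_)
    ((Finsupp.lmapDomain (M ⊗[R] N) R fun p : ι × κ => s p.1 p.2).comp
      ((finsuppTensorFinsupp R R M N ι κ).toLinearMap.comp
        (TensorProduct.map (coact hM) (coact hN)))) (fun t z hz => ?_)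
  · refine tensor_hom_induction hM hN (Submodule.zero_mem _)
      (fun x y hx hy => Submodule.add_mem _ hx hy) (fun i j x hx y hy => ?_) z
    exact (le_iSup (tensorGr s grM grN) (s i j)) (tmul_mem_tensorGr hx hy rfl)
  · induction hz using Submodule.span_induction with
    | mem z hz =>
      obtain ⟨i, j, x, hx, y, hy, rfl, rfl⟩ := hz
      simp [coact_of_mem hM hx, coact_of_mem hN hy, Finsupp.mapDomain_single]
    | zero => simp
    | add a b _ _ ha hb => rw [map_add, ha, hb, Finsupp.single_add]
    | smul r a _ ha => rw [map_smul, ha, Finsupp.smul_single]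

theorem map_isInternal (e : M ≃ₗ[R] N) {gr : ι → Submodule R M} (h : DirectSum.IsInternal gr) :
    DirectSum.IsInternal fun i => (gr i).map e.toLinearMap := by
  refine isInternal_of_coaction _ (fun z => ?_)
    ((Finsupp.mapRange.linearMap e.toLinearMap).comp ((coact h).comp e.symm.toLinearMap))
    (fun t z hz => ?_)
  · rw [← Submodule.map_iSup, h.submodule_iSup_eq_top]
    exact ⟨e.symm z, trivial, by simp⟩
  · obtain ⟨x, hx, rfl⟩ := hz
    simp [coact_of_mem h hx]

theorem quotient_isInternal {gr : ι → Submodule R M} (h : DirectSum.IsInternal gr)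
    (K : Submodule R M) (hK : ∀ x ∈ K, ∀ i, coact h x i ∈ K) :
    DirectSum.IsInternal fun i => (gr i).map K.mkQ := by
  refine isInternal_of_coaction _ (fun z => ?_)
    (K.liftQ ((Finsupp.mapRange.linearMap K.mkQ).comp (coact h)) fun x hx => ?_)
    (fun t z hz => ?_)
  · rw [← Submodule.map_iSup, h.submodule_iSup_eq_top]
    obtain ⟨x, rfl⟩ := K.mkQ_surjective z
    exact ⟨x, trivial, rfl⟩
  · rw [LinearMap.mem_ker]
    ext i
    simpa using hK x hx i
  · obtain ⟨x, hx, rfl⟩ := hz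
    simp [coact_of_mem h hx]

theorem prod_isInternal {grM : ι → Submodule R M} {grN : ι → Submodule R N}
    (hM : DirectSum.IsInternal grM) (hN : DirectSum.IsInternal grN) :
    DirectSum.IsInternal fun i => (grM i).prod (grN i) := by
  refine isInternal_of_coaction _ (fun z => ?_)
    ((Finsupp.mapRange.linearMap (LinearMap.inl R M N)).comp
        ((coact hM).comp (LinearMap.fst R M N)) +
      (Finsupp.mapRange.linearMap (LinearMap.inr R M N)).comp
        ((coact hN).comp (LinearMap.snd R M N)))
    (fun t z hz => ?_)
  · obtain ⟨x, y⟩ := z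
    have hx : ((x, 0) : M × N) ∈ ⨆ i, (grM i).prod (grN i) :=
      hom_induction hM (p := fun x => ((x, 0) : M × N) ∈ ⨆ i, (grM i).prod (grN i))
        (Submodule.zero_mem _) (fun a b ha hb => by simpa using Submodule.add_mem _ ha hb)
        (fun i x hx => (le_iSup (fun i => (grM i).prod (grN i)) i) ⟨hx, Submodule.zero_mem _⟩) x
    have hy : ((0, y) : M × N) ∈ ⨆ i, (grM i).prod (grN i) :=
      hom_induction hN (p := fun y => ((0, y) : M × N) ∈ ⨆ i, (grM i).prod (grN i))
        (Submodule.zero_mem _) (fun a b ha hb => by simpa using Submodule.add_mem _ ha hb)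
        (fun i x hx => (le_iSup (fun i => (grM i).prod (grN i)) i) ⟨Submodule.zero_mem _, hx⟩) y
    simpa using Submodule.add_mem _ hx hy
  · obtain ⟨x, y⟩ := z
    simp [coact_of_mem hM hz.1, coact_of_mem hN hz.2, ← Finsupp.single_add]

theorem reindex_isInternal {gr : ι → Submodule R M} (h : DirectSum.IsInternal gr) (e : κ ≃ ι) :
    DirectSum.IsInternal fun i => gr (e i) := by
  refine isInternal_of_coaction _ (fun z => ?_)
    ((Finsupp.lmapDomain M R e.symm).comp (coact h)) (fun t z hz => ?_)
  · rw [e.iSup_comp (g := gr), h.submodule_iSup_eq_top]; trivial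
  · simp [coact_of_mem h hz, Finsupp.mapDomain_single]

theorem directSum_isInternal {I : Type*} [DecidableEq I] {X : I → Type*}
    [∀ a, AddCommGroup (X a)] [∀ a, Module R (X a)] {gr : ∀ a, ι → Submodule R (X a)}
    (h : ∀ a, DirectSum.IsInternal (gr a)) :
    DirectSum.IsInternal fun i : ι =>
      (⨅ a, (gr a i).comap (DirectSum.component R I X a) : Submodule R (⨁ a, X a)) := by
  refine isInternal_of_coaction _ (fun z => ?_)
    (DirectSum.toModule R I _ fun a =>
      (Finsupp.mapRange.linearMap (DirectSum.lof R I X a)).comp (coact (h a))) (fun t z hz => ?_)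
  · induction z using DirectSum.induction_on with
    | zero => exact Submodule.zero_mem _
    | add x y hx hy => exact Submodule.add_mem _ hx hy
    | of a x =>
      refine hom_induction (h a) (p := fun x => DirectSum.of X a x ∈ _) (by simp)
        (fun x y hx hy => by simpa using Submodule.add_mem _ hx hy) (fun i x hx => ?_) x
      refine (le_iSup (fun i : ι =>
        (⨅ a, (gr a i).comap (DirectSum.component R I X a) : Submodule R (⨁ a, X a))) i) ?_
      rw [Submodule.mem_iInf]
      intro b
      rw [Submodule.mem_comap]
      by_cases hab : a = b
      · subst hab
        rw [← DirectSum.lof_eq_of R, DirectSum.component.lof_self]; exact hx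
      · rw [← DirectSum.lof_eq_of R, DirectSum.component.of, dif_neg hab]
        exact Submodule.zero_mem _
  · rw [Submodule.mem_iInf] at hz
    have hz' : ∀ a, z a ∈ gr a t := fun a => hz a
    classical
    rw [← DirectSum.sum_support_of z, map_sum]
    have : (Finsupp.single t (∑ i ∈ DFinsupp.support z, DirectSum.of X i (z i)) :
        ι →₀ ⨁ a, X a) = ∑ i ∈ DFinsupp.support z, Finsupp.single t (DirectSum.of X i (z i)) :=
      map_sum (Finsupp.singleAddHom t) _ _
    rw [this]
    refine Finset.sum_congr rfl fun a _ => ?_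
    rw [← DirectSum.lof_eq_of R, DirectSum.toModule_lof, LinearMap.comp_apply,
      coact_of_mem (h a) (hz' a)]
    simp

end Grading

/-! ### Dg algebras and graded dg modules -/

section DG

variable (k : Type u) [Field k]

/-- The sign `(-1) ^ i` as a scalar. -/
def sg (i : ℤ) : k := ((i.negOnePow : ℤ) : k)

theorem sg_zero : sg k 0 = 1 := by simp [sg]

theorem sg_one : sg k 1 = -1 := by simp [sg]

theorem sg_add (i j : ℤ) : sg k (i + j) = sg k i * sg k j := by
  simp [sg, Int.negOnePow_add]

theorem sg_mul_self (i : ℤ) : sg k i * sg k i = 1 := by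
  rw [← sg_add]; simp [sg, Int.negOnePow_even (i + i) ⟨i, rfl⟩]

theorem sg_succ (i : ℤ) : sg k (i + 1) = -sg k i := by rw [sg_add, sg_one]; ring

theorem sg_even {i : ℤ} (h : Even i) : sg k i = 1 := by simp [sg, Int.negOnePow_even i h]

theorem sg_odd {i : ℤ} (h : Odd i) : sg k i = -1 := by simp [sg, Int.negOnePow_odd i h]

theorem units_smul_eq {M : Type*} [AddCommGroup M] [Module k M] (i : ℤ) (x : M) :
    ((-1 : ℤˣ) ^ i) • x = sg k i • x := by
  rw [Units.smul_def, sg, Int.cast_smul_eq_zsmul]; rfl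

/-- A dg algebra over `k`: a `ℤ`-graded (cohomological grading) associative unital algebra with a
differential of degree `1` satisfying the graded Leibniz rule. As a graded dg algebra it is
understood to sit entirely in `q`-degree `0`. -/
structure DGAlg where
  carrier : Type u
  [ring : Ring carrier]
  [algebra : Algebra k carrier]
  gr : ℤ → Submodule k carrier
  internal : DirectSum.IsInternal gr
  one_mem : (1 : carrier) ∈ gr 0
  mul_mem : ∀ {i j : ℤ} {a b : carrier}, a ∈ gr i → b ∈ gr j → a * b ∈ gr (i + j)
  d : carrier →ₗ[k] carrier
  d_mem : ∀ {i : ℤ} {a : carrier}, a ∈ gr i → d a ∈ gr (i + 1)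
  d_d : ∀ a, d (d a) = 0
  leibniz : ∀ {i : ℤ} {a : carrier}, a ∈ gr i → ∀ b, d (a * b) = d a * b + sg k i • (a * d b)

attribute [instance] DGAlg.ring DGAlg.algebra

variable {k}

instance (A : DGAlg k) : SetLike.GradedMonoid A.gr where
  one_mem := A.one_mem
  mul_mem _ _ _ _ ha hb := A.mul_mem ha hb

instance (A : DGAlg k) : GradedAlgebra A.gr where
  toGradedMonoid := inferInstance
  toDecomposition := A.internal.chooseDecomposition

/-- The sign automorphism `a ↦ (-1) ^ deg a • a`. -/
def DGAlg.eps (A : DGAlg k) : A.carrier →ₐ[k] A.carrier :=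
  AlgHom.ofLinearMap (gscale A.internal (sg k))
    (by rw [gscale_of_mem A.internal _ A.one_mem, sg_zero, one_smul])
    (by
      intro a b
      refine hom_induction A.internal (p := fun a => gscale A.internal (sg k) (a * b) =
        gscale A.internal (sg k) a * gscale A.internal (sg k) b) (by simp)
        (fun x y hx hy => by simp only [add_mul, map_add, hx, hy]) (fun i a ha => ?_) a
      refine hom_induction A.internal (p := fun b => gscale A.internal (sg k) (a * b) =
        gscale A.internal (sg k) a * gscale A.internal (sg k) b) (by simp)
        (fun x y hx hy => by simp only [mul_add, map_add, hx, hy]) (fun j b hb => ?_) b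
      rw [gscale_of_mem _ _ ha, gscale_of_mem _ _ hb, gscale_of_mem _ _ (A.mul_mem ha hb), sg_add,
        smul_mul_smul_comm])

theorem DGAlg.eps_of_mem (A : DGAlg k) {i : ℤ} {a : A.carrier} (ha : a ∈ A.gr i) :
    A.eps a = sg k i • a :=
  gscale_of_mem A.internal (sg k) ha

/-- A homomorphism of dg algebras. -/
structure DGHom (A B : DGAlg k) where
  toAlgHom : A.carrier →ₐ[k] B.carrier
  map_mem : ∀ {i : ℤ} {a : A.carrier}, a ∈ A.gr i → toAlgHom a ∈ B.gr i
  map_d : ∀ a, toAlgHom (A.d a) = B.d (toAlgHom a)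

/-- A graded (left) dg module over `A`: a module with a bigrading (cohomological degree,
`q`-degree), an action of `A` adding the cohomological degrees and preserving the `q`-degree, and
a differential of bidegree `(1, 0)` satisfying the Leibniz rule. The action is given as an algebra
homomorphism from `A` to the `k`-linear endomorphisms. -/
structure DGMod (A : DGAlg k) where
  carrier : Type u
  [addCommGroup : AddCommGroup carrier]
  [module : Module k carrier]
  gr : ℤ × ℤ → Submodule k carrier
  internal : DirectSum.IsInternal gr
  act : A.carrier →ₐ[k] Module.End k carrier
  act_mem : ∀ {i p q : ℤ} {a : A.carrier} {m : carrier}, a ∈ A.gr i → m ∈ gr (p, q) →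
    act a m ∈ gr (i + p, q)
  d : carrier →ₗ[k] carrier
  d_mem : ∀ {p q : ℤ} {m : carrier}, m ∈ gr (p, q) → d m ∈ gr (p + 1, q)
  d_d : ∀ m, d (d m) = 0
  leibniz : ∀ {i : ℤ} {a : A.carrier}, a ∈ A.gr i → ∀ m,
    d (act a m) = act (A.d a) m + sg k i • act a (d m)

attribute [instance] DGMod.addCommGroup DGMod.module

namespace DGMod

variable {A : DGAlg k}

/-- The homogeneous `A`-linear maps of bidegree `(n, 0)`, which satisfy
`f (a m) = (-1) ^ (n * deg a) a f(m)`. -/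
def homDeg (n : ℤ) (M N : DGMod A) : Submodule k (M.carrier →ₗ[k] N.carrier) where
  carrier := {f | (∀ p q, ∀ m ∈ M.gr (p, q), f m ∈ N.gr (p + n, q)) ∧
    ∀ i, ∀ a ∈ A.gr i, ∀ m, f (M.act a m) = sg k (n * i) • N.act a (f m)}
  zero_mem' := ⟨fun _ _ _ _ => Submodule.zero_mem _, fun _ _ _ _ => by simp⟩
  add_mem' := fun hf hg => ⟨fun p q m hm => Submodule.add_mem _ (hf.1 p q m hm) (hg.1 p q m hm),
    fun i a ha m => by simp [hf.2 i a ha m, hg.2 i a ha m]⟩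
  smul_mem' := fun c f hf => ⟨fun p q m hm => Submodule.smul_mem _ _ (hf.1 p q m hm),
    fun i a ha m => by simp [hf.2 i a ha m, smul_comm c]⟩

/-- The differential `f ↦ d ∘ f - (-1) ^ n f ∘ d` of the complex `Hom_A(M, N)`, in degree `n`. -/
def homD (n : ℤ) (M N : DGMod A) :
    (M.carrier →ₗ[k] N.carrier) →ₗ[k] (M.carrier →ₗ[k] N.carrier) :=
  LinearMap.llcomp k M.carrier N.carrier N.carrier N.d - sg k n • LinearMap.lcomp k N.carrier M.d

theorem homD_apply (n : ℤ) (M N : DGMod A) (f : M.carrier →ₗ[k] N.carrier) (m : M.carrier) :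
    homD n M N f m = N.d (f m) - sg k n • f (M.d m) := by
  simp [homD]

/-- The `n`-cocycles of the complex `Hom_A(M, N)`. -/
def homZ (n : ℤ) (M N : DGMod A) : Submodule k (M.carrier →ₗ[k] N.carrier) :=
  homDeg n M N ⊓ LinearMap.ker (homD n M N)

/-- The `n`-coboundaries of the complex `Hom_A(M, N)`. -/
def homB (n : ℤ) (M N : DGMod A) : Submodule k (M.carrier →ₗ[k] N.carrier) :=
  (homDeg (n - 1) M N).map (homD (n - 1) M N)

/-- A dg module with zero homology. -/
def IsAcyclic (M : DGMod A) : Prop := ∀ m, M.d m = 0 → ∃ m', M.d m' = m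

/-- Projective (also called `K`-projective) dg modules: `Hom_A(P, M)` has zero homology whenever
`M` does. -/
def IsProjective (P : DGMod A) : Prop :=
  ∀ M : DGMod A, M.IsAcyclic → ∀ n : ℤ, homZ n P M ≤ homB n P M

/-- Morphisms in the homotopy category of graded dg modules: degree `0` homomorphisms of dg modules
modulo homotopy. -/
abbrev HomK (M N : DGMod A) : Type u :=
  homZ 0 M N ⧸ (homB 0 M N).comap (homZ 0 M N).subtype

/-- Two dg modules are isomorphic in the homotopy category. -/
def HtpyEquiv (M N : DGMod A) : Prop :=
  ∃ f ∈ homZ 0 M N, ∃ g ∈ homZ 0 N M,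
    g.comp f - LinearMap.id ∈ homB 0 M M ∧ f.comp g - LinearMap.id ∈ homB 0 N N

/-- The direct sum of a family of graded dg modules. -/
abbrev sum {I : Type u} (N : I → DGMod A) : DGMod A where
  carrier := ⨁ a, (N a).carrier
  gr i := ⨅ a, ((N a).gr i).comap (DirectSum.component k I (fun a => (N a).carrier) a)
  internal := by classical exact directSum_isInternal fun a => (N a).internal
  act := AlgHom.ofLinearMap
    { toFun := fun x => DirectSum.lmap fun a => (N a).act x
      map_add' := fun x y => LinearMap.ext fun m => DFinsupp.ext fun b =>
        LinearMap.congr_fun (map_add (N b).act x y) (m b)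
      map_smul' := fun c x => LinearMap.ext fun m => DFinsupp.ext fun b =>
        LinearMap.congr_fun (map_smul (N b).act c x) (m b) }
    (LinearMap.ext fun m => DFinsupp.ext fun b => LinearMap.congr_fun (map_one (N b).act) (m b))
    (fun x y => LinearMap.ext fun m => DFinsupp.ext fun b =>
      LinearMap.congr_fun (map_mul (N b).act x y) (m b))
  act_mem := by
    intro i p q a m ha hm
    rw [Submodule.mem_iInf] at hm ⊢
    exact fun b => (N b).act_mem ha (hm b)
  d := DirectSum.lmap fun a => (N a).d
  d_mem := by
    intro p q m hm
    rw [Submodule.mem_iInf] at hm ⊢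
    exact fun b => (N b).d_mem (hm b)
  d_d m := DFinsupp.ext fun b => (N b).d_d (m b)
  leibniz := fun ha m => DFinsupp.ext fun b => (N b).leibniz ha (m b)

theorem homZ_comm {M N : DGMod A} {f : M.carrier →ₗ[k] N.carrier} (hf : f ∈ homZ 0 M N)
    (m : M.carrier) : N.d (f m) = f (M.d m) := by
  have h := LinearMap.congr_fun (LinearMap.mem_ker.1 hf.2) m
  rwa [homD_apply, sg_zero, one_smul, LinearMap.zero_apply, sub_eq_zero] at h

theorem homZ_act {M N : DGMod A} {f : M.carrier →ₗ[k] N.carrier} (hf : f ∈ homZ 0 M N)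
    (a : A.carrier) (m : M.carrier) : f (M.act a m) = N.act a (f m) := by
  refine hom_induction A.internal (p := fun a => f (M.act a m) = N.act a (f m)) (by simp)
    (fun x y hx hy => by simp [hx, hy]) (fun i a ha => ?_) a
  rw [hf.1.2 i a ha m, zero_mul, sg_zero, one_smul]

theorem comp_mem_homDeg {n : ℤ} {M N N' : DGMod A} {f : M.carrier →ₗ[k] N.carrier}
    {g : N.carrier →ₗ[k] N'.carrier} (hf : f ∈ homDeg n M N) (hg : g ∈ homZ 0 N N') :
    g.comp f ∈ homDeg n M N' := by
  refine ⟨fun p q m hm => ?_, fun i a ha m => ?_⟩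
  · have := hg.1.1 _ _ _ (hf.1 p q m hm)
    rwa [add_zero] at this
  · rw [LinearMap.comp_apply, hf.2 i a ha m, map_smul, homZ_act hg, LinearMap.comp_apply]

theorem homD_comp {n : ℤ} {M N N' : DGMod A} (f : M.carrier →ₗ[k] N.carrier)
    {g : N.carrier →ₗ[k] N'.carrier} (hg : g ∈ homZ 0 N N') :
    homD n M N' (g.comp f) = g.comp (homD n M N f) := by
  ext m
  simp [homD_apply, homZ_comm hg]

/-- Composition with a homomorphism of dg modules, on the level of the homotopy category. -/
def postcomp (M : DGMod A) {N N' : DGMod A} (g : homZ 0 N N') : HomK M N →ₗ[k] HomK M N' :=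
  Submodule.mapQ _ _
    ((LinearMap.llcomp k M.carrier N.carrier N'.carrier g.1).restrict
      (p := homZ 0 M N) (q := homZ 0 M N') fun f hf => ⟨comp_mem_homDeg hf.1 g.2, by
        have h : homD 0 M N f = 0 := hf.2
        change homD 0 M N' (g.1.comp f) = 0
        rw [homD_comp f g.2, h, LinearMap.comp_zero]⟩)
    (by
      rintro ⟨f, hf⟩ ⟨s, hs, h⟩
      exact ⟨g.1.comp s, comp_mem_homDeg hs g.2, by
        rw [homD_comp s g.2, h]; rfl⟩)

open Classical in
/-- The inclusion of a summand into a direct sum of dg modules. -/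
def sumIncl {I : Type u} (N : I → DGMod A) (i : I) : homZ 0 (N i) (sum N) :=
  ⟨DirectSum.lof k I (fun a => (N a).carrier) i, by
    have key : ∀ (m : (N i).carrier) (φ : ∀ a, (N a).carrier →ₗ[k] (N a).carrier),
        DirectSum.lmap φ (DirectSum.lof k I (fun a => (N a).carrier) i m) =
          DirectSum.lof k I (fun a => (N a).carrier) i (φ i m) :=
      fun m φ => DirectSum.lmap_lof φ i m
    refine ⟨⟨fun p q m hm => ?_, fun j a ha m => ?_⟩, ?_⟩
    · rw [add_zero]
      refine (Submodule.mem_iInf _).2 fun b => ?_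
      rw [Submodule.mem_comap]
      by_cases h : i = b
      · subst h
        rw [DirectSum.component.lof_self]; exact hm
      · rw [DirectSum.component.of, dif_neg h]; exact Submodule.zero_mem _
    · rw [zero_mul, sg_zero, one_smul]
      exact (key m fun a' => (N a').act a).symm
    · refine LinearMap.mem_ker.2 (LinearMap.ext fun m => ?_)
      rw [homD_apply, sg_zero, one_smul, LinearMap.zero_apply, sub_eq_zero]
      exact key m fun a' => (N a').d⟩

open Classical in
/-- The canonical map from `⨁ i, Hom(M, N i)` to `Hom(M, ⨁ i, N i)` in the homotopy category. -/
def sumHomK (M : DGMod A) {I : Type u} (N : I → DGMod A) :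
    (⨁ i, HomK M (N i)) →ₗ[k] HomK M (sum N) :=
  DirectSum.toModule k I _ fun i => postcomp M (sumIncl N i)

/-- Compactness of an object of the homotopy category of projective graded dg modules. -/
def IsCompact (M : DGMod A) : Prop :=
  ∀ (I : Type u) (N : I → DGMod A), (∀ i, (N i).IsProjective) → Function.Bijective (sumHomK M N)

/-- The cohomological shift `M[1]`: `M[1]^i = M^(i+1)`, the differential changes sign and the left
action of `a` is multiplied by `(-1) ^ deg a`. -/
abbrev shift (M : DGMod A) : DGMod A where
  carrier := M.carrier
  gr i := M.gr (i.1 + 1, i.2)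
  internal := reindex_isInternal M.internal ((Equiv.addRight (1 : ℤ)).prodCongr (Equiv.refl ℤ))
  act := M.act.comp A.eps
  act_mem := by
    intro i p q a m ha hm
    rw [AlgHom.comp_apply, A.eps_of_mem ha, map_smul, LinearMap.smul_apply]
    have := M.act_mem ha hm
    rw [← add_assoc] at this
    exact Submodule.smul_mem _ _ this
  d := -M.d
  d_mem := fun hm => Submodule.neg_mem _ (M.d_mem hm)
  d_d m := by simp [M.d_d]
  leibniz := by
    intro i a ha m
    simp only [AlgHom.comp_apply, A.eps_of_mem ha, A.eps_of_mem (A.d_mem ha), map_smul,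
      LinearMap.smul_apply, LinearMap.neg_apply, M.leibniz ha, sg_succ, map_neg, smul_add,
      smul_neg, neg_smul, neg_add]

/-- The `q`-grading shift `M{n}` by `n` degrees up. -/
abbrev qshift (n : ℤ) (M : DGMod A) : DGMod A where
  carrier := M.carrier
  gr i := M.gr (i.1, i.2 - n)
  internal := reindex_isInternal M.internal ((Equiv.refl ℤ).prodCongr (Equiv.subRight n))
  act := M.act
  act_mem := fun ha hm => M.act_mem ha hm
  d := M.d
  d_mem := fun hm => M.d_mem hm
  d_d := M.d_d
  leibniz := fun ha m => M.leibniz ha m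

/-- The cone `N ⊕ M[1]` of a homomorphism `f : M → N` of dg modules, with differential
`(n, m) ↦ (d n + f m, - d m)`. -/
abbrev cone {M N : DGMod A} (f : homZ 0 M N) : DGMod A where
  carrier := N.carrier × M.carrier
  gr i := (N.gr i).prod (M.shift.gr i)
  internal := prod_isInternal N.internal M.shift.internal
  act := AlgHom.ofLinearMap
    { toFun := fun a => (N.act a).prodMap (M.act (A.eps a))
      map_add' := fun a b => by ext <;> simp
      map_smul' := fun c a => by ext <;> simp }
    (by ext <;> simp) (fun a b => by ext <;> simp)
  act_mem := fun ha hm => ⟨N.act_mem ha hm.1, M.shift.act_mem ha hm.2⟩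
  d := (N.d.comp (LinearMap.fst k _ _) + f.1.comp (LinearMap.snd k _ _)).prod
    ((-M.d).comp (LinearMap.snd k _ _))
  d_mem := by
    intro p q m hm
    refine ⟨Submodule.add_mem _ (N.d_mem hm.1) ?_, M.shift.d_mem hm.2⟩
    have := f.2.1.1 _ _ _ hm.2
    rwa [add_zero] at this
  d_d := by
    rintro ⟨n, m⟩
    simp [N.d_d, M.d_d, homZ_comm f.2]
  leibniz := by
    rintro i a ha ⟨n, m⟩
    refine Prod.ext ?_ (M.shift.leibniz ha m)
    change N.d (N.act a n) + f.1 (M.act (A.eps a) m) =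
      N.act (A.d a) n + sg k i • N.act a (N.d n + f.1 m)
    rw [N.leibniz ha, A.eps_of_mem ha, map_smul, LinearMap.smul_apply, map_smul, homZ_act f.2,
      map_add, smul_add, add_assoc]

/-- There is a distinguished triangle `P₁ → P₂ → P₃ → P₁[1]` in the homotopy category: up to
isomorphism in that category it is `X → Y → cone f → X[1]` for some `f : X → Y`. -/
def IsTriangle (P₁ P₂ P₃ : DGMod A) : Prop :=
  ∃ (X Y : DGMod A) (f : homZ 0 X Y),
    HtpyEquiv P₁ X ∧ HtpyEquiv P₂ Y ∧ HtpyEquiv P₃ (cone f)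

/-- The free module `A` of rank one, with its generator in bidegree `(0, 0)`. -/
abbrev regular (A : DGAlg k) : DGMod A where
  carrier := A.carrier
  gr i := if i.2 = 0 then A.gr i.1 else ⊥
  internal := by
    refine isInternal_of_coaction _ (fun x => ?_)
      ((Finsupp.lmapDomain A.carrier k fun i : ℤ => (i, (0 : ℤ))).comp (coact A.internal))
      (fun i x hx => ?_)
    · refine hom_induction A.internal (p := fun x => x ∈ _) (Submodule.zero_mem _)
        (fun x y hx hy => Submodule.add_mem _ hx hy) (fun i x hx => ?_) x
      refine (le_iSup (fun i : ℤ × ℤ => if i.2 = 0 then A.gr i.1 else ⊥) (i, 0)) ?_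
      simpa using hx
    · obtain ⟨p, q⟩ := i
      by_cases hq : q = 0
      · subst hq
        rw [if_pos rfl] at hx
        simp [coact_of_mem A.internal hx, Finsupp.mapDomain_single]
      · rw [if_neg hq, Submodule.mem_bot] at hx
        simp [hx]
  act := Algebra.lmul k A.carrier
  act_mem := by
    intro i p q a m ha hm
    by_cases hq : q = 0
    · simp only [hq, if_true] at hm ⊢
      exact A.mul_mem ha hm
    · simp only [hq, if_false, Submodule.mem_bot] at hm ⊢
      simp [hm]
  d := A.d
  d_mem := by
    intro p q m hm
    by_cases hq : q = 0
    · simp only [hq, if_true] at hm ⊢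
      exact A.d_mem hm
    · simp only [hq, if_false, Submodule.mem_bot] at hm ⊢
      simp [hm]
  d_d := A.d_d
  leibniz := fun ha m => A.leibniz ha m

/-- The restriction of a dg module along a homomorphism of dg algebras. -/
abbrev restrict {B : DGAlg k} (φ : DGHom A B) (M : DGMod B) : DGMod A where
  carrier := M.carrier
  gr := M.gr
  internal := M.internal
  act := M.act.comp φ.toAlgHom
  act_mem := fun ha hm => M.act_mem (φ.map_mem ha) hm
  d := M.d
  d_mem := fun hm => M.d_mem hm
  d_d := M.d_d
  leibniz := fun ha m => by
    rw [AlgHom.comp_apply, AlgHom.comp_apply, φ.map_d]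
    exact M.leibniz (φ.map_mem ha) m

end DGMod

/-! ### The Grothendieck group -/

/-- The ring `ℤ[q, q⁻¹]`. -/
abbrev Zq : Type := LaurentPolynomial ℤ

/-- Compact projective graded dg modules. -/
def DGMod.IsPerf {A : DGAlg k} (P : DGMod A) : Prop := P.IsProjective ∧ P.IsCompact

/-- Objects of the category of compact projective graded dg modules. -/
def Perf (A : DGAlg k) : Type (u + 1) := {P : DGMod A // P.IsPerf}

/-- The defining relations of the Grothendieck group. -/
inductive K0Rel (A : DGAlg k) : (Perf A →₀ Zq) → Prop
  | shift (P P' : Perf A) (h : P'.1.HtpyEquiv P.1.shift) :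
      K0Rel A (Finsupp.single P' 1 + Finsupp.single P 1)
  | triangle (P₁ P₂ P₃ : Perf A) (h : DGMod.IsTriangle P₁.1 P₂.1 P₃.1) :
      K0Rel A (Finsupp.single P₂ 1 - (Finsupp.single P₁ 1 + Finsupp.single P₃ 1))
  | qshift (n : ℤ) (P P' : Perf A) (h : P'.1.HtpyEquiv (P.1.qshift n)) :
      K0Rel A (Finsupp.single P' 1 - Finsupp.single P (LaurentPolynomial.T n))

/-- The Grothendieck group of the category of compact projective graded dg modules, as a
`ℤ[q, q⁻¹]`-module: generators `[P]`, relations `[P[1]] = -[P]`, `[P₂] = [P₁] + [P₃]` for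
distinguished triangles, `[P{n}] = q ^ n [P]`. -/
abbrev K0 (A : DGAlg k) : Type (u + 1) :=
  (Perf A →₀ Zq) ⧸ Submodule.span Zq {x | K0Rel A x}

/-- The symbol `[P]` of a compact projective dg module. -/
def K0.cls {A : DGAlg k} (P : DGMod A) (hP : P.IsPerf) : K0 A :=
  Submodule.Quotient.mk (Finsupp.single (⟨P, hP⟩ : Perf A) 1)

/-! ### The LOT dg algebras -/

section LOT

variable (k) (n : ℕ)

/-- Indices of the generators of `H⁻ₙ`: the index `i : ℕ` with `i + 1 < n` stands for the
generator `σ_{i+1}` among `σ_1, …, σ_{n-1}`. -/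
abbrev LIdx (n : ℕ) : Type := {i : ℕ // i + 1 < n}

/-- The defining relations of `H⁻ₙ`. -/
inductive LOTRel : FreeAlgebra k (LIdx n) → FreeAlgebra k (LIdx n) → Prop
  | sq (i : LIdx n) : LOTRel (FreeAlgebra.ι k i * FreeAlgebra.ι k i) 0
  | anti (i j : LIdx n) (h : i.1 + 1 < j.1 ∨ j.1 + 1 < i.1) :
      LOTRel (FreeAlgebra.ι k i * FreeAlgebra.ι k j + FreeAlgebra.ι k j * FreeAlgebra.ι k i) 0
  | braid (i j : LIdx n) (h : i.1 + 1 = j.1) :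
      LOTRel (FreeAlgebra.ι k i * FreeAlgebra.ι k j * FreeAlgebra.ι k i)
        (FreeAlgebra.ι k j * FreeAlgebra.ι k i * FreeAlgebra.ι k j)

/-- The algebra `H⁻ₙ` (without grading and differential). -/
def LOTAlg : Type u := RingQuot (LOTRel k n)

instance : Ring (LOTAlg k n) := inferInstanceAs (Ring (RingQuot (LOTRel k n)))

instance : Algebra k (LOTAlg k n) := inferInstanceAs (Algebra k (RingQuot (LOTRel k n)))

/-- The quotient map from the free algebra. -/
def LOTmk : FreeAlgebra k (LIdx n) →ₐ[k] LOTAlg k n := RingQuot.mkAlgHom k (LOTRel k n)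

theorem LOTmk_rel {x y : FreeAlgebra k (LIdx n)} (h : LOTRel k n x y) :
    LOTmk k n x = LOTmk k n y :=
  RingQuot.mkAlgHom_rel k h

variable {n}

/-- The generators of `H⁻ₙ`. -/
def sig (i : LIdx n) : LOTAlg k n := LOTmk k n (FreeAlgebra.ι k i)

theorem sig_sq (i : LIdx n) : sig k i * sig k i = 0 := by
  have h := LOTmk_rel k n (LOTRel.sq (k := k) i)
  rwa [map_mul, map_zero] at h

theorem sig_anti (i j : LIdx n) (h : i.1 + 1 < j.1 ∨ j.1 + 1 < i.1) :
    sig k i * sig k j + sig k j * sig k i = 0 := by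
  have h := LOTmk_rel k n (LOTRel.anti (k := k) i j h)
  rwa [map_add, map_mul, map_mul, map_zero] at h

theorem sig_braid (i j : LIdx n) (h : i.1 + 1 = j.1) :
    sig k i * sig k j * sig k i = sig k j * sig k i * sig k j := by
  have h := LOTmk_rel k n (LOTRel.braid (k := k) i j h)
  rwa [map_mul, map_mul, map_mul, map_mul] at h

/-- The universal property of `H⁻ₙ`. -/
def LOTlift {B : Type*} [Ring B] [Algebra k B] (f : LIdx n → B) (h1 : ∀ i, f i * f i = 0)
    (h2 : ∀ i j : LIdx n, i.1 + 1 < j.1 ∨ j.1 + 1 < i.1 → f i * f j + f j * f i = 0)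
    (h3 : ∀ i j : LIdx n, i.1 + 1 = j.1 → f i * f j * f i = f j * f i * f j) :
    LOTAlg k n →ₐ[k] B :=
  show RingQuot (LOTRel k n) →ₐ[k] B from RingQuot.liftAlgHom k ⟨FreeAlgebra.lift k f, by
    intro x y h
    cases h with
    | sq i => simp [h1]
    | anti i j h => simp [h2 i j h]
    | braid i j h => simp [h3 i j h]⟩

theorem LOTlift_sig {B : Type*} [Ring B] [Algebra k B] (f : LIdx n → B) (h1 : ∀ i, f i * f i = 0)
    (h2 : ∀ i j : LIdx n, i.1 + 1 < j.1 ∨ j.1 + 1 < i.1 → f i * f j + f j * f i = 0)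
    (h3 : ∀ i j : LIdx n, i.1 + 1 = j.1 → f i * f j * f i = f j * f i * f j) (i : LIdx n) :
    LOTlift k f h1 h2 h3 (sig k i) = f i :=
  (RingQuot.liftAlgHom_mkAlgHom_apply k (FreeAlgebra.lift k f) _ (FreeAlgebra.ι k i)).trans
    (FreeAlgebra.lift_ι_apply f i)

/-- The product of a sequence of generators. -/
def word (l : List (LIdx n)) : LOTAlg k n := (l.map (sig k)).prod

theorem word_nil : word k ([] : List (LIdx n)) = 1 := rfl

theorem word_cons (i : LIdx n) (l : List (LIdx n)) : word k (i :: l) = sig k i * word k l := by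
  simp [word]

theorem word_append (l l' : List (LIdx n)) : word k (l ++ l') = word k l * word k l' := by
  simp [word]

variable (n) in
/-- The cohomological grading of `H⁻ₙ`, with `deg σ_i = -1`. -/
def LOTgr (i : ℤ) : Submodule k (LOTAlg k n) :=
  Submodule.span k {x | ∃ l : List (LIdx n), (l.length : ℤ) = -i ∧ word k l = x}

theorem word_mem (l : List (LIdx n)) : word k l ∈ LOTgr k n (-(l.length : ℤ)) :=
  Submodule.subset_span ⟨l, by simp, rfl⟩

theorem LOT_span (x : LOTAlg k n) : x ∈ Submodule.span k (Set.range (word k (n := n))) := by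
  obtain ⟨y, rfl⟩ : ∃ y, LOTmk k n y = x := RingQuot.mkAlgHom_surjective k (LOTRel k n) x
  induction y using FreeAlgebra.induction with
  | grade0 r =>
    rw [AlgHom.commutes, Algebra.algebraMap_eq_smul_one]
    exact Submodule.smul_mem _ _ (Submodule.subset_span ⟨[], rfl⟩)
  | grade1 i => exact Submodule.subset_span ⟨[i], by simp [word, sig]⟩
  | add a b ha hb => rw [map_add]; exact Submodule.add_mem _ ha hb
  | mul a b ha hb =>
    rw [map_mul]
    have h := Submodule.mul_mem_mul ha hb
    rw [Submodule.span_mul_span] at h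
    refine Submodule.span_mono ?_ h
    rintro _ ⟨_, ⟨l, rfl⟩, _, ⟨l', rfl⟩, rfl⟩
    exact ⟨l ++ l', word_append k l l'⟩

/-- The algebra homomorphism that encodes the grading. -/
def LOTcoact : LOTAlg k n →ₐ[k] AddMonoidAlgebra (LOTAlg k n) ℤ :=
  LOTlift k (fun i => AddMonoidAlgebra.single (-1) (sig k i))
    (fun i => by
      rw [AddMonoidAlgebra.single_mul_single, sig_sq, AddMonoidAlgebra.single_zero])
    (fun i j h => by
      rw [AddMonoidAlgebra.single_mul_single, AddMonoidAlgebra.single_mul_single,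
        ← AddMonoidAlgebra.single_add, sig_anti k i j h, AddMonoidAlgebra.single_zero])
    (fun i j h => by simp only [AddMonoidAlgebra.single_mul_single, sig_braid k i j h])

theorem LOTcoact_word (l : List (LIdx n)) :
    LOTcoact k (word k l) = AddMonoidAlgebra.single (-(l.length : ℤ)) (word k l) := by
  induction l with
  | nil => rw [word_nil, map_one, List.length_nil, Nat.cast_zero, neg_zero, AddMonoidAlgebra.one_def]
  | cons i l ih =>
    rw [word_cons, map_mul, ih, LOTcoact, LOTlift_sig, AddMonoidAlgebra.single_mul_single]
    congr 1
    push_cast [List.length_cons]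
    ring

theorem LOT_internal : DirectSum.IsInternal (LOTgr k n) := by
  refine isInternal_of_coaction _ (fun x => ?_)
    { toFun := fun x => (LOTcoact k x).coeff
      map_add' := fun x y => by simp
      map_smul' := fun c x => by simp } (fun i x hx => ?_)
  · refine (Submodule.span_le.2 ?_) (LOT_span k x)
    rintro _ ⟨l, rfl⟩
    exact (le_iSup (LOTgr k n) _) (word_mem k l)
  · induction hx using Submodule.span_induction with
    | mem x hx =>
      obtain ⟨l, hl, rfl⟩ := hx
      change (LOTcoact k (word k l)).coeff = _
      rw [LOTcoact_word, hl, neg_neg, AddMonoidAlgebra.coeff_single]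
    | zero => simp
    | add a b _ _ ha hb => rw [map_add, ha, hb, Finsupp.single_add]
    | smul r a _ ha => rw [map_smul, ha, Finsupp.smul_single]

/-- The algebra homomorphism `a ↦ !![(-1) ^ deg a • a, d a; 0, a]` that encodes the differential. -/
def LOTmat : LOTAlg k n →ₐ[k] Matrix (Fin 2) (Fin 2) (LOTAlg k n) :=
  LOTlift k (fun i => !![-sig k i, 1; 0, sig k i])
    (fun i => by
      ext a b
      fin_cases a <;> fin_cases b <;> simp [Matrix.mul_apply, sig_sq])
    (fun i j h => by
      ext a b
      fin_cases a <;> fin_cases b <;> simp [sig_anti k i j h])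
    (fun i j h => by
      ext a b
      fin_cases a <;> fin_cases b <;>
        simp [Matrix.mul_apply, sig_braid k i j h, sig_sq, add_mul]
      abel)

theorem LOTmat_sig (i : LIdx n) : LOTmat k (sig k i) = !![-sig k i, 1; 0, sig k i] := by
  rw [LOTmat, LOTlift_sig]

/-- The differential of `H⁻ₙ`. -/
def LOTd : LOTAlg k n →ₗ[k] LOTAlg k n :=
  (Matrix.entryLinearMap k (LOTAlg k n) (0 : Fin 2) (1 : Fin 2)).comp (LOTmat k).toLinearMap

theorem LOTd_apply (x : LOTAlg k n) : LOTd k x = LOTmat k x 0 1 := rfl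

theorem LOTd_sig (i : LIdx n) : LOTd k (sig k i) = 1 := by simp [LOTd_apply, LOTmat_sig]

theorem LOTd_one : LOTd k (1 : LOTAlg k n) = 0 := by simp [LOTd_apply]

theorem LOTmat_word (l : List (LIdx n)) : LOTmat k (word k l) 1 0 = 0 ∧
    LOTmat k (word k l) 1 1 = word k l ∧
    LOTmat k (word k l) 0 0 = sg k (-(l.length : ℤ)) • word k l := by
  induction l with
  | nil => simp [word_nil, sg_zero]
  | cons i l ih =>
    have e : sg k (-((i :: l).length : ℤ)) = -sg k (-(l.length : ℤ)) := by
      rw [← neg_eq_iff_eq_neg, ← sg_succ]; simp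
    rw [e, word_cons, map_mul, LOTmat_sig]
    simp [Matrix.mul_apply, ih]

theorem LOTmat_one_one (x : LOTAlg k n) : LOTmat k x 1 1 = x := by
  induction LOT_span k x using Submodule.span_induction with
  | mem x hx => obtain ⟨l, rfl⟩ := hx; exact (LOTmat_word k l).2.1
  | zero => simp
  | add a b _ _ ha hb => simp [ha, hb]
  | smul r a _ ha => simp [ha]

theorem LOTmat_zero_zero {i : ℤ} {x : LOTAlg k n} (hx : x ∈ LOTgr k n i) :
    LOTmat k x 0 0 = sg k i • x := by
  induction hx using Submodule.span_induction with
  | mem x hx =>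
    obtain ⟨l, hl, rfl⟩ := hx
    rw [(LOTmat_word k l).2.2, hl, neg_neg]
  | zero => simp
  | add a b _ _ ha hb => simp [ha, hb]
  | smul r a _ ha => simp [ha, smul_comm r]

theorem LOTd_leibniz {i : ℤ} {x : LOTAlg k n} (hx : x ∈ LOTgr k n i) (y : LOTAlg k n) :
    LOTd k (x * y) = LOTd k x * y + sg k i • (x * LOTd k y) := by
  rw [LOTd_apply, map_mul, Matrix.mul_apply, Fin.sum_univ_two, LOTmat_zero_zero k hx,
    LOTmat_one_one, LOTd_apply, LOTd_apply, add_comm, smul_mul_assoc]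

theorem LOTd_sig_mul (i : LIdx n) (x : LOTAlg k n) :
    LOTd k (sig k i * x) = x - sig k i * LOTd k x := by
  rw [LOTd_apply, map_mul, Matrix.mul_apply, Fin.sum_univ_two, LOTmat_sig, LOTmat_one_one,
    LOTd_apply]
  simp; abel

theorem LOTgr_mul {i j : ℤ} {x y : LOTAlg k n} (hx : x ∈ LOTgr k n i) (hy : y ∈ LOTgr k n j) :
    x * y ∈ LOTgr k n (i + j) := by
  have h := Submodule.mul_mem_mul hx hy
  rw [LOTgr, LOTgr, Submodule.span_mul_span] at h
  refine Submodule.span_mono ?_ h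
  rintro _ ⟨_, ⟨l, hl, rfl⟩, _, ⟨l', hl', rfl⟩, rfl⟩
  exact ⟨l ++ l', by rw [List.length_append]; push_cast; omega, word_append k l l'⟩

theorem LOTd_word_mem (l : List (LIdx n)) : LOTd k (word k l) ∈ LOTgr k n (-(l.length : ℤ) + 1) := by
  induction l with
  | nil => rw [word_nil, LOTd_one]; exact Submodule.zero_mem _
  | cons i l ih =>
    rw [word_cons, LOTd_sig_mul]
    have e1 : -((i :: l).length : ℤ) + 1 = -(l.length : ℤ) := by simp
    have e2 : -(l.length : ℤ) = -1 + (-(l.length : ℤ) + 1) := by ring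
    have h := LOTgr_mul k (word_mem k [i]) ih
    rw [word_cons, word_nil, mul_one] at h
    rw [e1]
    refine Submodule.sub_mem _ (word_mem k l) ?_
    rw [e2]
    exact h

theorem LOTd_d_word (l : List (LIdx n)) : LOTd k (LOTd k (word k l)) = 0 := by
  induction l with
  | nil => rw [word_nil, LOTd_one, map_zero]
  | cons i l ih => rw [word_cons, LOTd_sig_mul, map_sub, LOTd_sig_mul, ih]; simp

variable (n) in
/-- The dg algebra `H⁻ₙ`. -/
def LOT : DGAlg k where
  carrier := LOTAlg k n
  gr := LOTgr k n
  internal := LOT_internal k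
  one_mem := Submodule.subset_span ⟨[], by simp, rfl⟩
  mul_mem := LOTgr_mul k
  d := LOTd k
  d_mem := by
    intro i x hx
    induction hx using Submodule.span_induction with
    | mem x hx =>
      obtain ⟨l, hl, rfl⟩ := hx
      have h := LOTd_word_mem k l
      rwa [hl, neg_neg] at h
    | zero => simp
    | add a b _ _ ha hb => rw [map_add]; exact Submodule.add_mem _ ha hb
    | smul r a _ ha => rw [map_smul]; exact Submodule.smul_mem _ _ ha
  d_d := by
    intro x
    induction LOT_span k x using Submodule.span_induction with
    | mem x hx => obtain ⟨l, rfl⟩ := hx; exact LOTd_d_word k l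
    | zero => simp
    | add a b _ _ ha hb => simp [ha, hb]
    | smul r a _ ha => simp [ha]
  leibniz := LOTd_leibniz k

end LOT

/-! ### Super tensor products, outer tensor products and induction -/

section Tensor

/-- The differential `x ⊗ y ↦ d x ⊗ y + (-1) ^ deg x • x ⊗ d y`, where the sign is given by the
function `c` of the degree. -/
def tensorD {ι M N : Type*} [DecidableEq ι] [AddCommGroup M] [Module k M] [AddCommGroup N]
    [Module k N] {gr : ι → Submodule k M} (h : DirectSum.IsInternal gr) (c : ι → k)
    (dM : M →ₗ[k] M) (dN : N →ₗ[k] N) : M ⊗[k] N →ₗ[k] M ⊗[k] N :=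
  TensorProduct.map dM LinearMap.id + TensorProduct.map (gscale h c) dN

theorem tensorD_tmul {ι M N : Type*} [DecidableEq ι] [AddCommGroup M] [Module k M]
    [AddCommGroup N] [Module k N] {gr : ι → Submodule k M} (h : DirectSum.IsInternal gr)
    (c : ι → k) (dM : M →ₗ[k] M) (dN : N →ₗ[k] N) {i : ι} {x : M} (hx : x ∈ gr i) (y : N) :
    tensorD h c dM dN (x ⊗ₜ y) = dM x ⊗ₜ y + c i • (x ⊗ₜ dN y) := by
  simp [tensorD, gscale_of_mem h c hx, TensorProduct.smul_tmul']

/-- Scalars in the proofs of Leibniz rules. -/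
theorem sg_mul_succ (i j : ℤ) : sg k (j * (i + 1)) = sg k (j * i) * sg k j := by
  rw [mul_add, mul_one, sg_add]

theorem sg_succ_mul (i j : ℤ) : sg k ((j + 1) * i) = sg k (j * i) * sg k i := by
  rw [add_mul, one_mul, sg_add]

namespace DGAlg

variable (A B : DGAlg k)

/-- The tensor product of two elements, in the super tensor product. -/
def tm (a : A.carrier) (b : B.carrier) : GradedTensorProduct k A.gr B.gr :=
  GradedTensorProduct.tmul k a b

variable {A B}

theorem tm_mul_tm {i j : ℤ} (a : A.carrier) {b : B.carrier} (hb : b ∈ B.gr j) {a' : A.carrier}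
    (ha' : a' ∈ A.gr i) (b' : B.carrier) :
    tm A B a b * tm A B a' b' = sg k (j * i) • tm A B (a * a') (b * b') := by
  rw [← units_smul_eq]
  exact GradedTensorProduct.tmul_coe_mul_coe_tmul A.gr B.gr a ⟨b, hb⟩ ⟨a', ha'⟩ b'

theorem tm_induction {p : GradedTensorProduct k A.gr B.gr → Prop} (h0 : p 0)
    (hadd : ∀ x y, p x → p y → p (x + y))
    (hom : ∀ i j, ∀ a ∈ A.gr i, ∀ b ∈ B.gr j, p (tm A B a b)) (z) : p z :=
  tensor_hom_induction A.internal B.internal (p := p) h0 hadd hom z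

variable (A B)

/-- The grading of the super tensor product. -/
def tensorGrading (t : ℤ) : Submodule k (GradedTensorProduct k A.gr B.gr) :=
  (tensorGr (fun i j : ℤ => i + j) A.gr B.gr t).map (GradedTensorProduct.of k A.gr B.gr).toLinearMap

variable {A B}

theorem tm_mem {i j t : ℤ} {a : A.carrier} (ha : a ∈ A.gr i) {b : B.carrier} (hb : b ∈ B.gr j)
    (ht : i + j = t) : tm A B a b ∈ tensorGrading A B t :=
  ⟨_, tmul_mem_tensorGr ha hb ht, rfl⟩

theorem tensorGrading_induction {t : ℤ} {p : GradedTensorProduct k A.gr B.gr → Prop} (h0 : p 0)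
    (hadd : ∀ x y, p x → p y → p (x + y)) (hsmul : ∀ (c : k) x, p x → p (c • x))
    (hom : ∀ i j, i + j = t → ∀ a ∈ A.gr i, ∀ b ∈ B.gr j, p (tm A B a b))
    {z : GradedTensorProduct k A.gr B.gr} (hz : z ∈ tensorGrading A B t) : p z := by
  obtain ⟨z, hz, rfl⟩ := hz
  refine Submodule.span_induction (p := fun z _ => p (GradedTensorProduct.of k A.gr B.gr z))
    ?_ h0 (fun x y _ _ hx hy => hadd _ _ hx hy) (fun c x _ hx => hsmul c _ hx) hz
  rintro _ ⟨i, j, a, ha, b, hb, hij, rfl⟩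
  exact hom i j hij a ha b hb

variable (A B)

/-- The differential of the super tensor product. -/
def tensorDiff : GradedTensorProduct k A.gr B.gr →ₗ[k] GradedTensorProduct k A.gr B.gr :=
  (GradedTensorProduct.of k A.gr B.gr).toLinearMap.comp
    ((tensorD A.internal (sg k) A.d B.d).comp (GradedTensorProduct.of k A.gr B.gr).symm.toLinearMap)

variable {A B}

theorem tensorDiff_tm {i : ℤ} {a : A.carrier} (ha : a ∈ A.gr i) (b : B.carrier) :
    tensorDiff A B (tm A B a b) = tm A B (A.d a) b + sg k i • tm A B a (B.d b) := by
  change GradedTensorProduct.of k A.gr B.gr (tensorD A.internal (sg k) A.d B.d (a ⊗ₜ b)) = _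
  rw [tensorD_tmul A.internal (sg k) A.d B.d ha, map_add, map_smul]
  rfl

theorem tm_add_left (a a' : A.carrier) (b : B.carrier) :
    tm A B (a + a') b = tm A B a b + tm A B a' b :=
  TensorProduct.add_tmul a a' b

theorem tm_add_right (a : A.carrier) (b b' : B.carrier) :
    tm A B a (b + b') = tm A B a b + tm A B a b' :=
  TensorProduct.tmul_add a b b'

theorem tm_smul_left (c : k) (a : A.carrier) (b : B.carrier) :
    tm A B (c • a) b = c • tm A B a b :=
  (TensorProduct.smul_tmul' c a b).symm

theorem tm_smul_right (c : k) (a : A.carrier) (b : B.carrier) :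
    tm A B a (c • b) = c • tm A B a b :=
  TensorProduct.tmul_smul c a b

theorem tm_zero_left (b : B.carrier) : tm A B 0 b = 0 :=
  TensorProduct.zero_tmul _ b

theorem tm_zero_right (a : A.carrier) : tm A B a 0 = 0 :=
  TensorProduct.tmul_zero _ a

variable (A B)

/-- The tensor product of dg algebras in the category of super vector spaces:
`(a ⊗ b) (a' ⊗ b') = (-1) ^ (deg b * deg a') a a' ⊗ b b'`. -/
abbrev tensor : DGAlg k where
  carrier := GradedTensorProduct k A.gr B.gr
  gr := tensorGrading A B
  internal := map_isInternal (GradedTensorProduct.of k A.gr B.gr)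
    (tensor_isInternal _ A.internal B.internal)
  one_mem := tm_mem A.one_mem B.one_mem rfl
  mul_mem := by
    intro i j z w hz hw
    refine tensorGrading_induction (p := fun z => z * w ∈ tensorGrading A B (i + j))
      (by simp) (fun x y hx hy => by rw [add_mul]; exact Submodule.add_mem _ hx hy)
      (fun c x hx => by rw [smul_mul_assoc]; exact Submodule.smul_mem _ _ hx)
      (fun i1 i2 hi a ha b hb => ?_) hz
    refine tensorGrading_induction (p := fun w => tm A B a b * w ∈ tensorGrading A B (i + j))
      (by simp) (fun x y hx hy => by rw [mul_add]; exact Submodule.add_mem _ hx hy)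
      (fun c x hx => by rw [mul_smul_comm]; exact Submodule.smul_mem _ _ hx)
      (fun j1 j2 hj a' ha' b' hb' => ?_) hw
    rw [tm_mul_tm a hb ha' b']
    exact Submodule.smul_mem _ _ (tm_mem (A.mul_mem ha ha') (B.mul_mem hb hb') (by omega))
  d := tensorDiff A B
  d_mem := by
    intro i z hz
    refine tensorGrading_induction (p := fun z => tensorDiff A B z ∈ tensorGrading A B (i + 1))
      (by simp) (fun x y hx hy => by rw [map_add]; exact Submodule.add_mem _ hx hy)
      (fun c x hx => by rw [map_smul]; exact Submodule.smul_mem _ _ hx)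
      (fun i1 i2 hi a ha b hb => ?_) hz
    rw [tensorDiff_tm ha]
    exact Submodule.add_mem _ (tm_mem (A.d_mem ha) hb (by omega))
      (Submodule.smul_mem _ _ (tm_mem ha (B.d_mem hb) (by omega)))
  d_d := by
    refine tm_induction (p := fun z => tensorDiff A B (tensorDiff A B z) = 0) (by simp)
      (fun x y hx hy => by rw [map_add, map_add, hx, hy, add_zero]) (fun i j a ha b hb => ?_)
    rw [tensorDiff_tm ha, map_add, map_smul, tensorDiff_tm (A.d_mem ha), tensorDiff_tm ha, A.d_d,
      B.d_d, tm_zero_left, tm_zero_right, sg_succ]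
    module
  leibniz := by
    intro t z hz w
    refine tensorGrading_induction (p := fun z => tensorDiff A B (z * w) =
        tensorDiff A B z * w + sg k t • (z * tensorDiff A B w)) (by simp)
      (fun x y hx hy => by rw [add_mul, map_add, hx, hy, map_add, add_mul, add_mul]; module)
      (fun c x hx => by
        rw [smul_mul_assoc, map_smul, hx, map_smul, smul_mul_assoc, smul_mul_assoc]; module)
      (fun i j hij a ha b hb => ?_) hz
    refine tm_induction (p := fun w => tensorDiff A B (tm A B a b * w) =
        tensorDiff A B (tm A B a b) * w + sg k t • (tm A B a b * tensorDiff A B w)) (by simp)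
      (fun x y hx hy => by rw [mul_add, map_add, hx, hy, map_add, mul_add, mul_add]; module)
      (fun i' j' a' ha' b' hb' => ?_) w
    subst hij
    rw [tm_mul_tm a hb ha' b', map_smul, tensorDiff_tm (A.mul_mem ha ha'), tensorDiff_tm ha,
      tensorDiff_tm ha', A.leibniz ha, B.leibniz hb, add_mul, smul_mul_assoc, mul_add,
      mul_smul_comm, tm_mul_tm _ hb ha', tm_mul_tm _ (B.d_mem hb) ha', tm_mul_tm _ hb (A.d_mem ha'),
      tm_mul_tm _ hb ha', tm_add_left, tm_add_right, tm_smul_left, tm_smul_right, sg_add, sg_add,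
      sg_mul_succ, sg_succ_mul]
    have hj := sg_mul_self k j
    generalize tm A B (A.d a * a') (b * b') = t1
    generalize tm A B (a * A.d a') (b * b') = t2
    generalize tm A B (a * a') (B.d b * b') = t3
    generalize tm A B (a * a') (b * B.d b') = t4
    match_scalars
    · ring
    · linear_combination (-(sg k (j * i') * sg k i)) * hj
    · ring
    · ring

/-- The automorphism `eps ^ p`. -/
def epsPow (p : ℤ) : A.carrier →ₐ[k] A.carrier :=
  if Even p then AlgHom.id k A.carrier else A.eps

theorem epsPow_of_mem (p : ℤ) {j : ℤ} {a : A.carrier} (ha : a ∈ A.gr j) :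
    A.epsPow p a = sg k (j * p) • a := by
  by_cases hp : Even p
  · rw [epsPow, if_pos hp, sg_even k (hp.mul_left j), one_smul]; rfl
  · rw [epsPow, if_neg hp, A.eps_of_mem ha]
    have hp' := Int.not_even_iff_odd.1 hp
    by_cases hj : Even j
    · rw [sg_even k hj, sg_even k (hj.mul_right p)]
    · have hj' := Int.not_even_iff_odd.1 hj
      rw [sg_odd k hj', sg_odd k (hj'.mul hp')]

end DGAlg

end Tensor

section Modules

namespace DGMod

section Outer

variable {A B : DGAlg k}

/-- The action of `1 ⊗ b` on `P ⊗ Q`: `p ⊗ q ↦ (-1) ^ (deg b * deg p) p ⊗ b q`. -/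
def outerActR (P : DGMod A) (Q : DGMod B) :
    B.carrier →ₗ[k] Module.End k (P.carrier ⊗[k] Q.carrier) where
  toFun b :=
    TensorProduct.map (gscale P.internal fun x => if Even x.1 then 1 else 0) (Q.act b) +
    TensorProduct.map (gscale P.internal fun x => if Even x.1 then 0 else 1) (Q.act (B.eps b))
  map_add' b b' := by
    simp only [map_add, TensorProduct.map_add_right]; abel
  map_smul' c b := by
    simp only [map_smul, TensorProduct.map_smul_right, RingHom.id_apply, smul_add]

theorem outerActR_tmul (P : DGMod A) (Q : DGMod B) (b : B.carrier) {x : ℤ × ℤ} {p : P.carrier}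
    (hp : p ∈ P.gr x) (q : Q.carrier) :
    outerActR P Q b (p ⊗ₜ q) = p ⊗ₜ Q.act (B.epsPow x.1 b) q := by
  simp only [outerActR, LinearMap.coe_mk, AddHom.coe_mk, LinearMap.add_apply,
    TensorProduct.map_tmul, gscale_of_mem P.internal _ hp, DGAlg.epsPow]
  by_cases hx : Even x.1 <;> simp [hx]

theorem outer_ext {P : DGMod A} {Q : DGMod B} {N : Type*} [AddCommGroup N] [Module k N]
    {f g : P.carrier ⊗[k] Q.carrier →ₗ[k] N}
    (h : ∀ x y, ∀ p ∈ P.gr x, ∀ q ∈ Q.gr y, f (p ⊗ₜ q) = g (p ⊗ₜ q)) : f = g := by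
  ext1
  refine LOTCat.hom_ext P.internal fun x p hp => LOTCat.hom_ext Q.internal fun y q hq => ?_
  exact h x y p hp q hq

/-- The action of `A ⊗ B` on `P ⊗ Q`: `(a ⊗ b) (p ⊗ q) = (-1) ^ (deg b * deg p) a p ⊗ b q`. -/
def outerAct (P : DGMod A) (Q : DGMod B) :
    GradedTensorProduct k A.gr B.gr →ₐ[k] Module.End k (P.carrier ⊗[k] Q.carrier) :=
  GradedTensorProduct.lift A.gr B.gr
    ((Module.End.rTensorAlgHom k P.carrier Q.carrier).comp P.act)
    (AlgHom.ofLinearMap (outerActR P Q)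
      (outer_ext fun x y p hp q hq => by
        rw [outerActR_tmul P Q _ hp, map_one, map_one]; rfl)
      (fun b b' => outer_ext fun x y p hp q hq => by
        rw [outerActR_tmul P Q _ hp, map_mul, map_mul, Module.End.mul_apply, Module.End.mul_apply,
          outerActR_tmul P Q _ hp, outerActR_tmul P Q _ hp]))
    (by
      rintro i j ⟨a, ha⟩ ⟨b, hb⟩
      rw [units_smul_eq k]
      refine outer_ext fun x y p hp q hq => ?_
      change (P.act a).rTensor Q.carrier (outerActR P Q b (p ⊗ₜ q)) =
        sg k (j * i) • outerActR P Q b ((P.act a).rTensor Q.carrier (p ⊗ₜ q))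
      obtain ⟨x1, x2⟩ := x
      rw [outerActR_tmul P Q _ hp, LinearMap.rTensor_tmul, LinearMap.rTensor_tmul,
        outerActR_tmul P Q _ (P.act_mem ha hp), B.epsPow_of_mem _ hb, B.epsPow_of_mem _ hb,
        map_smul, map_smul, LinearMap.smul_apply, LinearMap.smul_apply, TensorProduct.tmul_smul,
        TensorProduct.tmul_smul, smul_smul, mul_add, sg_add, ← mul_assoc, sg_mul_self, one_mul])

theorem outerAct_tmul (P : DGMod A) (Q : DGMod B) (a : A.carrier) {b : B.carrier} {j : ℤ}
    (hb : b ∈ B.gr j) {x : ℤ × ℤ} {p : P.carrier} (hp : p ∈ P.gr x) (q : Q.carrier) :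
    outerAct P Q (DGAlg.tm A B a b) (p ⊗ₜ q) =
      sg k (j * x.1) • (P.act a p ⊗ₜ[k] Q.act b q) := by
  change (P.act a).rTensor Q.carrier (outerActR P Q b (p ⊗ₜ q)) = _
  rw [outerActR_tmul P Q _ hp, B.epsPow_of_mem _ hb, map_smul, LinearMap.smul_apply,
    TensorProduct.tmul_smul, map_smul, LinearMap.rTensor_tmul]

/-- The outer tensor product `P ⊠ Q` of dg modules over `A` and `B`, a dg module over the super
tensor product `A ⊗ B`. -/
abbrev outer (P : DGMod A) (Q : DGMod B) : DGMod (A.tensor B) where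
  carrier := P.carrier ⊗[k] Q.carrier
  gr := tensorGr (fun x y : ℤ × ℤ => x + y) P.gr Q.gr
  internal := tensor_isInternal _ P.internal Q.internal
  act := outerAct P Q
  act_mem := by
    intro i p q z m hz hm
    refine DGAlg.tensorGrading_induction (p := fun z => outerAct P Q z m ∈
        tensorGr (fun x y : ℤ × ℤ => x + y) P.gr Q.gr (i + p, q))
      (by rw [map_zero]; exact Submodule.zero_mem _)
      (fun x y hx hy => by rw [map_add]; exact Submodule.add_mem _ hx hy)
      (fun c x hx => by rw [map_smul]; exact Submodule.smul_mem _ _ hx)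
      (fun i1 i2 hi a ha b hb => ?_) hz
    induction hm using Submodule.span_induction with
    | mem m hm =>
      obtain ⟨⟨x1, x2⟩, ⟨y1, y2⟩, u, hu, v, hv, hxy, rfl⟩ := hm
      rw [outerAct_tmul P Q a hb hu]
      refine Submodule.smul_mem _ _ (tmul_mem_tensorGr (P.act_mem ha hu) (Q.act_mem hb hv) ?_)
      simp only [Prod.mk_add_mk, Prod.mk.injEq] at hxy ⊢
      omega
    | zero => rw [map_zero]; exact Submodule.zero_mem _
    | add x y _ _ hx hy => rw [map_add]; exact Submodule.add_mem _ hx hy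
    | smul c x _ hx => rw [map_smul]; exact Submodule.smul_mem _ _ hx
  d := tensorD P.internal (fun x => sg k x.1) P.d Q.d
  d_mem := by
    intro p q m hm
    induction hm using Submodule.span_induction with
    | mem m hm =>
      obtain ⟨⟨x1, x2⟩, ⟨y1, y2⟩, u, hu, v, hv, hxy, rfl⟩ := hm
      simp only [Prod.mk_add_mk, Prod.mk.injEq] at hxy
      rw [tensorD_tmul _ _ _ _ hu]
      refine Submodule.add_mem _ (tmul_mem_tensorGr (P.d_mem hu) hv ?_)
        (Submodule.smul_mem _ _ (tmul_mem_tensorGr hu (Q.d_mem hv) ?_)) <;>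
      · simp only [Prod.mk_add_mk, Prod.mk.injEq]
        omega
    | zero => rw [map_zero]; exact Submodule.zero_mem _
    | add x y _ _ hx hy => rw [map_add]; exact Submodule.add_mem _ hx hy
    | smul c x _ hx => rw [map_smul]; exact Submodule.smul_mem _ _ hx
  d_d := by
    refine tensor_hom_induction P.internal Q.internal (by simp)
      (fun x y hx hy => by rw [map_add, map_add, hx, hy, add_zero]) (fun x y p hp q hq => ?_)
    obtain ⟨x1, x2⟩ := x
    rw [tensorD_tmul _ _ _ _ hp, map_add, map_smul, tensorD_tmul _ _ _ _ (P.d_mem hp),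
      tensorD_tmul _ _ _ _ hp, P.d_d, Q.d_d, TensorProduct.zero_tmul, TensorProduct.tmul_zero,
      sg_succ]
    module
  leibniz := by
    intro t z hz m
    refine DGAlg.tensorGrading_induction (p := fun z =>
        tensorD P.internal (fun x => sg k x.1) P.d Q.d (outerAct P Q z m) =
        outerAct P Q (DGAlg.tensorDiff A B z) m +
          sg k t • outerAct P Q z (tensorD P.internal (fun x => sg k x.1) P.d Q.d m))
      (by simp)
      (fun x y hx hy => by
        simp only [map_add, LinearMap.add_apply, hx, hy]; module)
      (fun c x hx => by
        simp only [map_smul, LinearMap.smul_apply, hx]; module)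
      (fun i j hij a ha b hb => ?_) hz
    refine tensor_hom_induction P.internal Q.internal (p := fun m =>
        tensorD P.internal (fun x => sg k x.1) P.d Q.d (outerAct P Q (DGAlg.tm A B a b) m) =
        outerAct P Q (DGAlg.tensorDiff A B (DGAlg.tm A B a b)) m +
          sg k t • outerAct P Q (DGAlg.tm A B a b)
            (tensorD P.internal (fun x => sg k x.1) P.d Q.d m))
      (by simp)
      (fun x y hx hy => by
        simp only [map_add, hx, hy]; module)
      (fun x y p hp q hq => ?_) m
    obtain ⟨x1, x2⟩ := x
    subst hij
    rw [outerAct_tmul P Q a hb hp, map_smul, tensorD_tmul _ _ _ _ (P.act_mem ha hp),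
      tensorD_tmul _ _ _ _ hp, DGAlg.tensorDiff_tm ha, map_add, map_smul, LinearMap.add_apply,
      LinearMap.smul_apply, map_add, map_smul, outerAct_tmul P Q _ hb hp,
      outerAct_tmul P Q _ (B.d_mem hb) hp, outerAct_tmul P Q _ hb (P.d_mem hp),
      outerAct_tmul P Q _ hb hp, P.leibniz ha, Q.leibniz hb, TensorProduct.add_tmul,
      TensorProduct.tmul_add, ← TensorProduct.smul_tmul', TensorProduct.tmul_smul]
    simp only [sg_add, sg_mul_succ, sg_succ_mul]
    have hj := sg_mul_self k j
    generalize P.act (A.d a) p ⊗ₜ[k] Q.act b q = t1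
    generalize P.act a (P.d p) ⊗ₜ[k] Q.act b q = t2
    generalize P.act a p ⊗ₜ[k] Q.act (B.d b) q = t3
    generalize P.act a p ⊗ₜ[k] Q.act b (Q.d q) = t4
    match_scalars
    · ring
    · linear_combination (-(sg k (j * x1) * sg k i)) * hj
    · ring
    · ring

end Outer

section Extend

variable {A C : DGAlg k} (φ : DGHom A C) (M : DGMod A)

/-- The relations `c φ(a) ⊗ m = c ⊗ a m` that define `C ⊗_A M` as a quotient of `C ⊗_k M`. -/
def extRel : Submodule k (C.carrier ⊗[k] M.carrier) :=
  Submodule.span k {z | ∃ c a m, (c * φ.toAlgHom a) ⊗ₜ[k] m - c ⊗ₜ[k] M.act a m = z}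

theorem extRel_le {S : Submodule k (C.carrier ⊗[k] M.carrier)}
    (h : ∀ i j x, ∀ c ∈ C.gr i, ∀ a ∈ A.gr j, ∀ m ∈ M.gr x,
      (c * φ.toAlgHom a) ⊗ₜ[k] m - c ⊗ₜ[k] M.act a m ∈ S) : extRel φ M ≤ S := by
  refine Submodule.span_le.2 ?_
  rintro _ ⟨c, a, m, rfl⟩
  rw [SetLike.mem_coe]
  refine hom_induction C.internal
    (p := fun c => (c * φ.toAlgHom a) ⊗ₜ[k] m - c ⊗ₜ[k] M.act a m ∈ S) (by simp)
    (fun x y hx hy => ?_) (fun i c hc => ?_) c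
  · rw [add_mul, TensorProduct.add_tmul, TensorProduct.add_tmul, add_sub_add_comm]
    exact S.add_mem hx hy
  refine hom_induction A.internal
    (p := fun a => (c * φ.toAlgHom a) ⊗ₜ[k] m - c ⊗ₜ[k] M.act a m ∈ S) (by simp)
    (fun x y hx hy => ?_) (fun j a ha => ?_) a
  · rw [map_add, map_add, mul_add, TensorProduct.add_tmul, LinearMap.add_apply,
      TensorProduct.tmul_add, add_sub_add_comm]
    exact S.add_mem hx hy
  refine hom_induction M.internal
    (p := fun m => (c * φ.toAlgHom a) ⊗ₜ[k] m - c ⊗ₜ[k] M.act a m ∈ S) (by simp)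
    (fun x y hx hy => ?_) (fun x m hm => h i j x c hc a ha m hm) m
  rw [map_add, TensorProduct.tmul_add, TensorProduct.tmul_add, add_sub_add_comm]
  exact S.add_mem hx hy

theorem rel_mem_extRel (c : C.carrier) (a : A.carrier) (m : M.carrier) :
    (c * φ.toAlgHom a) ⊗ₜ[k] m - c ⊗ₜ[k] M.act a m ∈ extRel φ M :=
  Submodule.subset_span ⟨c, a, m, rfl⟩

/-- The bigrading of `C ⊗_k M`. -/
def extGr : ℤ × ℤ → Submodule k (C.carrier ⊗[k] M.carrier) :=
  tensorGr (fun (i : ℤ) (x : ℤ × ℤ) => (i + x.1, x.2)) C.gr M.gr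

theorem extGr_internal : DirectSum.IsInternal (extGr (C := C) M) :=
  tensor_isInternal _ C.internal M.internal

theorem extRel_homogeneous (z : C.carrier ⊗[k] M.carrier) (hz : z ∈ extRel φ M) (x : ℤ × ℤ) :
    coact (extGr_internal (C := C) M) z x ∈ extRel φ M := by
  have h : extRel φ M ≤ (extRel φ M).comap
      ((Finsupp.lapply x).comp (coact (extGr_internal (C := C) M))) := by
    refine extRel_le φ M fun i j y c hc a ha m hm => ?_
    obtain ⟨y1, y2⟩ := y
    have h1 : (c * φ.toAlgHom a) ⊗ₜ[k] m - c ⊗ₜ[k] M.act a m ∈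
        extGr (C := C) M (i + j + y1, y2) :=
      Submodule.sub_mem _ (tmul_mem_tensorGr (C.mul_mem hc (φ.map_mem ha)) hm rfl)
        (tmul_mem_tensorGr hc (M.act_mem ha hm) (by rw [add_assoc]))
    rw [Submodule.mem_comap, LinearMap.comp_apply, coact_of_mem _ h1, Finsupp.lapply_apply,
      Finsupp.single_apply]
    split_ifs
    · exact rel_mem_extRel φ M c a m
    · exact Submodule.zero_mem _
  exact h hz

theorem extRel_mul (c' : C.carrier) :
    extRel φ M ≤ (extRel φ M).comap ((LinearMap.mulLeft k c').rTensor M.carrier) := by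
  refine Submodule.span_le.2 ?_
  rintro _ ⟨c, a, m, rfl⟩
  rw [SetLike.mem_coe, Submodule.mem_comap, map_sub, LinearMap.rTensor_tmul,
    LinearMap.rTensor_tmul, LinearMap.mulLeft_apply, LinearMap.mulLeft_apply, ← mul_assoc]
  exact rel_mem_extRel φ M (c' * c) a m

theorem extRel_d : extRel φ M ≤ (extRel φ M).comap (tensorD C.internal (sg k) C.d M.d) := by
  refine extRel_le φ M fun i j y c hc a ha m hm => ?_
  rw [Submodule.mem_comap, map_sub, tensorD_tmul _ _ _ _ (C.mul_mem hc (φ.map_mem ha)),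
    tensorD_tmul _ _ _ _ hc, C.leibniz hc, ← φ.map_d, M.leibniz ha]
  have h1 := rel_mem_extRel φ M (C.d c) a m
  have h2 := Submodule.smul_mem _ (sg k i) (rel_mem_extRel φ M c (A.d a) m)
  have h3 := Submodule.smul_mem _ (sg k (i + j)) (rel_mem_extRel φ M c a (M.d m))
  convert Submodule.add_mem _ (Submodule.add_mem _ h1 h2) h3 using 1
  simp only [TensorProduct.add_tmul, TensorProduct.tmul_add, ← TensorProduct.smul_tmul',
    TensorProduct.tmul_smul, sg_add]
  module

theorem extMk_ext {N : Type*} [AddCommGroup N] [Module k N]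
    {f g : (C.carrier ⊗[k] M.carrier) ⧸ extRel φ M →ₗ[k] N}
    (h : ∀ c m, f ((extRel φ M).mkQ (c ⊗ₜ m)) = g ((extRel φ M).mkQ (c ⊗ₜ m))) : f = g := by
  refine Submodule.linearMap_qext _ (TensorProduct.ext' fun c m => ?_)
  exact h c m

/-- The action of `C` on `C ⊗_A M`. -/
def extAct : C.carrier →ₐ[k] Module.End k ((C.carrier ⊗[k] M.carrier) ⧸ extRel φ M) :=
  AlgHom.ofLinearMap
    { toFun := fun c => Submodule.mapQ _ _ _ (extRel_mul φ M c)
      map_add' := fun c c' => extMk_ext φ M fun x m => by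
        simp only [Submodule.mkQ_apply, Submodule.mapQ_apply, LinearMap.add_apply,
          LinearMap.rTensor_tmul, LinearMap.mulLeft_apply, add_mul, TensorProduct.add_tmul,
          Submodule.Quotient.mk_add]
      map_smul' := fun r c => extMk_ext φ M fun x m => by
        simp only [Submodule.mkQ_apply, Submodule.mapQ_apply, LinearMap.smul_apply,
          LinearMap.rTensor_tmul, LinearMap.mulLeft_apply, smul_mul_assoc,
          ← TensorProduct.smul_tmul', Submodule.Quotient.mk_smul, RingHom.id_apply] }
    (extMk_ext φ M fun x m => by
      simp only [LinearMap.coe_mk, AddHom.coe_mk, Submodule.mkQ_apply, Submodule.mapQ_apply,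
        LinearMap.rTensor_tmul, LinearMap.mulLeft_apply, one_mul, Module.End.one_apply])
    (fun c c' => extMk_ext φ M fun x m => by
      simp only [LinearMap.coe_mk, AddHom.coe_mk, Submodule.mkQ_apply, Submodule.mapQ_apply,
        LinearMap.rTensor_tmul, LinearMap.mulLeft_apply, mul_assoc, Module.End.mul_apply])

theorem extAct_mkQ (c : C.carrier) (z : C.carrier ⊗[k] M.carrier) :
    extAct φ M c ((extRel φ M).mkQ z) =
      (extRel φ M).mkQ ((LinearMap.mulLeft k c).rTensor M.carrier z) := rfl

/-- The extension of scalars `C ⊗_A M` of a dg module along a homomorphism `φ : A → C` of dg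
algebras. -/
abbrev extend : DGMod C where
  carrier := (C.carrier ⊗[k] M.carrier) ⧸ extRel φ M
  gr x := (extGr (C := C) M x).map (extRel φ M).mkQ
  internal := quotient_isInternal (extGr_internal M) _ (extRel_homogeneous φ M)
  act := extAct φ M
  act_mem := by
    rintro i p q c _ hc ⟨z, hz, rfl⟩
    rw [extAct_mkQ]
    refine Submodule.mem_map_of_mem ?_
    induction hz using Submodule.span_induction with
    | mem z hz =>
      obtain ⟨j, ⟨x1, x2⟩, c', hc', m, hm, hx, rfl⟩ := hz
      rw [LinearMap.rTensor_tmul]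
      refine tmul_mem_tensorGr (C.mul_mem hc hc') hm ?_
      simp only [Prod.mk.injEq] at hx ⊢
      omega
    | zero => rw [map_zero]; exact Submodule.zero_mem _
    | add x y _ _ hx hy => rw [map_add]; exact Submodule.add_mem _ hx hy
    | smul r x _ hx => rw [map_smul]; exact Submodule.smul_mem _ _ hx
  d := Submodule.mapQ _ _ _ (extRel_d φ M)
  d_mem := by
    rintro p q _ ⟨z, hz, rfl⟩
    refine Submodule.mem_map_of_mem (p := extGr (C := C) M (p + 1, q))
      (r := tensorD C.internal (sg k) C.d M.d z) ?_
    induction hz using Submodule.span_induction with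
    | mem z hz =>
      obtain ⟨j, ⟨x1, x2⟩, c', hc', m, hm, hx, rfl⟩ := hz
      simp only [Prod.mk.injEq] at hx
      rw [tensorD_tmul _ _ _ _ hc']
      refine Submodule.add_mem _ (tmul_mem_tensorGr (C.d_mem hc') hm ?_)
        (Submodule.smul_mem _ _ (tmul_mem_tensorGr hc' (M.d_mem hm) ?_)) <;>
      · simp only [Prod.mk.injEq]
        omega
    | zero => rw [map_zero]; exact Submodule.zero_mem _
    | add x y _ _ hx hy => rw [map_add]; exact Submodule.add_mem _ hx hy
    | smul r x _ hx => rw [map_smul]; exact Submodule.smul_mem _ _ hx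
  d_d := by
    intro z
    obtain ⟨z, rfl⟩ := (extRel φ M).mkQ_surjective z
    rw [Submodule.mkQ_apply, Submodule.mapQ_apply, Submodule.mapQ_apply]
    refine (congrArg Submodule.Quotient.mk ?_).trans (Submodule.Quotient.mk_zero _)
    refine tensor_hom_induction C.internal M.internal (p := fun z =>
      tensorD C.internal (sg k) C.d M.d (tensorD C.internal (sg k) C.d M.d z) = 0) (by simp)
      (fun x y hx hy => by rw [map_add, map_add, hx, hy, add_zero]) (fun i x c hc m hm => ?_) z
    rw [tensorD_tmul _ _ _ _ hc, map_add, map_smul, tensorD_tmul _ _ _ _ (C.d_mem hc),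
      tensorD_tmul _ _ _ _ hc, C.d_d, M.d_d, TensorProduct.zero_tmul, TensorProduct.tmul_zero,
      sg_succ]
    module
  leibniz := by
    intro i c hc z
    obtain ⟨z, rfl⟩ := (extRel φ M).mkQ_surjective z
    rw [extAct_mkQ]
    refine Eq.trans (b := (extRel φ M).mkQ (tensorD C.internal (sg k) C.d M.d
      ((LinearMap.mulLeft k c).rTensor M.carrier z))) rfl ?_
    refine Eq.trans (b := (extRel φ M).mkQ ((LinearMap.mulLeft k (C.d c)).rTensor M.carrier z +
      sg k i • (LinearMap.mulLeft k c).rTensor M.carrier (tensorD C.internal (sg k) C.d M.d z)))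
      (congrArg _ ?_) rfl
    refine tensor_hom_induction C.internal M.internal (p := fun z =>
      tensorD C.internal (sg k) C.d M.d ((LinearMap.mulLeft k c).rTensor M.carrier z) =
      (LinearMap.mulLeft k (C.d c)).rTensor M.carrier z + sg k i •
        (LinearMap.mulLeft k c).rTensor M.carrier (tensorD C.internal (sg k) C.d M.d z)) (by simp)
      (fun x y hx hy => by simp only [map_add, hx, hy]; module) (fun j x c' hc' m hm => ?_) z
    rw [LinearMap.rTensor_tmul, LinearMap.rTensor_tmul, LinearMap.mulLeft_apply,
      LinearMap.mulLeft_apply, tensorD_tmul _ _ _ _ (C.mul_mem hc hc'), tensorD_tmul _ _ _ _ hc',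
      map_add, map_smul, LinearMap.rTensor_tmul, LinearMap.rTensor_tmul, LinearMap.mulLeft_apply,
      LinearMap.mulLeft_apply, C.leibniz hc, TensorProduct.add_tmul, ← TensorProduct.smul_tmul',
      sg_add]
    module

end Extend

end DGMod

end Modules

/-! ### The inclusions of LOT algebras, induction and restriction -/

section Inclusion

/-- The homomorphism `a ⊗ b ↦ f a * g b` out of a super tensor product, for two supercommuting
homomorphisms `f` and `g` of dg algebras. -/
def DGHom.ofTensor {A B C : DGAlg k} (f : DGHom A C) (g : DGHom B C)
    (hfg : ∀ {i j : ℤ} {a : A.carrier} {b : B.carrier}, a ∈ A.gr i → b ∈ B.gr j →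
      f.toAlgHom a * g.toAlgHom b = sg k (j * i) • (g.toAlgHom b * f.toAlgHom a)) :
    DGHom (A.tensor B) C where
  toAlgHom := GradedTensorProduct.lift A.gr B.gr f.toAlgHom g.toAlgHom (by
    rintro i j ⟨a, ha⟩ ⟨b, hb⟩
    rw [units_smul_eq k]
    exact hfg ha hb)
  map_mem := by
    intro i z hz
    generalize_proofs hF
    refine DGAlg.tensorGrading_induction (p := fun z =>
        GradedTensorProduct.lift A.gr B.gr f.toAlgHom g.toAlgHom hF z ∈ C.gr i)
      (by rw [map_zero]; exact Submodule.zero_mem _)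
      (fun x y hx hy => by rw [map_add]; exact Submodule.add_mem _ hx hy)
      (fun c x hx => by rw [map_smul]; exact Submodule.smul_mem _ _ hx)
      (fun i1 i2 hi a ha b hb => ?_) hz
    subst hi
    exact C.mul_mem (f.map_mem ha) (g.map_mem hb)
  map_d := by
    generalize_proofs hF
    refine DGAlg.tm_induction (p := fun z =>
        GradedTensorProduct.lift A.gr B.gr f.toAlgHom g.toAlgHom hF (DGAlg.tensorDiff A B z) =
        C.d (GradedTensorProduct.lift A.gr B.gr f.toAlgHom g.toAlgHom hF z)) (by simp)
      (fun x y hx hy => by simp only [map_add, hx, hy]) (fun i j a ha b hb => ?_)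
    rw [DGAlg.tensorDiff_tm ha, map_add, map_smul]
    change f.toAlgHom (A.d a) * g.toAlgHom b + sg k i • (f.toAlgHom a * g.toAlgHom (B.d b)) =
      C.d (f.toAlgHom a * g.toAlgHom b)
    rw [C.leibniz (f.map_mem ha), f.map_d, g.map_d]

variable (k)

/-- The generator `σ_{i+c}` of `H⁻_N`, for a generator `σ_i` of `H⁻ₙ`. -/
def idxShift {n N : ℕ} (c : ℕ) (h : n + c ≤ N) (i : LIdx n) : LIdx N :=
  ⟨i.1 + c, by have := i.2; omega⟩

/-- The homomorphism `H⁻ₙ → H⁻_N`, `σ_i ↦ σ_{i+c}`, which adds `c` vertical lines on the left and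
`N - n - c` vertical lines on the right of a diagram. -/
def LOTshift {n N : ℕ} (c : ℕ) (h : n + c ≤ N) : LOTAlg k n →ₐ[k] LOTAlg k N :=
  LOTlift k (fun i => sig k (idxShift c h i)) (fun i => sig_sq k _)
    (fun i j hij => sig_anti k _ _ (by simp only [idxShift]; omega))
    (fun i j hij => sig_braid k _ _ (by simp only [idxShift]; omega))

theorem LOTshift_word {n N : ℕ} (c : ℕ) (h : n + c ≤ N) (l : List (LIdx n)) :
    LOTshift k c h (word k l) = word k (l.map (idxShift c h)) := by
  induction l with
  | nil => rw [word_nil, map_one]; rfl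
  | cons i l ih => rw [word_cons, map_mul, ih, LOTshift, LOTlift_sig, List.map_cons, word_cons]

theorem LOTshift_mem {n N : ℕ} (c : ℕ) (h : n + c ≤ N) {i : ℤ} {x : LOTAlg k n}
    (hx : x ∈ LOTgr k n i) : LOTshift k c h x ∈ LOTgr k N i := by
  induction hx using Submodule.span_induction with
  | mem x hx =>
    obtain ⟨l, hl, rfl⟩ := hx
    rw [LOTshift_word]
    exact Submodule.subset_span ⟨l.map (idxShift c h), by rw [List.length_map, hl], rfl⟩
  | zero => simp
  | add a b _ _ ha hb => rw [map_add]; exact Submodule.add_mem _ ha hb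
  | smul r a _ ha => rw [map_smul]; exact Submodule.smul_mem _ _ ha

theorem LOTshift_d {n N : ℕ} (c : ℕ) (h : n + c ≤ N) (x : LOTAlg k n) :
    LOTshift k c h (LOTd k x) = LOTd k (LOTshift k c h x) := by
  induction LOT_span k x using Submodule.span_induction with
  | mem x hx =>
    obtain ⟨l, rfl⟩ := hx
    induction l with
    | nil => rw [word_nil, LOTd_one, map_zero, map_one, LOTd_one]
    | cons i l ih =>
      have e : LOTshift k c h (sig k i) = sig k (idxShift c h i) := by rw [LOTshift, LOTlift_sig]
      rw [word_cons, LOTd_sig_mul, map_sub, map_mul, map_mul, ih, e, LOTd_sig_mul]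
  | zero => simp
  | add a b _ _ ha hb => simp only [map_add, ha, hb]
  | smul r a _ ha => simp only [map_smul, ha]

theorem word_anti {N : ℕ} (i : LIdx N) (l : List (LIdx N)) (hl : ∀ j ∈ l, i.1 + 1 < j.1) :
    sig k i * word k l = sg k l.length • (word k l * sig k i) := by
  induction l with
  | nil => simp [word_nil, sg_zero]
  | cons j l ih =>
    have h1 := eq_neg_of_add_eq_zero_left (sig_anti k i j (Or.inl (hl j (by simp))))
    have h2 := ih fun j' hj' => hl j' (by simp [hj'])
    rw [word_cons, ← mul_assoc, h1, neg_mul, mul_assoc, h2, List.length_cons, Nat.cast_add,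
      Nat.cast_one, sg_succ, mul_smul_comm, mul_assoc, neg_smul]

theorem word_word_anti {N : ℕ} (l l' : List (LIdx N)) (h : ∀ i ∈ l, ∀ j ∈ l', i.1 + 1 < j.1) :
    word k l * word k l' = sg k (l'.length * l.length) • (word k l' * word k l) := by
  induction l with
  | nil => simp [word_nil, sg_zero]
  | cons i l ih =>
    have h1 := word_anti k i l' (h i (by simp))
    have h2 := ih fun i' hi' => h i' (by simp [hi'])
    rw [word_cons, mul_assoc, h2, mul_smul_comm, ← mul_assoc, h1, smul_mul_assoc, smul_smul,
      List.length_cons, Nat.cast_add, Nat.cast_one, sg_mul_succ, mul_assoc]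

theorem LOTshift_anti {n m N : ℕ} (h : n + m = N) {i j : ℤ} {a : LOTAlg k n} {b : LOTAlg k m}
    (ha : a ∈ LOTgr k n i) (hb : b ∈ LOTgr k m j) :
    LOTshift k (N := N) 0 (by omega) a * LOTshift k (N := N) n (by omega) b =
      sg k (j * i) • (LOTshift k (N := N) n (by omega) b *
        LOTshift k (N := N) 0 (by omega) a) := by
  induction ha using Submodule.span_induction with
  | mem x hx =>
    obtain ⟨l, hl, rfl⟩ := hx
    induction hb using Submodule.span_induction with
    | mem y hy =>
      obtain ⟨l', hl', rfl⟩ := hy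
      rw [LOTshift_word, LOTshift_word, word_word_anti]
      · rw [List.length_map, List.length_map, hl, hl', neg_mul_neg]
      · intro i hi j hj
        obtain ⟨i', _, rfl⟩ := List.mem_map.1 hi
        obtain ⟨j', _, rfl⟩ := List.mem_map.1 hj
        have := i'.2
        simp only [idxShift]
        omega
    | zero => simp
    | add x y _ _ hx hy => rw [map_add, mul_add, add_mul, hx, hy, smul_add]
    | smul r x _ hx => rw [map_smul, mul_smul_comm, smul_mul_assoc, hx, smul_comm]
  | zero => simp
  | add x y _ _ hx hy => rw [map_add, mul_add, add_mul, hx, hy, smul_add]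
  | smul r x _ hx => rw [map_smul, mul_smul_comm, smul_mul_assoc, hx, smul_comm]

/-- `LOTshift` as a homomorphism of dg algebras. -/
def LOTshiftHom {n N : ℕ} (c : ℕ) (h : n + c ≤ N) : DGHom (LOT k n) (LOT k N) where
  toAlgHom := LOTshift k c h
  map_mem := fun ha => LOTshift_mem k c h ha
  map_d := LOTshift_d k c h

/-- The homomorphism `H⁻ₙ ⊗ H⁻ₘ → H⁻_N`, `N = n + m`, of dg algebras given by placing a diagram
from `H⁻ₙ` above and to the left of a diagram from `H⁻ₘ`: `σ_i ⊗ 1 ↦ σ_i`, `1 ⊗ σ_j ↦ σ_{n+j}`. -/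
def LOTincl {n m N : ℕ} (h : n + m = N) : DGHom ((LOT k n).tensor (LOT k m)) (LOT k N) :=
  DGHom.ofTensor (LOTshiftHom k (N := N) 0 (by omega)) (LOTshiftHom k (N := N) n (by omega))
    fun ha hb => LOTshift_anti k h ha hb

variable {k}

/-- The induction functor on objects: `Ind(P, Q) = H⁻_N ⊗_{H⁻ₙ ⊗ H⁻ₘ} (P ⊠ Q)`, `N = n + m`. -/
def Ind {n m N : ℕ} (h : n + m = N) (P : DGMod (LOT k n)) (Q : DGMod (LOT k m)) :
    DGMod (LOT k N) :=
  DGMod.extend (LOTincl k h) (P.outer Q)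

/-- The restriction functor on objects, from `H⁻_N`-modules to `H⁻ₙ ⊗ H⁻ₘ`-modules,
`N = n + m`. -/
def Res {n m N : ℕ} (h : n + m = N) (P : DGMod (LOT k N)) :
    DGMod ((LOT k n).tensor (LOT k m)) :=
  DGMod.restrict (LOTincl k h) P

end Inclusion

end DG

/-! ### The integral form of the positive half of quantum `gl(1|1)` -/

section Target

open Polynomial

/-- The algebra `ℤ[q, q⁻¹, E₁] / (E₁²)`. -/
abbrev UZ : Type := AdjoinRoot ((X : Zq[X]) ^ 2)

/-- The generator `E₁`. -/
def E₁ : UZ := AdjoinRoot.root _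

theorem E₁_sq : E₁ * E₁ = 0 := by
  have h := AdjoinRoot.eval₂_root ((X : Zq[X]) ^ 2)
  rw [eval₂_pow, eval₂_X] at h
  exact (pow_two E₁).symm.trans h

/-- The universal property of `ℤ[q, q⁻¹, E₁] / (E₁²)`. -/
def UZlift {B : Type*} [Ring B] [Algebra Zq B] (x : B) (hx : x * x = 0) : UZ →ₐ[Zq] B :=
  show (Zq[X] ⧸ Ideal.span {(X : Zq[X]) ^ 2}) →ₐ[Zq] B from
  Ideal.Quotient.liftₐ _ (aeval x) (by
    intro p hp
    obtain ⟨r, rfl⟩ := Ideal.mem_span_singleton'.1 hp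
    rw [map_mul, map_pow, aeval_X, pow_two, hx, mul_zero])

theorem UZlift_E₁ {B : Type*} [Ring B] [Algebra Zq B] (x : B) (hx : x * x = 0) :
    UZlift x hx E₁ = x :=
  aeval_X x

/-- The super grading: `1` is even and `E₁` is odd. -/
def UZgr (i : ZMod 2) : Submodule Zq UZ :=
  if i = 0 then Submodule.span Zq {1} else Submodule.span Zq {E₁}

theorem one_mem_UZgr : (1 : UZ) ∈ UZgr 0 := by
  rw [UZgr, if_pos rfl]; exact Submodule.mem_span_singleton_self _

theorem E₁_mem : E₁ ∈ UZgr 1 := by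
  rw [UZgr, if_neg (by decide)]; exact Submodule.mem_span_singleton_self _

theorem UZgr_cases {i : ZMod 2} {x : UZ} (hx : x ∈ UZgr i) :
    (i = 0 ∧ ∃ a : Zq, a • (1 : UZ) = x) ∨ (i = 1 ∧ ∃ a : Zq, a • E₁ = x) := by
  rw [UZgr] at hx
  split_ifs at hx with h
  · exact Or.inl ⟨h, Submodule.mem_span_singleton.1 hx⟩
  · have h01 : ∀ i : ZMod 2, i ≠ 0 → i = 1 := by decide
    exact Or.inr ⟨h01 i h, Submodule.mem_span_singleton.1 hx⟩

theorem UZ_span (x : UZ) : ∃ a b : Zq, x = a • (1 : UZ) + b • E₁ := by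
  obtain ⟨p, rfl⟩ := AdjoinRoot.mk_surjective x
  induction p using Polynomial.induction_on' with
  | add p r hp hr =>
    obtain ⟨a, b, h⟩ := hp
    obtain ⟨a', b', h'⟩ := hr
    exact ⟨a + a', b + b', by rw [map_add, h, h']; module⟩
  | monomial n a =>
    have e : AdjoinRoot.mk ((X : Zq[X]) ^ 2) (monomial n a) = a • E₁ ^ n := by
      rw [← C_mul_X_pow_eq_monomial, map_mul, map_pow, AdjoinRoot.mk_C, AdjoinRoot.mk_X,
        Algebra.smul_def, AdjoinRoot.algebraMap_eq]
      rfl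
    rw [e]
    match n with
    | 0 => exact ⟨a, 0, by rw [pow_zero, zero_smul, add_zero]⟩
    | 1 => exact ⟨0, a, by rw [pow_one, zero_smul, zero_add]⟩
    | n + 2 =>
      exact ⟨0, 0, by
        rw [pow_add, pow_two E₁, E₁_sq, mul_zero, smul_zero, zero_smul, zero_smul, add_zero]⟩

theorem UZgr_internal : DirectSum.IsInternal UZgr := by
  refine isInternal_of_coaction _ (fun x => ?_)
    { toFun := fun x => (UZlift (B := AddMonoidAlgebra UZ (ZMod 2)) (AddMonoidAlgebra.single 1 E₁)
        (by rw [AddMonoidAlgebra.single_mul_single, E₁_sq, AddMonoidAlgebra.single_zero]) x).coeff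
      map_add' := fun x y => by simp
      map_smul' := fun c x => by simp } (fun i x hx => ?_)
  · obtain ⟨a, b, rfl⟩ := UZ_span x
    exact Submodule.add_mem _ (Submodule.smul_mem _ _ ((le_iSup UZgr 0) one_mem_UZgr))
      (Submodule.smul_mem _ _ ((le_iSup UZgr 1) E₁_mem))
  · rcases UZgr_cases hx with ⟨rfl, a, rfl⟩ | ⟨rfl, a, rfl⟩ <;>
      rw [map_smul, ← Finsupp.smul_single] <;> congr 1
    · simp [AddMonoidAlgebra.one_def]
    · simp [UZlift_E₁]

instance : SetLike.GradedMonoid UZgr where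
  one_mem := one_mem_UZgr
  mul_mem := by
    intro i j x y hx hy
    rcases UZgr_cases hx with ⟨rfl, a, rfl⟩ | ⟨rfl, a, rfl⟩ <;>
    rcases UZgr_cases hy with ⟨rfl, b, rfl⟩ | ⟨rfl, b, rfl⟩ <;>
    rw [smul_mul_smul_comm] <;> refine Submodule.smul_mem _ _ ?_
    · rw [one_mul, add_zero]; exact one_mem_UZgr
    · rw [one_mul, zero_add]; exact E₁_mem
    · rw [mul_one, add_zero]; exact E₁_mem
    · rw [E₁_sq]; exact Submodule.zero_mem _

instance : GradedAlgebra UZgr where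
  toGradedMonoid := inferInstance
  toDecomposition := UZgr_internal.chooseDecomposition

/-- The comultiplication `E₁ ↦ E₁ ⊗ 1 + 1 ⊗ E₁`, an algebra homomorphism into the super tensor
square. -/
def UZcomul : UZ →ₐ[Zq] GradedTensorProduct Zq UZgr UZgr :=
  UZlift (GradedTensorProduct.tmul Zq E₁ 1 + GradedTensorProduct.tmul Zq 1 E₁) (by
    have h1 := GradedTensorProduct.tmul_coe_mul_coe_tmul (R := Zq) UZgr UZgr (1 : UZ)
      ⟨E₁, E₁_mem⟩ ⟨E₁, E₁_mem⟩ (1 : UZ)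
    have h2 := GradedTensorProduct.tmul_one_mul_one_tmul (R := Zq) UZgr UZgr E₁ E₁
    have h3 := GradedTensorProduct.tmul_one_mul_coe_tmul (R := Zq) UZgr UZgr E₁ ⟨E₁, E₁_mem⟩ 1
    have h4 := GradedTensorProduct.tmul_coe_mul_one_tmul (R := Zq) UZgr UZgr 1 ⟨E₁, E₁_mem⟩ E₁
    simp only [one_mul, mul_one, E₁_sq] at h1 h2 h3 h4
    have h5 : GradedTensorProduct.tmul (𝒜 := UZgr) (ℬ := UZgr) Zq (0 : UZ) (1 : UZ) = 0 :=
      TensorProduct.zero_tmul UZ (1 : UZ)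
    have h6 : GradedTensorProduct.tmul (𝒜 := UZgr) (ℬ := UZgr) Zq (1 : UZ) (0 : UZ) = 0 :=
      TensorProduct.tmul_zero UZ (1 : UZ)
    rw [add_mul, mul_add, mul_add, h1, h2, h3, h4, h5, h6]
    simp)

/-- The comultiplication of `ℤ[q, q⁻¹, E₁] / (E₁²)` as a map to the tensor square. -/
def UZΔ : UZ →ₗ[Zq] UZ ⊗[Zq] UZ :=
  (GradedTensorProduct.of Zq UZgr UZgr).symm.toLinearMap.comp UZcomul.toLinearMap

/-- The field `ℚ(q)`, as the fraction field of `ℤ[q, q⁻¹]`. -/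
abbrev Qq : Type := FractionRing Zq

/-- The positive half of quantum `gl(1|1)`: the `ℚ(q)`-algebra with one generator `E₁` and the
relation `E₁² = 0`. -/
abbrev UQ : Type := AdjoinRoot ((X : Qq[X]) ^ 2)

/-- Its integral form: the `ℤ[q, q⁻¹]`-subalgebra generated by `E₁`. -/
def UQint : Subalgebra Zq UQ := Algebra.adjoin Zq {AdjoinRoot.root ((X : Qq[X]) ^ 2)}

end Target

end LOTCat

end

open LOTCat

/-!
For `n ≤ 1` the dg algebra `H⁻ₙ` has no generators and is the base field `k`. For `n ≥ 2` the unit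
is a boundary, `1 = d σ₁`, so that multiplication by `σ₁` contracts every module: all modules are
acyclic, hence all projective ones are contractible, and `K₀` vanishes.

Over the base field every complex is homotopy equivalent to its cohomology, a sum of shifts of `k`.
Compactness forces the identity of such a sum to factor, up to homotopy, through finitely many
summands, so the cohomology is finite dimensional. Its graded Euler characteristic is additive on
distinguished triangles and identifies `K₀` with `ℤ[q, q⁻¹]`; it is multiplicative under outer
tensor products. Since `H⁻ₙ ⊗ H⁻ₘ` is again acyclic or the base field, the structure maps of
`⨁ K₀(H⁻ₙ)` are determined by Euler characteristics. There is room for only `1` and `E₁`, and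
`E₁² = 0` because `K₀(H⁻₂) = 0`.
-/

noncomputable section

namespace LOTCat

variable {k : Type u} [Field k]

/-! ### Complexes of homomorphisms and homotopies -/

theorem sg_pred (n : ℤ) : sg k (n - 1) = -sg k n := by
  rw [eq_neg_iff_add_eq_zero, ← neg_eq_iff_add_eq_zero, ← sg_succ, sub_add_cancel]

theorem DGAlg.d_one (A : DGAlg k) : A.d 1 = 0 := by
  have h := A.leibniz A.one_mem 1
  rw [sg_zero, one_smul, mul_one, one_mul, mul_one] at h
  exact left_eq_add.1 h

namespace DGMod

variable {A : DGAlg k} {L M N N' : DGMod A}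

theorem mem_homZ_zero {f : M.carrier →ₗ[k] N.carrier} (hgr : ∀ x, ∀ m ∈ M.gr x, f m ∈ N.gr x)
    (hact : ∀ a m, f (M.act a m) = N.act a (f m)) (hd : ∀ m, N.d (f m) = f (M.d m)) :
    f ∈ homZ 0 M N := by
  refine ⟨⟨fun p q m hm => ?_, fun i a _ m => ?_⟩, ?_⟩
  · rw [add_zero]
    exact hgr _ m hm
  · rw [zero_mul, sg_zero, one_smul, hact]
  · refine LinearMap.mem_ker.2 (LinearMap.ext fun m => ?_)
    rw [homD_apply, sg_zero, one_smul, hd, sub_self, LinearMap.zero_apply]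

theorem homZ_map_mem {f : M.carrier →ₗ[k] N.carrier} (hf : f ∈ homZ 0 M N) {x : ℤ × ℤ}
    {m : M.carrier} (hm : m ∈ M.gr x) : f m ∈ N.gr x := by
  have := hf.1.1 x.1 x.2 m hm
  rwa [add_zero] at this

theorem homZ_d_apply {n : ℤ} {f : M.carrier →ₗ[k] N.carrier} (hf : f ∈ homZ n M N)
    (m : M.carrier) : N.d (f m) = sg k n • f (M.d m) := by
  have := LinearMap.congr_fun (LinearMap.mem_ker.1 hf.2) m
  rwa [homD_apply, LinearMap.zero_apply, sub_eq_zero] at this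

theorem mem_homB_zero {f : M.carrier →ₗ[k] N.carrier} :
    f ∈ homB 0 M N ↔ ∃ s ∈ homDeg (-1) M N, ∀ m, f m = N.d (s m) + s (M.d m) := by
  have homD_neg_one (s : M.carrier →ₗ[k] N.carrier) (m : M.carrier) :
      homD (0 - 1) M N s m = N.d (s m) + s (M.d m) := by
    rw [homD_apply, sg_pred, sg_zero, neg_one_smul, sub_neg_eq_add]
  constructor
  · rintro ⟨s, hs, rfl⟩
    exact ⟨s, hs, homD_neg_one s⟩
  · rintro ⟨s, hs, h⟩
    exact ⟨s, hs, LinearMap.ext fun m => (homD_neg_one s m).trans (h m).symm⟩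

theorem id_mem_homZ (M : DGMod A) : LinearMap.id ∈ homZ 0 M M :=
  mem_homZ_zero (fun _ _ h => h) (fun _ _ => rfl) fun _ => rfl

theorem comp_mem_homZ {f : M.carrier →ₗ[k] N.carrier} {g : N.carrier →ₗ[k] N'.carrier}
    (hg : g ∈ homZ 0 N N') (hf : f ∈ homZ 0 M N) : g.comp f ∈ homZ 0 M N' :=
  mem_homZ_zero (fun _ _ h => homZ_map_mem hg (homZ_map_mem hf h))
    (fun a m => by simp only [LinearMap.comp_apply, homZ_act hf, homZ_act hg])
    (fun m => by simp only [LinearMap.comp_apply, homZ_comm hf, homZ_comm hg])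

theorem comp_mem_homB_right {n : ℤ} {f : M.carrier →ₗ[k] N.carrier}
    {g : N.carrier →ₗ[k] N'.carrier} (hg : g ∈ homZ 0 N N') (hf : f ∈ homB n M N) :
    g.comp f ∈ homB n M N' := by
  obtain ⟨s, hs, rfl⟩ := hf
  exact ⟨g.comp s, comp_mem_homDeg hs hg, homD_comp s hg⟩

theorem comp_mem_homB_left {n : ℤ} {f : M.carrier →ₗ[k] N.carrier}
    {g : L.carrier →ₗ[k] M.carrier} (hf : f ∈ homB n M N) (hg : g ∈ homZ 0 L M) :
    f.comp g ∈ homB n L N := by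
  obtain ⟨s, hs, rfl⟩ := hf
  refine ⟨s.comp g, ⟨fun p q m hm => hs.1 p q _ (homZ_map_mem hg hm), fun i a ha m => ?_⟩, ?_⟩
  · rw [LinearMap.comp_apply, homZ_act hg, hs.2 i a ha, LinearMap.comp_apply]
  · ext m
    simp [homD_apply, homZ_comm hg]

theorem HtpyEquiv.refl (M : DGMod A) : HtpyEquiv M M :=
  ⟨_, id_mem_homZ M, _, id_mem_homZ M, by simp, by simp⟩

theorem HtpyEquiv.symm (h : HtpyEquiv M N) : HtpyEquiv N M := by
  obtain ⟨f, hf, g, hg, hgf, hfg⟩ := h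
  exact ⟨g, hg, f, hf, hfg, hgf⟩

theorem HtpyEquiv.trans (h : HtpyEquiv L M) (h' : HtpyEquiv M N) : HtpyEquiv L N := by
  obtain ⟨f, hf, g, hg, hgf, hfg⟩ := h
  obtain ⟨f', hf', g', hg', hgf', hfg'⟩ := h'
  refine ⟨f'.comp f, comp_mem_homZ hf' hf, g.comp g', comp_mem_homZ hg hg', ?_, ?_⟩
  · convert Submodule.add_mem _ (comp_mem_homB_right hg (comp_mem_homB_left hgf' hf)) hgf using 1
    ext m
    simp
  · convert Submodule.add_mem _ (comp_mem_homB_right hf' (comp_mem_homB_left hfg hg')) hfg' using 1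
    ext m
    simp

theorem HtpyEquiv.of_linearEquiv (e : M.carrier ≃ₗ[k] N.carrier)
    (h : e.toLinearMap ∈ homZ 0 M N) (h' : e.symm.toLinearMap ∈ homZ 0 N M) : HtpyEquiv M N :=
  ⟨_, h, _, h', by simp, by simp⟩

/-- A dg module is contractible if its identity is homotopic to zero, that is, if it is a zero
object of the homotopy category. -/
def IsContractible (M : DGMod A) : Prop := LinearMap.id ∈ homB 0 M M

theorem IsContractible.homZ_le_homB (h : M.IsContractible) (N : DGMod A) (n : ℤ) :
    homZ n M N ≤ homB n M N := by
  obtain ⟨s, hs, hsd⟩ := mem_homB_zero.1 h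
  intro f hf
  refine ⟨sg k n • f.comp s, Submodule.smul_mem _ _ ⟨fun p q m hm => ?_, fun i a ha m => ?_⟩, ?_⟩
  · have := hf.1.1 _ _ _ (hs.1 p q m hm)
    rwa [add_assoc, neg_add_eq_sub] at this
  · rw [LinearMap.comp_apply, hs.2 i a ha, map_smul, hf.1.2 i a ha, smul_smul, LinearMap.comp_apply,
      ← sg_add, ← add_mul, neg_add_eq_sub]
  · ext m
    have f_eq : f m = f (M.d (s m)) + f (s (M.d m)) := by
      rw [← map_add, ← hsd, LinearMap.id_apply]
    rw [homD_apply, LinearMap.smul_apply, LinearMap.smul_apply, LinearMap.comp_apply,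
      LinearMap.comp_apply, map_smul, homZ_d_apply hf, smul_smul, sg_mul_self, one_smul, smul_smul,
      sg_pred, neg_mul, sg_mul_self, neg_one_smul, sub_neg_eq_add, f_eq]

theorem IsContractible.isProjective (h : M.IsContractible) : M.IsProjective :=
  fun N _ n => h.homZ_le_homB N n

theorem IsContractible.htpyEquiv (hM : M.IsContractible) (hN : N.IsContractible) :
    HtpyEquiv M N :=
  ⟨0, Submodule.zero_mem _, 0, Submodule.zero_mem _,
    by simpa using Submodule.neg_mem _ hM, by simpa using Submodule.neg_mem _ hN⟩

theorem isContractible_of_subsingleton (M : DGMod A) [Subsingleton M.carrier] :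
    M.IsContractible := by
  rw [IsContractible, Subsingleton.elim LinearMap.id (0 : M.carrier →ₗ[k] M.carrier)]
  exact Submodule.zero_mem _

theorem IsContractible.isTriangle {P₁ P₂ P₃ : DGMod A} (h₁ : P₁.IsContractible)
    (h₂ : P₂.IsContractible) (h₃ : P₃.IsContractible) : IsTriangle P₁ P₂ P₃ := by
  let Z : DGMod A := sum (fun i : PEmpty.{u + 1} => i.elim)
  have : Subsingleton Z.carrier := ⟨fun x y => DFinsupp.ext fun i => i.elim⟩
  have : Subsingleton (cone (0 : homZ 0 Z Z)).carrier :=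
    inferInstanceAs (Subsingleton (Z.carrier × Z.carrier))
  exact ⟨Z, Z, 0, h₁.htpyEquiv (isContractible_of_subsingleton Z),
    h₂.htpyEquiv (isContractible_of_subsingleton Z),
    h₃.htpyEquiv (isContractible_of_subsingleton _)⟩

theorem qshift_zero (M : DGMod A) : M.qshift 0 = M := by
  cases M
  simp [qshift]

/-! ### Compactness -/

section Compact

variable {I : Type u} (F : I → DGMod A)

theorem component_mem_homZ (i : I) :
    DirectSum.component k I (fun a => (F a).carrier) i ∈ homZ 0 (sum F) (F i) :=
  mem_homZ_zero (fun _ _ hm => (Submodule.mem_iInf _).1 hm i) (fun _ _ => rfl) fun _ => rfl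

theorem postcomp_component_comp_sumHomK (M : DGMod A) (i : I) :
    (postcomp M ⟨_, component_mem_homZ F i⟩) ∘ₗ sumHomK M F =
      DirectSum.component k I (fun i => HomK M (F i)) i := by
  classical
  refine DirectSum.linearMap_ext _ fun j => LinearMap.ext fun g => ?_
  obtain ⟨g, rfl⟩ := Submodule.Quotient.mk_surjective _ g
  rw [LinearMap.comp_apply, LinearMap.comp_apply, LinearMap.comp_apply, sumHomK,
    DirectSum.toModule_lof]
  change (Submodule.Quotient.mk (⟨(DirectSum.component k I (fun a => (F a).carrier) i).comp
    ((DirectSum.lof k I (fun a => (F a).carrier) j).comp g.1), _⟩ : homZ 0 M (F i)) :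
    HomK M (F i)) = _
  by_cases hij : j = i
  · subst hij
    rw [DirectSum.component.lof_self]
    congr 1
    ext m
    simp [DirectSum.component.lof_self]
  · rw [DirectSum.component.of, dif_neg hij, Submodule.Quotient.mk_eq_zero]
    convert Submodule.zero_mem _
    ext m
    simp [DirectSum.component.of, dif_neg hij]

theorem sumHomK_injective (M : DGMod A) : Function.Injective (sumHomK M F) := by
  intro x y hxy
  refine DFinsupp.ext fun i => ?_
  have hx := LinearMap.congr_fun (postcomp_component_comp_sumHomK F M i) x
  have hy := LinearMap.congr_fun (postcomp_component_comp_sumHomK F M i) y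
  rw [LinearMap.comp_apply, hxy, ← LinearMap.comp_apply, hy] at hx
  exact hx.symm

variable {F}

theorem mk_mem_range_sumHomK (f : homZ 0 M (sum F)) (S : Finset I)
    (hS : ∀ m, ∀ i ∉ S, f.1 m i = 0) :
    Submodule.Quotient.mk f ∈ LinearMap.range (sumHomK M F) := by
  classical
  let fᵢ (i : I) : homZ 0 M (F i) :=
    ⟨_, comp_mem_homZ (component_mem_homZ F i) f.2⟩
  let ιfᵢ (i : I) : homZ 0 M (sum F) := ⟨_, comp_mem_homZ (sumIncl F i).2 (fᵢ i).2⟩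
  have f_eq : f = ∑ i ∈ S, ιfᵢ i := by
    ext m : 2
    rw [AddSubmonoidClass.coe_finsetSum, LinearMap.sum_apply]
    refine DFinsupp.ext fun j => ?_
    change f.1 m j = (∑ i ∈ S, DirectSum.lof k I (fun a => (F a).carrier) i (f.1 m i)) j
    rw [DFinsupp.finsetSum_apply, Finset.sum_eq_single j
      (fun i _ hij => DFinsupp.single_eq_of_ne hij.symm) fun hj => by rw [hS m j hj, map_zero]; rfl]
    exact (DFinsupp.single_eq_same (β := fun a => (F a).carrier)).symm
  rw [f_eq, ← Submodule.mkQ_apply, map_sum]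
  refine Submodule.sum_mem _ fun i _ => ⟨DirectSum.lof k I (fun i => HomK M (F i)) i
    (Submodule.Quotient.mk (fᵢ i)), ?_⟩
  rw [sumHomK, DirectSum.toModule_lof]
  rfl

theorem isCompact_of_exists_finite_support
    (h : ∀ (I : Type u) (F : I → DGMod A), ∀ f ∈ homZ 0 M (sum F), ∃ f' ∈ homZ 0 M (sum F),
      f - f' ∈ homB 0 M (sum F) ∧ ∃ S : Finset I, ∀ m, ∀ i ∉ S, f' m i = 0) : M.IsCompact := by
  refine fun I F _ => ⟨sumHomK_injective F M, fun y => ?_⟩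
  obtain ⟨⟨f, hf⟩, rfl⟩ := Submodule.Quotient.mk_surjective _ y
  obtain ⟨f', hf', hff', S, hS⟩ := h I F f hf
  rw [show (Submodule.Quotient.mk ⟨f, hf⟩ : HomK M (sum F)) = Submodule.Quotient.mk ⟨f', hf'⟩ from
    (Submodule.Quotient.eq _).2 hff']
  exact mk_mem_range_sumHomK ⟨f', hf'⟩ S hS

theorem IsCompact.finite_setOf_component_comp_notMem_homB (hM : M.IsCompact)
    (hF : ∀ i, (F i).IsProjective) {f : M.carrier →ₗ[k] (sum F).carrier}
    (hf : f ∈ homZ 0 M (sum F)) :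
    {i | (DirectSum.component k I (fun a => (F a).carrier) i).comp f ∉ homB 0 M (F i)}.Finite := by
  classical
  obtain ⟨y, hy⟩ := (hM I F hF).2 (Submodule.Quotient.mk ⟨f, hf⟩)
  refine (DFinsupp.support y).finite_toSet.subset fun i hi => ?_
  rw [Finset.mem_coe, DFinsupp.mem_support_iff]
  intro hyi
  have h := LinearMap.congr_fun (postcomp_component_comp_sumHomK F M i) y
  rw [LinearMap.comp_apply, hy] at h
  have mk_eq_zero : (Submodule.Quotient.mk
      ⟨_, comp_mem_homZ (component_mem_homZ F i) hf⟩ : HomK M (F i)) = 0 := h.trans hyi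
  exact hi ((Submodule.Quotient.mk_eq_zero ((homB 0 M (F i)).submoduleOf _)).1 mk_eq_zero)

theorem IsContractible.isPerf (h : M.IsContractible) : M.IsPerf := by
  refine ⟨h.isProjective, isCompact_of_exists_finite_support fun I F f hf =>
    ⟨0, Submodule.zero_mem _, ?_, ∅, fun _ _ _ => rfl⟩⟩
  rw [sub_zero]
  exact h.homZ_le_homB _ 0 hf

theorem HtpyEquiv.isCompact_of_finite (h : HtpyEquiv M N) [Module.Finite k N.carrier] :
    M.IsCompact := by
  classical
  obtain ⟨f, hf, g, hg, hgf, -⟩ := h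
  refine isCompact_of_exists_finite_support fun I F t ht =>
    ⟨(t.comp g).comp f, comp_mem_homZ (comp_mem_homZ ht hg) hf, ?_, ?_⟩
  · convert Submodule.neg_mem _ (comp_mem_homB_right ht hgf) using 1
    ext1 m
    simp
  · obtain ⟨T, hT⟩ := Module.Finite.fg_top (R := k) (M := N.carrier)
    refine ⟨T.biUnion fun v => DFinsupp.support (t (g v)), fun m i hi => ?_⟩
    have top_le_ker : (⊤ : Submodule k N.carrier) ≤ LinearMap.ker
        ((DirectSum.component k I (fun a => (F a).carrier) i).comp (t.comp g)) := by
      rw [← hT, Submodule.span_le]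
      intro v hv
      by_contra hne
      exact hi (Finset.mem_biUnion.2 ⟨v, hv, DFinsupp.mem_support_iff.2 hne⟩)
    exact top_le_ker (Submodule.mem_top (x := f m))

end Compact

/-! ### Homogeneous components -/

/-- The projection of a dg module onto its part of bidegree `x`. -/
def proj (M : DGMod A) (x : ℤ × ℤ) : M.carrier →ₗ[k] M.carrier :=
  (Finsupp.lapply x).comp (coact M.internal)

theorem proj_of_mem (M : DGMod A) {x : ℤ × ℤ} {m : M.carrier} (hm : m ∈ M.gr x) :
    M.proj x m = m := by
  simp [proj, coact_of_mem M.internal hm]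

theorem proj_of_mem_of_ne (M : DGMod A) {x y : ℤ × ℤ} (hxy : x ≠ y) {m : M.carrier}
    (hm : m ∈ M.gr x) : M.proj y m = 0 := by
  simp [proj, coact_of_mem M.internal hm, hxy]

theorem proj_mem (M : DGMod A) (x : ℤ × ℤ) (m : M.carrier) : M.proj x m ∈ M.gr x := by
  refine hom_induction M.internal (p := fun m => M.proj x m ∈ M.gr x)
    (by rw [map_zero]; exact Submodule.zero_mem _)
    (fun a b ha hb => by rw [map_add]; exact Submodule.add_mem _ ha hb) (fun y m hm => ?_) m
  by_cases h : y = x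
  · subst h
    rwa [M.proj_of_mem hm]
  · rw [M.proj_of_mem_of_ne h hm]
    exact Submodule.zero_mem _

theorem d_proj (M : DGMod A) (p q : ℤ) (m : M.carrier) :
    M.d (M.proj (p, q) m) = M.proj (p + 1, q) (M.d m) := by
  refine LinearMap.congr_fun (f := M.d ∘ₗ M.proj (p, q)) (g := M.proj (p + 1, q) ∘ₗ M.d)
    (hom_ext M.internal fun ⟨p', q'⟩ m hm => ?_) m
  rw [LinearMap.comp_apply, LinearMap.comp_apply]
  by_cases h : (p', q') = (p, q)
  · obtain ⟨rfl, rfl⟩ := Prod.mk.inj h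
    rw [M.proj_of_mem hm, M.proj_of_mem (M.d_mem hm)]
  · rw [M.proj_of_mem_of_ne h hm, M.proj_of_mem_of_ne _ (M.d_mem hm), map_zero]
    simpa using h

theorem exists_mem_gr_d_eq (M : DGMod A) {p q : ℤ} {m m' : M.carrier}
    (hm : m ∈ M.gr (p + 1, q)) (h : M.d m' = m) : ∃ m'' ∈ M.gr (p, q), M.d m'' = m :=
  ⟨M.proj (p, q) m', M.proj_mem _ _, by rw [d_proj, h, M.proj_of_mem hm]⟩

theorem one_mem_regular_gr (A : DGAlg k) : (1 : A.carrier) ∈ (regular A).gr (0, 0) :=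
  A.one_mem

theorem regular_isProjective (A : DGAlg k) : (regular A).IsProjective := by
  intro M hM n f hf
  have f_one_mem : f (1 : A.carrier) ∈ M.gr (n - 1 + 1, 0) := by
    have := hf.1.1 0 0 _ (one_mem_regular_gr A)
    rwa [zero_add, ← sub_add_cancel n 1] at this
  have d_f_one : M.d (f (1 : A.carrier)) = 0 := by
    rw [homZ_d_apply hf, show (regular A).d (1 : A.carrier) = 0 from A.d_one, map_zero, smul_zero]
  obtain ⟨_, hy⟩ := hM _ d_f_one
  obtain ⟨y, y_mem, hy⟩ := M.exists_mem_gr_d_eq f_one_mem hy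
  have f_eq : ∀ i, ∀ a ∈ A.gr i, f a = sg k (n * i) • M.act a (M.d y) := fun i a ha => by
    rw [hy, ← hf.1.2 i a ha, show (regular A).act a (1 : A.carrier) = a from mul_one a]
  let s : A.carrier →ₗ[k] M.carrier :=
    M.act.toLinearMap.flip y ∘ₗ (A.epsPow (n - 1)).toLinearMap
  have s_eq : ∀ i, ∀ a ∈ A.gr i, s a = sg k (i * (n - 1)) • M.act a y := fun i a ha => by
    change M.act (A.epsPow (n - 1) a) y = _
    rw [A.epsPow_of_mem (n - 1) ha, map_smul, LinearMap.smul_apply]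
  refine ⟨s, ⟨fun p q a ha => ?_, fun i a ha b => ?_⟩, ?_⟩
  · by_cases hq : q = 0
    · subst hq
      have ha' : a ∈ A.gr p := ha
      rw [s_eq p a ha']
      exact Submodule.smul_mem _ _ (M.act_mem ha' y_mem)
    · have ha0 : a = 0 := by simpa [hq] using ha
      rw [ha0, map_zero]
      exact Submodule.zero_mem _
  · change M.act (A.epsPow (n - 1) (a * b)) y = sg k ((n - 1) * i) • M.act a (s b)
    rw [map_mul, A.epsPow_of_mem (n - 1) ha, map_mul, map_smul, mul_comm i]
    rfl
  · refine hom_ext A.internal fun i a ha => ?_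
    have sign_act : sg k (i * (n - 1)) * sg k i = sg k (n * i) := by
      rw [← sg_add]
      congr 1
      ring
    have sign_d : sg k (n - 1) * sg k ((i + 1) * (n - 1)) = sg k (i * (n - 1)) := by
      rw [add_mul, one_mul, sg_add, mul_left_comm, sg_mul_self, mul_one]
    rw [homD_apply, s_eq i a ha, s_eq (i + 1) _ (A.d_mem ha), map_smul, M.leibniz ha, f_eq i a ha,
      smul_add, smul_smul, smul_smul, sign_act, sign_d, add_sub_cancel_left]

theorem regular_isCompact (A : DGAlg k) : (regular A).IsCompact := by
  classical
  refine isCompact_of_exists_finite_support fun I F f hf => ⟨f, hf, by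
    rw [sub_self]
    exact Submodule.zero_mem _, DFinsupp.support (f (1 : A.carrier)), fun a i hi => ?_⟩
  have f_eq : f a = (sum F).act a (f (1 : A.carrier)) := by
    rw [← homZ_act hf, show (regular A).act a (1 : A.carrier) = a from mul_one a]
  rw [f_eq]
  change (F i).act a (f (1 : A.carrier) i) = 0
  rw [DFinsupp.notMem_support_iff.1 hi, map_zero]

theorem regular_isPerf (A : DGAlg k) : (regular A).IsPerf :=
  ⟨regular_isProjective A, regular_isCompact A⟩

end DGMod

/-! ### Grothendieck groups -/

namespace K0

variable {A : DGAlg k} {P P₁ P₂ P₃ : DGMod A}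

theorem smul_cls (c : Zq) (hP : P.IsPerf) :
    c • cls P hP = Submodule.Quotient.mk (Finsupp.single (⟨P, hP⟩ : Perf A) c) :=
  congrArg (Submodule.Quotient.mk (p := Submodule.span Zq {x | K0Rel A x}))
    (Finsupp.smul_single_one (⟨P, hP⟩ : Perf A) c)

theorem cls_triangle (h₁ : P₁.IsPerf) (h₂ : P₂.IsPerf) (h₃ : P₃.IsPerf)
    (h : DGMod.IsTriangle P₁ P₂ P₃) : cls P₂ h₂ = cls P₁ h₁ + cls P₃ h₃ := by
  rw [← sub_eq_zero]
  exact (Submodule.Quotient.mk_eq_zero _).2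
    (Submodule.subset_span (K0Rel.triangle ⟨P₁, h₁⟩ ⟨P₂, h₂⟩ ⟨P₃, h₃⟩ h))

theorem cls_shift (h₁ : P₁.IsPerf) (h₂ : P₂.IsPerf) (h : P₂.HtpyEquiv P₁.shift) :
    cls P₂ h₂ = -cls P₁ h₁ := by
  rw [eq_neg_iff_add_eq_zero]
  exact (Submodule.Quotient.mk_eq_zero _).2
    (Submodule.subset_span (K0Rel.shift ⟨P₁, h₁⟩ ⟨P₂, h₂⟩ h))

theorem cls_qshift (n : ℤ) (h₁ : P₁.IsPerf) (h₂ : P₂.IsPerf) (h : P₂.HtpyEquiv (P₁.qshift n)) :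
    cls P₂ h₂ = (LaurentPolynomial.T n : Zq) • cls P₁ h₁ := by
  rw [← sub_eq_zero, smul_cls]
  exact (Submodule.Quotient.mk_eq_zero _).2
    (Submodule.subset_span (K0Rel.qshift n ⟨P₁, h₁⟩ ⟨P₂, h₂⟩ h))

theorem cls_congr (h₁ : P₁.IsPerf) (h₂ : P₂.IsPerf) (h : P₁.HtpyEquiv P₂) :
    cls P₁ h₁ = cls P₂ h₂ := by
  rw [cls_qshift 0 h₂ h₁ (by rwa [DGMod.qshift_zero]), LaurentPolynomial.T_zero, one_smul]

theorem cls_eq_zero (h : P.IsContractible) (hP : P.IsPerf) : cls P hP = 0 :=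
  left_eq_add.1 (cls_triangle hP hP hP (h.isTriangle h h))

section UniversalProperty

variable {V : Type*} [AddCommGroup V] [Module Zq V]

theorem hom_ext {f g : K0 A →ₗ[Zq] V} (h : ∀ P hP, f (cls P hP) = g (cls P hP)) : f = g :=
  Submodule.linearMap_qext _ (Finsupp.lhom_ext' fun P => LinearMap.ext_ring (h P.1 P.2))

/-- The universal property of the Grothendieck group: a function on compact projective modules
which is additive on triangles and compatible with both shifts extends linearly. -/
def lift (f : ∀ P : DGMod A, P.IsPerf → V)
    (shift : ∀ {P P'} hP hP', P'.HtpyEquiv P.shift → f P' hP' = -f P hP)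
    (triangle : ∀ {P₁ P₂ P₃} h₁ h₂ h₃, DGMod.IsTriangle P₁ P₂ P₃ → f P₂ h₂ = f P₁ h₁ + f P₃ h₃)
    (qshift : ∀ (n : ℤ) {P P'} hP hP', P'.HtpyEquiv (P.qshift n) →
      f P' hP' = (LaurentPolynomial.T n : Zq) • f P hP) : K0 A →ₗ[Zq] V :=
  Submodule.liftQ _ (Finsupp.linearCombination Zq fun P : Perf A => f P.1 P.2) <| by
    rw [Submodule.span_le]
    rintro _ (⟨P, P', h⟩ | ⟨P₁, P₂, P₃, h⟩ | ⟨n, P, P', h⟩)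
    · simp [shift P.2 P'.2 h]
    · simp [triangle P₁.2 P₂.2 P₃.2 h]
    · simp [qshift n P.2 P'.2 h]

theorem lift_cls {f : ∀ P : DGMod A, P.IsPerf → V} {shift triangle qshift} (hP : P.IsPerf) :
    lift f shift triangle qshift (cls P hP) = f P hP :=
  (Finsupp.linearCombination_single Zq _ _).trans (one_smul Zq _)

end UniversalProperty

end K0

/-! ### Acyclic dg algebras -/

/-- A dg algebra is acyclic if its unit is a boundary; then so is every cocycle. -/
def DGAlg.IsAcyclic (A : DGAlg k) : Prop := ∃ s ∈ A.gr (-1), A.d s = 1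

namespace DGAlg.IsAcyclic

variable {A : DGAlg k}

theorem isAcyclic (hA : A.IsAcyclic) (M : DGMod A) : M.IsAcyclic := by
  obtain ⟨s, hs, hd⟩ := hA
  intro m hm
  refine ⟨M.act s m, ?_⟩
  rw [M.leibniz hs, hd, hm, map_zero, smul_zero, add_zero, map_one, Module.End.one_apply]

theorem isContractible (hA : A.IsAcyclic) {P : DGMod A} (hP : P.IsProjective) :
    P.IsContractible :=
  hP P (hA.isAcyclic P) 0 (DGMod.id_mem_homZ P)

theorem isPerf (hA : A.IsAcyclic) {P : DGMod A} (hP : P.IsProjective) : P.IsPerf :=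
  (hA.isContractible hP).isPerf

theorem subsingleton_K0 (hA : A.IsAcyclic) : Subsingleton (K0 A) :=
  subsingleton_of_forall_eq 0 fun x => LinearMap.congr_fun
    (f := LinearMap.id) (g := (0 : K0 A →ₗ[Zq] K0 A))
    (K0.hom_ext fun _ hP => K0.cls_eq_zero (hA.isContractible hP.1) hP) x

theorem of_dgHom {C : DGAlg k} (hA : A.IsAcyclic) (φ : DGHom A C) : C.IsAcyclic := by
  obtain ⟨s, hs, hd⟩ := hA
  exact ⟨φ.toAlgHom s, φ.map_mem hs, by rw [← φ.map_d, hd, map_one]⟩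

end DGAlg.IsAcyclic

/-! ### Homology -/

theorem finrank_add_finrank_range_of_exact {V₁ V₂ V₃ V₄ V₅ : Type*} [AddCommGroup V₁]
    [AddCommGroup V₂] [AddCommGroup V₃] [AddCommGroup V₄] [AddCommGroup V₅] [Module k V₁]
    [Module k V₂] [Module k V₃] [Module k V₄] [Module k V₅] [Module.Finite k V₂]
    [Module.Finite k V₃] [Module.Finite k V₄] {f₁ : V₁ →ₗ[k] V₂} {f₂ : V₂ →ₗ[k] V₃}
    {f₃ : V₃ →ₗ[k] V₄} {f₄ : V₄ →ₗ[k] V₅} (h₁₂ : Function.Exact f₁ f₂)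
    (h₂₃ : Function.Exact f₂ f₃) (h₃₄ : Function.Exact f₃ f₄) :
    Module.finrank k V₃ + (Module.finrank k (LinearMap.range f₁) +
      Module.finrank k (LinearMap.range f₄)) = Module.finrank k V₂ + Module.finrank k V₄ := by
  have rank_nullity₂ := LinearMap.finrank_range_add_finrank_ker f₂
  have rank_nullity₃ := LinearMap.finrank_range_add_finrank_ker f₃
  have rank_nullity₄ := LinearMap.finrank_range_add_finrank_ker f₄
  rw [h₁₂.linearMap_ker_eq] at rank_nullity₂
  rw [h₂₃.linearMap_ker_eq] at rank_nullity₃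
  rw [h₃₄.linearMap_ker_eq] at rank_nullity₄
  lia

namespace DGMod

variable {A : DGAlg k} {M N : DGMod A}

/-- The cycles of bidegree `x`. -/
def cycles (M : DGMod A) (x : ℤ × ℤ) : Submodule k M.carrier := M.gr x ⊓ LinearMap.ker M.d

/-- The homology in bidegree `x`. -/
abbrev homology (M : DGMod A) (x : ℤ × ℤ) : Type u :=
  cycles M x ⧸ (LinearMap.range M.d).submoduleOf (cycles M x)

/-- The homology class of a cycle. -/
def homologyClass (M : DGMod A) {x : ℤ × ℤ} (m : cycles M x) : homology M x :=
  Submodule.Quotient.mk m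

theorem homologyClass_surjective (M : DGMod A) {x : ℤ × ℤ} :
    Function.Surjective (M.homologyClass (x := x)) :=
  Submodule.Quotient.mk_surjective _

theorem homologyClass_eq_zero {x : ℤ × ℤ} {m : cycles M x} :
    M.homologyClass m = 0 ↔ ∃ m', M.d m' = m.1 :=
  Submodule.Quotient.mk_eq_zero _

theorem homologyClass_eq {x : ℤ × ℤ} {m m' : cycles M x} :
    M.homologyClass m = M.homologyClass m' ↔ ∃ b, M.d b = m.1 - m'.1 :=
  Submodule.Quotient.eq _

/-- The map induced on homology by a homomorphism of dg modules. -/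
def homologyMap (f : homZ 0 M N) (x : ℤ × ℤ) : homology M x →ₗ[k] homology N x :=
  Submodule.mapQ _ _
    (f.1.restrict (p := cycles M x) (q := cycles N x) fun m hm =>
      ⟨homZ_map_mem f.2 hm.1, LinearMap.mem_ker.2 <| by
        rw [homZ_comm f.2, LinearMap.mem_ker.1 hm.2, map_zero]⟩)
    (by
      rintro ⟨_, _⟩ ⟨b, rfl⟩
      exact ⟨f.1 b, homZ_comm f.2 b⟩)

theorem homologyMap_comp_of_sub_mem_homB {f : homZ 0 M N} {g : homZ 0 N M}
    (h : g.1.comp f.1 - LinearMap.id ∈ homB 0 M M) (x : ℤ × ℤ) :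
    homologyMap g x ∘ₗ homologyMap f x = LinearMap.id := by
  obtain ⟨s, -, hs⟩ := mem_homB_zero.1 h
  refine LinearMap.ext fun z => ?_
  obtain ⟨⟨m, hm⟩, rfl⟩ := M.homologyClass_surjective z
  refine homologyClass_eq.2 ⟨s m, ?_⟩
  have := hs m
  rw [LinearMap.mem_ker.1 hm.2, map_zero, add_zero] at this
  exact this.symm

theorem HtpyEquiv.nonempty_homology_equiv (h : HtpyEquiv M N) (x : ℤ × ℤ) :
    Nonempty (homology M x ≃ₗ[k] homology N x) := by
  obtain ⟨f, hf, g, hg, hgf, hfg⟩ := h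
  exact ⟨.ofLinearMap (homologyMap ⟨f, hf⟩ x) (homologyMap ⟨g, hg⟩ x)
    (homologyMap_comp_of_sub_mem_homB hfg x) (homologyMap_comp_of_sub_mem_homB hgf x)⟩

/-- The homology of a shift is the shift of the homology. -/
def homologyShiftEquiv (M : DGMod A) (p q : ℤ) :
    homology M.shift (p, q) ≃ₗ[k] homology M (p + 1, q) :=
  have cycles_eq : cycles M.shift (p, q) = cycles M (p + 1, q) := by
    rw [cycles, cycles, LinearMap.ker_neg]
  Submodule.Quotient.equiv _ _ (LinearEquiv.ofEq _ _ cycles_eq) <| by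
    ext m
    simp [Submodule.submoduleOf, LinearMap.range_neg]

section Cone

variable (f : homZ 0 M N)

/-- The inclusion of the target into the cone. -/
def coneIncl : homZ 0 N (cone f) :=
  ⟨LinearMap.inl k N.carrier M.carrier, mem_homZ_zero
    (fun _ _ hn => ⟨hn, Submodule.zero_mem _⟩)
    (fun a _ => Prod.ext rfl (map_zero (M.act (A.eps a))).symm)
    (fun _ => by simp)⟩

/-- The projection of the cone onto the shifted source. -/
def coneProj : homZ 0 (cone f) M.shift :=
  ⟨LinearMap.snd k N.carrier M.carrier, mem_homZ_zero (fun _ _ h => h.2) (fun _ _ => rfl)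
    (fun _ => rfl)⟩

theorem exact_homologyMap_coneIncl (x : ℤ × ℤ) :
    Function.Exact (homologyMap f x) (homologyMap (coneIncl f) x) := by
  obtain ⟨p, q⟩ := x
  intro z
  obtain ⟨⟨n, hn⟩, rfl⟩ := N.homologyClass_surjective z
  constructor
  · intro h
    obtain ⟨b, hb⟩ := homologyClass_eq_zero.1 h
    obtain ⟨⟨y, m⟩, hym, hd⟩ := (cone f).exists_mem_gr_d_eq (p := p - 1) (q := q)
      (by rw [sub_add_cancel]; exact ⟨hn.1, Submodule.zero_mem _⟩) hb
    obtain ⟨d_fst, d_snd⟩ := Prod.mk.inj hd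
    have hm : m ∈ M.gr (p, q) := by
      have : m ∈ M.gr (p - 1 + 1, q) := hym.2
      rwa [sub_add_cancel] at this
    refine ⟨M.homologyClass ⟨m, hm, neg_eq_zero.1 d_snd⟩, homologyClass_eq.2 ⟨-y, ?_⟩⟩
    change N.d y + f.1 m = n at d_fst
    change N.d (-y) = f.1 m - n
    rw [← d_fst, map_neg, sub_add_cancel_right]
  · rintro ⟨w, hw⟩
    obtain ⟨⟨m, hm⟩, rfl⟩ := M.homologyClass_surjective w
    obtain ⟨y, hy⟩ := homologyClass_eq.1 hw
    change N.d y = f.1 m - n at hy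
    refine homologyClass_eq_zero.2 ⟨(-y, m), Prod.ext ?_ (neg_eq_zero.2 hm.2)⟩
    change N.d (-y) + f.1 m = n
    rw [map_neg, hy, neg_sub, sub_add_cancel]

theorem exact_homologyMap_coneProj (x : ℤ × ℤ) :
    Function.Exact (homologyMap (coneIncl f) x) (homologyMap (coneProj f) x) := by
  obtain ⟨p, q⟩ := x
  intro z
  obtain ⟨⟨⟨n, m⟩, hnm⟩, rfl⟩ := (cone f).homologyClass_surjective z
  have d_fst : N.d n + f.1 m = 0 := (Prod.mk.inj hnm.2).1
  constructor
  · intro h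
    obtain ⟨b, hb⟩ := homologyClass_eq_zero.1 h
    obtain ⟨y, hy, hd⟩ := M.shift.exists_mem_gr_d_eq (p := p - 1) (q := q)
      (by rw [sub_add_cancel]; exact hnm.1.2) hb
    change -M.d y = m at hd
    have hy' : y ∈ M.gr (p, q) := by
      have : y ∈ M.gr (p - 1 + 1, q) := hy
      rwa [sub_add_cancel] at this
    refine ⟨N.homologyClass ⟨n - f.1 y, Submodule.sub_mem _ hnm.1.1 (homZ_map_mem f.2 hy'), ?_⟩,
      homologyClass_eq.2 ⟨(0, -y), Prod.ext ?_ ?_⟩⟩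
    · change N.d (n - f.1 y) = 0
      rw [map_sub, homZ_comm f.2, sub_eq_add_neg, ← map_neg, hd, d_fst]
    · change N.d 0 + f.1 (-y) = n - f.1 y - n
      rw [map_zero, zero_add, map_neg, sub_sub_cancel_left]
    · change -M.d (-y) = 0 - m
      rw [map_neg, neg_neg, zero_sub, ← hd, neg_neg]
  · rintro ⟨w, hw⟩
    obtain ⟨n', rfl⟩ := N.homologyClass_surjective w
    obtain ⟨⟨y', y⟩, hy⟩ := homologyClass_eq.1 hw
    have d_snd : -M.d y = 0 - m := (Prod.mk.inj hy).2
    refine homologyClass_eq_zero.2 ⟨-y, ?_⟩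
    change -M.d (-y) = m
    rw [map_neg, d_snd, zero_sub, neg_neg]

theorem exact_homologyMap_comp_shiftEquiv (p q : ℤ) :
    Function.Exact (homologyMap (coneProj f) (p, q))
      (homologyMap f (p + 1, q) ∘ₗ (homologyShiftEquiv M p q).toLinearMap) := by
  intro z
  obtain ⟨⟨m, hm⟩, rfl⟩ := M.shift.homologyClass_surjective z
  constructor
  · intro h
    obtain ⟨b, hb⟩ := homologyClass_eq_zero.1 h
    obtain ⟨n, hn, hd⟩ := N.exists_mem_gr_d_eq (p := p) (q := q) (homZ_map_mem f.2 hm.1) hb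
    change N.d n = f.1 m at hd
    refine ⟨(cone f).homologyClass ⟨(-n, m), ⟨Submodule.neg_mem _ hn, hm.1⟩, ?_⟩, rfl⟩
    refine Prod.ext ?_ hm.2
    change N.d (-n) + f.1 m = 0
    rw [map_neg, hd, neg_add_cancel]
  · rintro ⟨w, hw⟩
    obtain ⟨⟨⟨n, m'⟩, hnm⟩, rfl⟩ := (cone f).homologyClass_surjective w
    have d_fst : N.d n + f.1 m' = 0 := (Prod.mk.inj hnm.2).1
    obtain ⟨y, hy⟩ := homologyClass_eq.1 hw
    change -M.d y = m' - m at hy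
    refine homologyClass_eq_zero.2 ⟨f.1 y - n, ?_⟩
    change N.d (f.1 y - n) = f.1 m
    rw [map_sub, homZ_comm f.2, neg_eq_iff_eq_neg.1 hy, map_neg, map_sub,
      eq_neg_of_add_eq_zero_left d_fst]
    abel

end Cone

/-! ### The Euler characteristic -/

/-- The signed monomial `(-1) ^ p q ^ r` contributed by a homology class of bidegree `(p, r)`. -/
def eulerMonomial (x : ℤ × ℤ) : Zq := ((x.1.negOnePow : ℤ) : Zq) * LaurentPolynomial.T x.2

theorem eulerMonomial_add (x y : ℤ × ℤ) :
    eulerMonomial (x + y) = eulerMonomial x * eulerMonomial y := by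
  simp only [eulerMonomial, Prod.fst_add, Prod.snd_add, Int.negOnePow_add, LaurentPolynomial.T_add,
    Units.val_mul, Int.cast_mul]
  ring

theorem eulerMonomial_succ (p q : ℤ) : eulerMonomial (p + 1, q) = -eulerMonomial (p, q) := by
  simp [eulerMonomial, Int.negOnePow_succ]

theorem eulerMonomial_zero : eulerMonomial 0 = 1 := by
  simp [eulerMonomial]

/-- The graded Euler characteristic of a family of dimensions indexed by bidegrees; a finite sum,
and `0` by convention if the family has infinite support. -/
def eulerSum (g : ℤ × ℤ → ℕ) : Zq := ∑ᶠ x, (g x : Zq) * eulerMonomial x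

theorem finite_support_mul_eulerMonomial {g : ℤ × ℤ → ℕ} (h : g.support.Finite) :
    (Function.support fun x => (g x : Zq) * eulerMonomial x).Finite :=
  h.subset fun _ hx hg => hx (by simp [hg])

theorem eulerSum_add {g g' : ℤ × ℤ → ℕ} (h : g.support.Finite) (h' : g'.support.Finite) :
    eulerSum (fun x => g x + g' x) = eulerSum g + eulerSum g' := by
  rw [eulerSum, eulerSum, eulerSum, ← finsum_add_distrib (finite_support_mul_eulerMonomial h)
    (finite_support_mul_eulerMonomial h')]
  simp only [Nat.cast_add, add_mul]

theorem finite_support_comp_shift {g : ℤ × ℤ → ℕ} (h : g.support.Finite) :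
    (Function.support fun x : ℤ × ℤ => g (x.1 + 1, x.2)).Finite :=
  h.preimage (f := fun x : ℤ × ℤ => (x.1 + 1, x.2)) fun x _ y _ hxy => by
    simpa [Prod.ext_iff] using hxy

theorem eulerSum_comp_shift (g : ℤ × ℤ → ℕ) :
    eulerSum (fun x => g (x.1 + 1, x.2)) = -eulerSum g := by
  rw [eulerSum, eulerSum, ← finsum_neg_distrib,
    ← finsum_comp_equiv ((Equiv.addRight (1 : ℤ)).prodCongr (Equiv.refl ℤ))
      (f := fun x => -((g x : Zq) * eulerMonomial x))]
  refine finsum_congr fun x => ?_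
  change _ = -((g (x.1 + 1, x.2) : Zq) * eulerMonomial (x.1 + 1, x.2))
  rw [eulerMonomial_succ, mul_neg, neg_neg]

theorem eulerSum_comp_qshift (n : ℤ) (g : ℤ × ℤ → ℕ) :
    eulerSum (fun x => g (x.1, x.2 - n)) = LaurentPolynomial.T n * eulerSum g := by
  have eulerMonomial_qshift (x : ℤ × ℤ) :
      eulerMonomial x = LaurentPolynomial.T n * eulerMonomial (x.1, x.2 - n) := by
    simp only [eulerMonomial]
    rw [mul_left_comm, ← LaurentPolynomial.T_add, add_sub_cancel]
  rw [eulerSum, eulerSum, ← finsum_comp_equiv ((Equiv.refl ℤ).prodCongr (Equiv.subRight n))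
    (f := fun x => (g x : Zq) * eulerMonomial x), ← smul_eq_mul, smul_finsum]
  refine finsum_congr fun x => ?_
  change _ = LaurentPolynomial.T n * ((g (x.1, x.2 - n) : Zq) * eulerMonomial (x.1, x.2 - n))
  rw [eulerMonomial_qshift x, mul_left_comm]

/-- The dimension of the homology in bidegree `x`. -/
def homologyDim (M : DGMod A) (x : ℤ × ℤ) : ℕ := Module.finrank k (homology M x)

/-- The graded Euler characteristic of the homology of a dg module. -/
def euler (M : DGMod A) : Zq := eulerSum (homologyDim M)

/-- Finiteness of the total homology. -/
structure HasFiniteHomology (M : DGMod A) : Prop where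
  finite : ∀ x, Module.Finite k (homology M x)
  finite_support : (homologyDim M).support.Finite

namespace HtpyEquiv

theorem homologyDim_eq (h : HtpyEquiv M N) : homologyDim M = homologyDim N :=
  funext fun x => (h.nonempty_homology_equiv x).elim LinearEquiv.finrank_eq

theorem euler_eq (h : HtpyEquiv M N) : euler M = euler N := by
  rw [euler, euler, h.homologyDim_eq]

theorem hasFiniteHomology (h : HtpyEquiv M N) (hM : M.HasFiniteHomology) :
    N.HasFiniteHomology where
  finite x := by
    obtain ⟨e⟩ := h.nonempty_homology_equiv x
    have := hM.finite x
    exact Module.Finite.equiv e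
  finite_support := by
    rw [← h.homologyDim_eq]
    exact hM.finite_support

end HtpyEquiv

theorem homologyDim_shift (M : DGMod A) (p q : ℤ) :
    homologyDim M.shift (p, q) = homologyDim M (p + 1, q) :=
  (homologyShiftEquiv M p q).finrank_eq

theorem euler_shift (M : DGMod A) : euler M.shift = -euler M := by
  rw [euler, euler, ← eulerSum_comp_shift]
  exact congrArg eulerSum (funext fun x => homologyDim_shift M x.1 x.2)

theorem euler_qshift (n : ℤ) (M : DGMod A) :
    euler (M.qshift n) = LaurentPolynomial.T n * euler M :=
  eulerSum_comp_qshift n (homologyDim M)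

theorem homologyDim_cone (f : homZ 0 M N) (hM : M.HasFiniteHomology)
    (hN : N.HasFiniteHomology) (hf : (cone f).HasFiniteHomology) (p q : ℤ) :
    homologyDim (cone f) (p, q) + (Module.finrank k (LinearMap.range (homologyMap f (p, q))) +
      Module.finrank k (LinearMap.range (homologyMap f (p + 1, q)))) =
        homologyDim N (p, q) + homologyDim M (p + 1, q) := by
  have := hM.finite (p + 1, q)
  have := hN.finite (p, q)
  have := hf.finite (p, q)
  have : Module.Finite k (homology M.shift (p, q)) :=
    Module.Finite.equiv (homologyShiftEquiv M p q).symm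
  have h := finrank_add_finrank_range_of_exact (exact_homologyMap_coneIncl f (p, q))
    (exact_homologyMap_coneProj f (p, q)) (exact_homologyMap_comp_shiftEquiv f p q)
  rwa [LinearEquiv.range_comp, (homologyShiftEquiv M p q).finrank_eq] at h

theorem euler_cone (f : homZ 0 M N) (hM : M.HasFiniteHomology) (hN : N.HasFiniteHomology)
    (hf : (cone f).HasFiniteHomology) : euler N = euler M + euler (cone f) := by
  let rank (x : ℤ × ℤ) : ℕ := Module.finrank k (LinearMap.range (homologyMap f x))
  have finite_support_rank : rank.support.Finite := hN.finite_support.subset fun x hx h0 => hx <| by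
    have := hN.finite x
    exact Nat.le_zero.1 ((Submodule.finrank_le _).trans_eq h0)
  have h := congrArg eulerSum (funext fun x => homologyDim_cone f hM hN hf x.1 x.2)
  -- The ranks of the connecting maps cancel, since they enter in two consecutive degrees.
  have eulerSum_rank : eulerSum (fun x => rank x + rank (x.1 + 1, x.2)) = 0 := by
    rw [eulerSum_add finite_support_rank (finite_support_comp_shift finite_support_rank),
      eulerSum_comp_shift, add_neg_cancel]
  rw [eulerSum_add hf.finite_support ((finite_support_rank.union
      (finite_support_comp_shift finite_support_rank)).subset (Function.support_add _ _)),
    eulerSum_rank, add_zero, eulerSum_add hN.finite_support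
      (finite_support_comp_shift hM.finite_support), eulerSum_comp_shift,
    ← sub_eq_add_neg] at h
  exact (add_eq_of_eq_sub' h).symm

theorem IsTriangle.euler_eq {P₁ P₂ P₃ : DGMod A} (h : IsTriangle P₁ P₂ P₃)
    (h₁ : P₁.HasFiniteHomology) (h₂ : P₂.HasFiniteHomology) (h₃ : P₃.HasFiniteHomology) :
    euler P₂ = euler P₁ + euler P₃ := by
  obtain ⟨X, Y, f, e₁, e₂, e₃⟩ := h
  rw [e₁.euler_eq, e₂.euler_eq, e₃.euler_eq]
  exact euler_cone f (e₁.hasFiniteHomology h₁) (e₂.hasFiniteHomology h₂) (e₃.hasFiniteHomology h₃)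

end DGMod

/-! ### Splitting complexes of vector spaces -/

theorem isInternal_comap_range_of_idempotent {ι R M : Type*} [DecidableEq ι] [CommRing R]
    [AddCommGroup M] [Module R M] {gr : ι → Submodule R M} (h : DirectSum.IsInternal gr)
    {π : M →ₗ[R] M} (hπ : ∀ m, π (π m) = π m) (hgr : ∀ i, ∀ m ∈ gr i, π m ∈ gr i) :
    DirectSum.IsInternal fun i => (gr i).comap (LinearMap.range π).subtype := by
  have rangeRestrict_coe (v : LinearMap.range π) : π.rangeRestrict v.1 = v := by
    obtain ⟨_, m, rfl⟩ := v
    exact Subtype.ext (hπ m)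
  refine isInternal_of_coaction _ (fun v => ?_)
    (Finsupp.mapRange.linearMap π.rangeRestrict ∘ₗ coact h ∘ₗ (LinearMap.range π).subtype)
    (fun i v hv => ?_)
  · rw [← rangeRestrict_coe v]
    refine hom_induction h
      (p := fun m => π.rangeRestrict m ∈ ⨆ i, (gr i).comap (LinearMap.range π).subtype)
      (by rw [map_zero]; exact Submodule.zero_mem _)
      (fun a b ha hb => by rw [map_add]; exact Submodule.add_mem _ ha hb)
      (fun i m hm => Submodule.mem_iSup_of_mem i (hgr i m hm)) v.1
  · rw [LinearMap.comp_apply, LinearMap.comp_apply,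
      coact_of_mem h (show (LinearMap.range π).subtype v ∈ gr i from hv)]
    simp [rangeRestrict_coe]

namespace DGMod

variable {A : DGAlg k} {M N : DGMod A}

theorem exists_homogeneous_quasi_inverse_d (M : DGMod A) : ∃ h : M.carrier →ₗ[k] M.carrier,
    (∀ p q, ∀ m ∈ M.gr (p, q), h m ∈ M.gr (p - 1, q)) ∧ ∀ m, M.d (h (M.d m)) = M.d m := by
  obtain ⟨g₀, hg₀⟩ := M.d.rangeRestrict.exists_rightInverse_of_surjective M.d.range_rangeRestrict
  obtain ⟨g, hg⟩ := LinearMap.exists_extend g₀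
  have d_g_d (m : M.carrier) : M.d (g (M.d m)) = M.d m := by
    rw [show g (M.d m) = g₀ (M.d.rangeRestrict m) from
      LinearMap.congr_fun hg (M.d.rangeRestrict m)]
    exact congrArg Subtype.val (LinearMap.congr_fun hg₀ (M.d.rangeRestrict m))
  -- `h` is the component of bidegree `(-1, 0)` of `g`.
  let h : M.carrier →ₗ[k] M.carrier :=
    (Finsupp.lsum k fun x : ℤ × ℤ => M.proj (x.1 - 1, x.2) ∘ₗ g) ∘ₗ coact M.internal
  have h_eq : ∀ p q, ∀ m ∈ M.gr (p, q), h m = M.proj (p - 1, q) (g m) := fun p q m hm => by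
    simp [h, coact_of_mem M.internal hm]
  refine ⟨h, fun p q m hm => ?_, fun m => LinearMap.congr_fun (f := M.d ∘ₗ h ∘ₗ M.d) (g := M.d)
    (hom_ext M.internal fun ⟨p, q⟩ m hm => ?_) m⟩
  · rw [h_eq p q m hm]
    exact M.proj_mem _ _
  · rw [LinearMap.comp_apply, LinearMap.comp_apply, h_eq _ _ _ (M.d_mem hm), d_proj, d_g_d,
      sub_add_cancel, M.proj_of_mem (M.d_mem hm)]

/-- A homogeneous map `h` of bidegree `(-1, 0)` which splits the underlying complex of vector
spaces of a dg module, not necessarily compatibly with the action. -/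
structure IsSplitting (M : DGMod A) (h : M.carrier →ₗ[k] M.carrier) : Prop where
  map_mem : ∀ p q, ∀ m ∈ M.gr (p, q), h m ∈ M.gr (p - 1, q)
  d_map_d : ∀ m, M.d (h (M.d m)) = M.d m
  map_map : ∀ m, h (h m) = 0

theorem exists_isSplitting (M : DGMod A) : ∃ h, M.IsSplitting h := by
  obtain ⟨h, map_mem, d_map_d⟩ := M.exists_homogeneous_quasi_inverse_d
  refine ⟨h ∘ₗ M.d ∘ₗ h ∘ₗ (LinearMap.id - h ∘ₗ M.d), fun p q m hm => ?_, fun m => ?_,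
    fun m => ?_⟩
  · have sub_mem : m - h (M.d m) ∈ M.gr (p, q) := by
      have := map_mem _ _ _ (M.d_mem hm)
      rw [add_sub_cancel_right] at this
      exact Submodule.sub_mem _ hm this
    have d_mem := M.d_mem (map_mem _ _ _ sub_mem)
    rw [sub_add_cancel] at d_mem
    exact map_mem _ _ _ d_mem
  · simp [M.d_d, d_map_d]
  · simp [d_map_d]

/-- The projection onto a complement of the boundaries in the cycles, for a splitting `h`. -/
def harmonic (M : DGMod A) (h : M.carrier →ₗ[k] M.carrier) : M.carrier →ₗ[k] M.carrier :=
  LinearMap.id - M.d ∘ₗ h - h ∘ₗ M.d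

theorem harmonic_apply (M : DGMod A) (h : M.carrier →ₗ[k] M.carrier) (m : M.carrier) :
    M.harmonic h m = m - M.d (h m) - h (M.d m) := rfl

namespace IsSplitting

variable {h : M.carrier →ₗ[k] M.carrier} (hh : M.IsSplitting h)
include hh

theorem d_harmonic (m : M.carrier) : M.d (M.harmonic h m) = 0 := by
  simp [harmonic_apply, M.d_d, hh.d_map_d]

theorem harmonic_d (m : M.carrier) : M.harmonic h (M.d m) = 0 := by
  simp [harmonic_apply, M.d_d, hh.d_map_d]

theorem harmonic_harmonic (m : M.carrier) :
    M.harmonic h (M.harmonic h m) = M.harmonic h m := by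
  rw [harmonic_apply M h (M.harmonic h m), hh.d_harmonic, map_zero, sub_zero]
  simp [harmonic_apply, hh.d_map_d, hh.map_map]

theorem harmonic_mem {x : ℤ × ℤ} {m : M.carrier} (hm : m ∈ M.gr x) : M.harmonic h m ∈ M.gr x := by
  obtain ⟨p, q⟩ := x
  have d_map_mem := M.d_mem (hh.map_mem _ _ _ hm)
  have map_d_mem := hh.map_mem _ _ _ (M.d_mem hm)
  rw [sub_add_cancel] at d_map_mem
  rw [add_sub_cancel_right] at map_d_mem
  exact Submodule.sub_mem _ (Submodule.sub_mem _ hm d_map_mem) map_d_mem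

theorem harmonic_eq_zero (hM : M.IsAcyclic) (m : M.carrier) : M.harmonic h m = 0 := by
  obtain ⟨m', hm'⟩ := hM _ (hh.d_harmonic m)
  rw [← hh.harmonic_harmonic, ← hm', hh.harmonic_d]

end IsSplitting

theorem eq_zero_of_mem_homB_zero (hM : M.d = 0) (hN : N.d = 0) {f : M.carrier →ₗ[k] N.carrier}
    (hf : f ∈ homB 0 M N) : f = 0 := by
  obtain ⟨s, -, hs⟩ := mem_homB_zero.1 hf
  ext m
  rw [hs, hM, hN]
  simp

end DGMod

/-! ### The base field -/

/-- The dg algebra is the base field, concentrated in degree `0`. -/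
def DGAlg.IsBaseField (A : DGAlg k) : Prop := Function.Bijective (algebraMap k A.carrier)

namespace DGAlg.IsBaseField

open DGMod

variable {A : DGAlg k} (hA : A.IsBaseField)

/-- The isomorphism of the base field with the algebra. -/
def equiv : k ≃ₐ[k] A.carrier := AlgEquiv.ofBijective (Algebra.ofId k A.carrier) hA

include hA

theorem exists_eq_smul_one (a : A.carrier) : ∃ c : k, a = c • (1 : A.carrier) := by
  obtain ⟨c, rfl⟩ := hA.2 a
  exact ⟨c, Algebra.algebraMap_eq_smul_one c⟩

theorem mem_gr_zero (a : A.carrier) : a ∈ A.gr 0 := by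
  obtain ⟨c, rfl⟩ := hA.exists_eq_smul_one a
  exact Submodule.smul_mem _ _ A.one_mem

theorem eq_zero_of_mem_gr {i : ℤ} (hi : i ≠ 0) {a : A.carrier} (ha : a ∈ A.gr i) : a = 0 :=
  Submodule.disjoint_def.1 (A.internal.submodule_iSupIndep.pairwiseDisjoint hi) a ha
    (hA.mem_gr_zero a)

theorem d_eq_zero (a : A.carrier) : A.d a = 0 :=
  hA.eq_zero_of_mem_gr one_ne_zero (A.d_mem (hA.mem_gr_zero a))

theorem not_isAcyclic : ¬A.IsAcyclic := by
  rintro ⟨s, -, hs⟩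
  have := hA.equiv.symm.toRingHom.domain_nontrivial
  exact one_ne_zero (hs.symm.trans (hA.d_eq_zero s))

variable {M N : DGMod A}

theorem mem_homDeg {n : ℤ} {f : M.carrier →ₗ[k] N.carrier}
    (hgr : ∀ p q, ∀ m ∈ M.gr (p, q), f m ∈ N.gr (p + n, q)) : f ∈ homDeg n M N := by
  refine ⟨hgr, fun i a ha m => ?_⟩
  by_cases hi : i = 0
  · obtain ⟨c, rfl⟩ := hA.exists_eq_smul_one a
    simp [hi, sg_zero]
  · rw [hA.eq_zero_of_mem_gr hi ha]
    simp

theorem mem_homZ_zero {f : M.carrier →ₗ[k] N.carrier}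
    (hgr : ∀ x, ∀ m ∈ M.gr x, f m ∈ N.gr x) (hd : ∀ m, N.d (f m) = f (M.d m)) :
    f ∈ homZ 0 M N := by
  refine DGMod.mem_homZ_zero hgr (fun a m => ?_) hd
  obtain ⟨c, rfl⟩ := hA.exists_eq_smul_one a
  simp

theorem htpyEquiv_of_linearEquiv (e : M.carrier ≃ₗ[k] N.carrier)
    (hgr : ∀ x, ∀ m ∈ M.gr x, e m ∈ N.gr x) (hgr' : ∀ x, ∀ n ∈ N.gr x, e.symm n ∈ M.gr x)
    (hd : ∀ m, N.d (e m) = e (M.d m)) : HtpyEquiv M N :=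
  .of_linearEquiv e (hA.mem_homZ_zero hgr hd)
    (hA.mem_homZ_zero hgr' fun n => e.injective (by simp [← hd]))

theorem isProjective (P : DGMod A) : P.IsProjective := by
  intro M hM n f hf
  obtain ⟨h, hh⟩ := M.exists_isSplitting
  have id_eq (m : M.carrier) : m = M.d (h m) + h (M.d m) := by
    have := hh.harmonic_eq_zero hM m
    rwa [harmonic_apply, sub_sub, sub_eq_zero] at this
  refine ⟨h.comp f, hA.mem_homDeg fun p q m hm => ?_, ?_⟩
  · have := hh.map_mem _ _ _ (hf.1.1 p q m hm)
    rwa [add_sub_assoc] at this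
  · ext m
    rw [homD_apply, LinearMap.comp_apply, LinearMap.comp_apply, sg_pred, neg_smul, sub_neg_eq_add,
      ← map_smul, ← homZ_d_apply hf, ← id_eq]

section ZeroDiff

variable {V : Type u} [AddCommGroup V] [Module k V] {gr : ℤ × ℤ → Submodule k V}

omit hA in
/-- A bigraded vector space as a dg module with zero differential over the base field. -/
abbrev zeroDiffMod (hA : A.IsBaseField) (hV : DirectSum.IsInternal gr) : DGMod A where
  carrier := V
  gr := gr
  internal := hV
  act := (Algebra.ofId k (Module.End k V)).comp hA.equiv.symm.toAlgHom
  act_mem := by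
    intro i p q a m ha hm
    by_cases hi : i = 0
    · subst hi
      rw [zero_add]
      exact Submodule.smul_mem _ (hA.equiv.symm a) hm
    · rw [hA.eq_zero_of_mem_gr hi ha, map_zero]
      exact Submodule.zero_mem _
  d := 0
  d_mem := fun _ => Submodule.zero_mem _
  d_d _ := rfl
  leibniz := fun _ m => by simp [hA.d_eq_zero]

theorem htpyEquiv_zeroDiffMod_harmonic {h : M.carrier →ₗ[k] M.carrier} (hh : M.IsSplitting h) :
    HtpyEquiv M (hA.zeroDiffMod (isInternal_comap_range_of_idempotent M.internal
      hh.harmonic_harmonic fun _ _ => hh.harmonic_mem)) := by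
  refine ⟨(M.harmonic h).rangeRestrict, hA.mem_homZ_zero (fun _ _ hm => hh.harmonic_mem hm)
    (fun m => Subtype.ext (hh.harmonic_d m).symm), (LinearMap.range (M.harmonic h)).subtype,
    hA.mem_homZ_zero (fun _ _ hv => hv) (fun v => ?_), mem_homB_zero.2 ⟨-h, hA.mem_homDeg
      fun p q m hm => Submodule.neg_mem _ (hh.map_mem p q m hm), fun m => ?_⟩, ?_⟩
  · obtain ⟨_, m, rfl⟩ := v
    exact hh.d_harmonic m
  · change M.harmonic h m - m = M.d (-h m) + -h (M.d m)
    rw [harmonic_apply, map_neg]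
    abel
  · convert Submodule.zero_mem _
    refine LinearMap.ext ?_
    rintro ⟨_, m, rfl⟩
    exact Subtype.ext (sub_eq_zero.2 (hh.harmonic_harmonic m))

end ZeroDiff

omit hA in
theorem supported_isInternal {I : Type*} (deg : I → ℤ × ℤ) :
    DirectSum.IsInternal fun x => Finsupp.supported k k {i | deg i = x} := by
  refine isInternal_of_coaction _ (fun v => ?_)
    (Finsupp.lsum k fun i => (Finsupp.lsingle (deg i)).comp (Finsupp.lsingle i)) (fun x v hv => ?_)
  · induction v using Finsupp.induction_linear with
    | zero => exact Submodule.zero_mem _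
    | add v w hv hw => exact Submodule.add_mem _ hv hw
    | single i c =>
      exact Submodule.mem_iSup_of_mem (p := fun x => Finsupp.supported k k {i | deg i = x}) (deg i)
        (Finsupp.single_mem_supported k c rfl)
  · rw [Finsupp.supported_eq_span_single] at hv
    induction hv using Submodule.span_induction with
    | mem v hv =>
      obtain ⟨i, rfl, rfl⟩ := hv
      simp
    | zero => simp
    | add v w _ _ hv hw => rw [map_add, hv, hw, Finsupp.single_add]
    | smul c v _ hv => rw [map_smul, hv, Finsupp.smul_single]

omit hA in
/-- The dg module with zero differential and a basis indexed by `I`, with the basis vector `i` in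
bidegree `deg i`. -/
abbrev freeMod (hA : A.IsBaseField) {I : Type u} (deg : I → ℤ × ℤ) : DGMod A :=
  hA.zeroDiffMod (supported_isInternal deg)

omit hA in
/-- The one-dimensional dg module in bidegree `x`. -/
abbrev line (hA : A.IsBaseField) (x : ℤ × ℤ) : DGMod A := hA.freeMod fun _ : PUnit.{u + 1} => x

variable {I J : Type u} {deg : I → ℤ × ℤ}

theorem mem_freeMod_gr {x : ℤ × ℤ} {v : I →₀ k} :
    v ∈ (hA.freeMod deg).gr x ↔ ∀ i, v i ≠ 0 → deg i = x := by
  rw [Finsupp.mem_supported]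
  exact ⟨fun h i hi => h (Finsupp.mem_support_iff.2 hi),
    fun h i hi => h i (Finsupp.mem_support_iff.1 hi)⟩

theorem freeMod_gr_le {x : ℤ × ℤ} {S : Submodule k (I →₀ k)}
    (h : ∀ i, deg i = x → Finsupp.single i 1 ∈ S) : (hA.freeMod deg).gr x ≤ S := by
  change Finsupp.supported k k {i | deg i = x} ≤ S
  rw [Finsupp.supported_eq_span_single, Submodule.span_le]
  rintro _ ⟨i, hi, rfl⟩
  exact h i hi

theorem exists_zeroDiffMod_htpyEquiv_freeMod {V : Type u} [AddCommGroup V] [Module k V]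
    {gr : ℤ × ℤ → Submodule k V} (hV : DirectSum.IsInternal gr) :
    ∃ (I : Type u) (deg : I → ℤ × ℤ), HtpyEquiv (hA.zeroDiffMod hV) (hA.freeMod deg) := by
  let b := hV.collectedBasis fun x => Module.Basis.ofVectorSpace k (gr x)
  refine ⟨_, fun i => i.1, hA.htpyEquiv_of_linearEquiv b.repr (fun x v hv => ?_) (fun x => ?_)
    fun _ => (map_zero b.repr).symm⟩
  · rw [mem_freeMod_gr]
    rintro ⟨y, a⟩ hi
    by_contra hyx
    exact hi (hV.collectedBasis_repr_of_mem_ne _ (Ne.symm hyx) hv)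
  · refine hA.freeMod_gr_le (S := (gr x).comap b.repr.symm.toLinearMap) fun i hi => ?_
    subst hi
    rw [Submodule.mem_comap, LinearEquiv.coe_coe, b.repr_symm_single_one]
    exact hV.collectedBasis_mem _ i

theorem exists_htpyEquiv_freeMod (M : DGMod A) :
    ∃ (I : Type u) (deg : I → ℤ × ℤ), HtpyEquiv M (hA.freeMod deg) := by
  obtain ⟨h, hh⟩ := M.exists_isSplitting
  obtain ⟨I, deg, e⟩ := hA.exists_zeroDiffMod_htpyEquiv_freeMod
    (isInternal_comap_range_of_idempotent M.internal hh.harmonic_harmonic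
      fun _ _ => hh.harmonic_mem)
  exact ⟨I, deg, (hA.htpyEquiv_zeroDiffMod_harmonic hh).trans e⟩

omit hA in
/-- The tautological map from a free module to the direct sum of its lines. -/
def toSumLines (hA : A.IsBaseField) (deg : I → ℤ × ℤ) :
    (hA.freeMod deg).carrier →ₗ[k] (sum fun i => hA.line (deg i)).carrier :=
  Finsupp.lsum k fun i => (sumIncl (fun i => hA.line (deg i)) i).1 ∘ₗ Finsupp.lsingle PUnit.unit

theorem toSumLines_single (deg : I → ℤ × ℤ) (i : I) :
    hA.toSumLines deg (Finsupp.single i 1) =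
      (sumIncl (fun i => hA.line (deg i)) i).1 (Finsupp.single PUnit.unit 1) := by
  rw [toSumLines, Finsupp.lsum_single]
  rfl

theorem toSumLines_mem_homZ (deg : I → ℤ × ℤ) :
    hA.toSumLines deg ∈ homZ 0 (hA.freeMod deg) (sum fun i => hA.line (deg i)) := by
  refine hA.mem_homZ_zero (fun x v hv => ?_) fun v => ?_
  · refine hA.freeMod_gr_le (S := Submodule.comap (hA.toSumLines deg)
      ((sum fun i => hA.line (deg i)).gr x)) (fun i hi => ?_) hv
    subst hi
    rw [Submodule.mem_comap, toSumLines_single]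
    exact homZ_map_mem (sumIncl _ i).2 (Finsupp.single_mem_supported k 1 rfl)
  · rw [LinearMap.zero_apply, map_zero]
    exact DFinsupp.ext fun _ => rfl

theorem component_comp_toSumLines_notMem_homB (deg : I → ℤ × ℤ) (i : I) :
    (DirectSum.component k I (fun i => (hA.line (deg i)).carrier) i).comp (hA.toSumLines deg) ∉
      homB 0 (hA.freeMod deg) (hA.line (deg i)) := by
  classical
  intro h
  have := LinearMap.congr_fun (eq_zero_of_mem_homB_zero rfl rfl h) (Finsupp.single i 1)
  rw [LinearMap.comp_apply, toSumLines_single] at this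
  exact one_ne_zero (Finsupp.single_eq_zero.1
    ((DirectSum.component.lof_self k i _).symm.trans this))

theorem finite_of_isCompact {P : DGMod A} (hP : P.IsCompact)
    (h : HtpyEquiv P (hA.freeMod deg)) : Finite I := by
  obtain ⟨f, hf, g, hg, -, hfg⟩ := h
  refine Set.finite_univ_iff.1 ((hP.finite_setOf_component_comp_notMem_homB
    (F := fun i => hA.line (deg i)) (fun i => hA.isProjective _)
    (comp_mem_homZ (hA.toSumLines_mem_homZ deg) hf)).subset fun i _ hi => ?_)
  refine hA.component_comp_toSumLines_notMem_homB deg i ?_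
  convert Submodule.sub_mem _ (comp_mem_homB_left hi hg)
    (comp_mem_homB_right (comp_mem_homZ (component_mem_homZ _ i) (hA.toSumLines_mem_homZ deg)) hfg)
    using 1
  refine LinearMap.ext fun v => ?_
  simp

theorem freeMod_isPerf [Finite I] (deg : I → ℤ × ℤ) : (hA.freeMod deg).IsPerf :=
  ⟨hA.isProjective _, (HtpyEquiv.refl _).isCompact_of_finite⟩

theorem exists_htpyEquiv_of_isPerf {P : DGMod A} (hP : P.IsPerf) :
    ∃ (I : Type u) (_ : Fintype I) (deg : I → ℤ × ℤ), HtpyEquiv P (hA.freeMod deg) := by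
  obtain ⟨I, deg, h⟩ := hA.exists_htpyEquiv_freeMod P
  have := hA.finite_of_isCompact hP.2 h
  exact ⟨I, Fintype.ofFinite I, deg, h⟩

theorem isPerf_of_htpyEquiv [Finite I] {P : DGMod A} (h : HtpyEquiv P (hA.freeMod deg)) :
    P.IsPerf :=
  ⟨hA.isProjective P, h.isCompact_of_finite⟩

/-! ### Euler characteristics and the Grothendieck group over the base field -/

theorem homologyDim_freeMod (deg : I → ℤ × ℤ) (x : ℤ × ℤ) :
    homologyDim (hA.freeMod deg) x = Nat.card {i // deg i = x} := by
  have range_d : (LinearMap.range (hA.freeMod deg).d).submoduleOf (cycles (hA.freeMod deg) x) =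
      ⊥ := by
    rw [LinearMap.range_zero, Submodule.submoduleOf, Submodule.comap_bot, Submodule.ker_subtype]
  have cycles_eq : cycles (hA.freeMod deg) x = Finsupp.supported k k {i | deg i = x} := by
    rw [cycles, LinearMap.ker_zero, inf_top_eq]
  rw [homologyDim, (Submodule.quotEquivOfEqBot _ range_d).finrank_eq,
    (LinearEquiv.ofEq _ _ cycles_eq).finrank_eq,
    (Finsupp.supportedEquivFinsupp (R := k) (M := k) {i | deg i = x}).finrank_eq,
    Module.finrank_eq_nat_card_basis Finsupp.basisSingleOne]
  rfl

theorem support_homologyDim_freeMod_subset (deg : I → ℤ × ℤ) :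
    (homologyDim (hA.freeMod deg)).support ⊆ Set.range deg := by
  intro x hx
  by_contra h
  have : IsEmpty {i // deg i = x} := ⟨fun i => h ⟨i.1, i.2⟩⟩
  exact hx (by rw [homologyDim_freeMod, Nat.card_of_isEmpty])

theorem freeMod_hasFiniteHomology [Finite I] (deg : I → ℤ × ℤ) :
    (hA.freeMod deg).HasFiniteHomology where
  finite _ := inferInstance
  finite_support := (Set.finite_range deg).subset (hA.support_homologyDim_freeMod_subset deg)

theorem hasFiniteHomology {P : DGMod A} (hP : P.IsPerf) : P.HasFiniteHomology := by
  obtain ⟨I, _, deg, h⟩ := hA.exists_htpyEquiv_of_isPerf hP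
  exact h.symm.hasFiniteHomology (hA.freeMod_hasFiniteHomology deg)

theorem euler_freeMod [Fintype I] (deg : I → ℤ × ℤ) :
    euler (hA.freeMod deg) = ∑ i, eulerMonomial (deg i) := by
  classical
  rw [euler, eulerSum, finsum_eq_sum_of_support_subset (s := Finset.univ.image deg),
    Finset.sum_comp eulerMonomial deg]
  · refine Finset.sum_congr rfl fun x _ => ?_
    rw [homologyDim_freeMod, nsmul_eq_mul, Nat.card_eq_fintype_card, Fintype.card_subtype]
  · rw [Finset.coe_image, Finset.coe_univ, Set.image_univ]
    refine fun x hx => hA.support_homologyDim_freeMod_subset deg fun h => hx ?_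
    simp only [h, Nat.cast_zero, zero_mul]

theorem regular_htpyEquiv : HtpyEquiv (regular A) (hA.line 0) := by
  refine hA.htpyEquiv_of_linearEquiv
    (hA.equiv.symm.toLinearEquiv ≪≫ₗ (Finsupp.uniqueLinearEquiv k k PUnit.unit.{u + 1}).symm)
    (fun x a ha => ?_) (fun x v hv => ?_) (fun a => ?_)
  · by_cases hx : x = 0
    · exact hA.mem_freeMod_gr.2 fun _ _ => hx.symm
    · have a_eq_zero : a = 0 := by
        obtain ⟨p, q⟩ := x
        by_cases hq : q = 0
        · subst hq
          simp only [if_true] at ha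
          exact hA.eq_zero_of_mem_gr (fun hp => hx (by rw [hp]; rfl)) ha
        · simpa only [hq, if_false, Submodule.mem_bot] using ha
      rw [a_eq_zero, map_zero]
      exact Submodule.zero_mem _
  · by_cases hx : x = 0
    · subst hx
      exact hA.mem_gr_zero _
    · have v_eq_zero : v = 0 := Finsupp.ext fun i => by
        by_contra h
        exact hx (hA.mem_freeMod_gr.1 hv i h).symm
      rw [v_eq_zero, map_zero]
      exact Submodule.zero_mem _
  · rw [show (regular A).d a = 0 from hA.d_eq_zero a, map_zero, LinearMap.zero_apply]

theorem euler_regular : euler (regular A) = 1 := by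
  rw [hA.regular_htpyEquiv.euler_eq, euler_freeMod, Fintype.sum_unique, eulerMonomial_zero]

theorem freeMod_htpyEquiv_shift (deg : I → ℤ × ℤ) :
    HtpyEquiv (hA.freeMod deg) (hA.freeMod fun i => ((deg i).1 + 1, (deg i).2)).shift :=
  hA.htpyEquiv_of_linearEquiv (LinearEquiv.refl k _)
    (fun x v hv => hA.mem_freeMod_gr.2 fun i hi => by
      rw [hA.mem_freeMod_gr.1 hv i hi])
    (fun x v hv => hA.mem_freeMod_gr.2 fun i hi => by
      have := (hA.mem_freeMod_gr (deg := fun i => ((deg i).1 + 1, (deg i).2))).1 hv i hi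
      simpa [Prod.ext_iff] using this)
    (fun _ => by simp)

theorem freeMod_htpyEquiv_qshift (n : ℤ) (deg : I → ℤ × ℤ) :
    HtpyEquiv (hA.freeMod fun i => ((deg i).1, (deg i).2 + n)) ((hA.freeMod deg).qshift n) :=
  hA.htpyEquiv_of_linearEquiv (LinearEquiv.refl k _)
    (fun x v hv => hA.mem_freeMod_gr.2 fun i hi => by
      rw [← hA.mem_freeMod_gr.1 hv i hi]; simp)
    (fun x v hv => hA.mem_freeMod_gr.2 fun i hi => by
      rw [(hA.mem_freeMod_gr (deg := deg)).1 hv i hi]; simp)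
    (fun _ => by simp)

theorem freeMod_htpyEquiv_comp (e : I ≃ J) (deg : J → ℤ × ℤ) :
    HtpyEquiv (hA.freeMod deg) (hA.freeMod (deg ∘ e)) :=
  hA.htpyEquiv_of_linearEquiv (Finsupp.domLCongr e.symm)
    (fun x v hv => hA.mem_freeMod_gr.2 fun i hi => hA.mem_freeMod_gr.1 hv (e i) (by simpa using hi))
    (fun x v hv => hA.mem_freeMod_gr.2 fun i hi => by
      simpa using hA.mem_freeMod_gr.1 hv (e.symm i) (by simpa using hi))
    (fun v => by simp)

theorem freeMod_option_htpyEquiv_cone (deg : Option I → ℤ × ℤ) :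
    HtpyEquiv (hA.freeMod deg)
      (cone (0 : homZ 0 (hA.line ((deg none).1 + 1, (deg none).2))
        (hA.freeMod (deg ∘ some)))) := by
  refine hA.htpyEquiv_of_linearEquiv ((Finsupp.domLCongr (Equiv.optionEquivSumPUnit I)) ≪≫ₗ
    Finsupp.sumFinsuppLEquivProdFinsupp k)
    (fun x v hv => ⟨hA.mem_freeMod_gr.2 fun i hi => ?_, hA.mem_freeMod_gr.2 fun i hi => ?_⟩)
    (fun x v ⟨fst_mem, snd_mem⟩ => hA.mem_freeMod_gr.2 fun i hi => ?_) (fun v => ?_)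
  · exact hA.mem_freeMod_gr.1 hv (some i) (by simpa using hi)
  · rw [hA.mem_freeMod_gr.1 hv none (by simpa using hi)]
  · cases i with
    | none =>
      have := (hA.mem_freeMod_gr (deg := fun _ => ((deg none).1 + 1, (deg none).2))).1 snd_mem
        PUnit.unit (by simpa using hi)
      simpa [Prod.ext_iff] using this
    | some i => exact hA.mem_freeMod_gr.1 fst_mem i (by simpa using hi)
  · simp

theorem cls_line_succ (p q : ℤ) : K0.cls (hA.line (p, q)) (hA.freeMod_isPerf _) =
    -K0.cls (hA.line (p + 1, q)) (hA.freeMod_isPerf _) :=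
  K0.cls_shift _ _ (hA.freeMod_htpyEquiv_shift fun _ : PUnit.{u + 1} => (p, q))

theorem cls_line_zero_right (p : ℤ) : K0.cls (hA.line (p, 0)) (hA.freeMod_isPerf _) =
    eulerMonomial (p, 0) • K0.cls (regular A) (regular_isPerf A) := by
  induction p using Int.induction_on with
  | zero =>
    change _ = eulerMonomial 0 • _
    rw [eulerMonomial_zero, one_smul]
    exact K0.cls_congr _ _ hA.regular_htpyEquiv.symm
  | succ p ih => rw [eulerMonomial_succ, neg_smul, ← ih, hA.cls_line_succ p, neg_neg]
  | pred p ih =>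
    have eulerMonomial_eq := eulerMonomial_succ (-(p : ℤ) - 1) 0
    rw [sub_add_cancel] at eulerMonomial_eq
    rw [cls_line_succ, sub_add_cancel, ih, eulerMonomial_eq, neg_smul, neg_neg]

theorem cls_line (x : ℤ × ℤ) : K0.cls (hA.line x) (hA.freeMod_isPerf _) =
    eulerMonomial x • K0.cls (regular A) (regular_isPerf A) := by
  obtain ⟨p, q⟩ := x
  have cls_eq := K0.cls_qshift q (hA.freeMod_isPerf fun _ : PUnit.{u + 1} => (p, 0))
    (hA.freeMod_isPerf _) (hA.freeMod_htpyEquiv_qshift q fun _ => (p, 0))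
  simp only [zero_add] at cls_eq
  rw [cls_eq, cls_line_zero_right, smul_smul]
  congr 1
  rw [eulerMonomial, eulerMonomial, LaurentPolynomial.T_zero, mul_one, mul_comm]

theorem cls_freeMod [Fintype I] (deg : I → ℤ × ℤ) :
    K0.cls (hA.freeMod deg) (hA.freeMod_isPerf deg) =
      (∑ i, eulerMonomial (deg i)) • K0.cls (regular A) (regular_isPerf A) := by
  revert deg
  refine Fintype.induction_empty_option (P := fun I _ => ∀ deg : I → ℤ × ℤ,
    K0.cls (hA.freeMod deg) (hA.freeMod_isPerf deg) =
      (∑ i, eulerMonomial (deg i)) • K0.cls (regular A) (regular_isPerf A))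
    (fun I J _ e ih deg => ?_) (fun deg => ?_) (fun I _ ih deg => ?_) I
  · have := Finite.of_equiv J e.symm
    rw [K0.cls_congr _ (hA.freeMod_isPerf (deg ∘ e)) (hA.freeMod_htpyEquiv_comp e deg)]
    refine (ih (deg ∘ e)).trans (congrArg (· • _) ?_)
    let := Fintype.ofEquiv J e.symm
    exact e.sum_comp fun i => eulerMonomial (deg i)
  · rw [K0.cls_eq_zero (isContractible_of_subsingleton _)]
    simp
  · have cls_eq := K0.cls_triangle (hA.freeMod_isPerf _) (hA.freeMod_isPerf _)
      (hA.freeMod_isPerf deg) ⟨_, _, _, .refl _, .refl _, hA.freeMod_option_htpyEquiv_cone deg⟩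
    rw [ih, cls_line, eulerMonomial_succ] at cls_eq
    simp only [Function.comp_apply] at cls_eq
    rw [Fintype.sum_option, add_smul, cls_eq]
    simp

theorem cls_eq_euler_smul {P : DGMod A} (hP : P.IsPerf) :
    K0.cls P hP = euler P • K0.cls (regular A) (regular_isPerf A) := by
  obtain ⟨I, _, deg, h⟩ := hA.exists_htpyEquiv_of_isPerf hP
  rw [K0.cls_congr hP (hA.freeMod_isPerf deg) h, cls_freeMod, h.euler_eq, euler_freeMod]

end DGAlg.IsBaseField

namespace DGMod

/-! ### Outer tensor products of homomorphisms -/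

section Outer

variable {A B : DGAlg k} {P P' : DGMod A} {Q Q' : DGMod B}

theorem mem_homDeg_outer {n : ℤ} {F : P.carrier ⊗[k] Q.carrier →ₗ[k] P'.carrier ⊗[k] Q'.carrier}
    (hgr : ∀ x y, ∀ p ∈ P.gr x, ∀ q ∈ Q.gr y,
      F (p ⊗ₜ q) ∈ (P'.outer Q').gr (x.1 + y.1 + n, x.2 + y.2))
    (hact : ∀ i j x y, ∀ a ∈ A.gr i, ∀ b ∈ B.gr j, ∀ p ∈ P.gr x, ∀ q ∈ Q.gr y,
      F (outerAct P Q (DGAlg.tm A B a b) (p ⊗ₜ q)) =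
        sg k (n * (i + j)) • outerAct P' Q' (DGAlg.tm A B a b) (F (p ⊗ₜ q))) :
    F ∈ homDeg n (P.outer Q) (P'.outer Q') := by
  refine ⟨fun p q m hm => ?_, fun t z hz m => ?_⟩
  · refine (Submodule.span_le (p := ((P'.outer Q').gr (p + n, q)).comap F)).2 ?_ hm
    rintro _ ⟨x, y, u, hu, v, hv, hxy, rfl⟩
    have := hgr x y u hu v hv
    change x + y = (p, q) at hxy
    rwa [← Prod.fst_add, ← Prod.snd_add, hxy] at this
  · refine DGAlg.tensorGrading_induction (p := fun z => F (outerAct P Q z m) =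
        sg k (n * t) • outerAct P' Q' z (F m)) (by simp)
      (fun x y hx hy => by simp only [map_add, LinearMap.add_apply, hx, hy, smul_add])
      (fun c x hx => by simp only [map_smul, LinearMap.smul_apply, hx, smul_comm c])
      (fun i j hij a ha b hb => ?_) hz
    refine tensor_hom_induction P.internal Q.internal (p := fun m =>
        F (outerAct P Q (DGAlg.tm A B a b) m) =
          sg k (n * t) • outerAct P' Q' (DGAlg.tm A B a b) (F m)) (by simp)
      (fun x y hx hy => by simp only [map_add, hx, hy, smul_add]) (fun x y p hp q hq => ?_) m
    rw [hact i j x y a ha b hb p hp q hq, hij]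

/-- The tensor product `p ⊗ q ↦ (-1) ^ (n * deg p) f(p) ⊗ g(q)` of linear maps, with the sign of the
Koszul rule for `g` of degree `n`. -/
def koszulMap (n : ℤ) (f : P.carrier →ₗ[k] P'.carrier) (g : Q.carrier →ₗ[k] Q'.carrier) :
    P.carrier ⊗[k] Q.carrier →ₗ[k] P'.carrier ⊗[k] Q'.carrier :=
  TensorProduct.map (f ∘ₗ gscale P.internal fun x => sg k (n * x.1)) g

theorem koszulMap_tmul (n : ℤ) (f : P.carrier →ₗ[k] P'.carrier) (g : Q.carrier →ₗ[k] Q'.carrier)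
    {x : ℤ × ℤ} {p : P.carrier} (hp : p ∈ P.gr x) (q : Q.carrier) :
    koszulMap n f g (p ⊗ₜ q) = sg k (n * x.1) • f p ⊗ₜ g q := by
  rw [koszulMap, TensorProduct.map_tmul, LinearMap.comp_apply, gscale_of_mem P.internal _ hp,
    map_smul, TensorProduct.smul_tmul']

theorem koszulMap_zero (f : P.carrier →ₗ[k] P'.carrier) (g : Q.carrier →ₗ[k] Q'.carrier) :
    koszulMap 0 f g = TensorProduct.map f g :=
  outer_ext fun x y p hp q _ => by
    rw [koszulMap_tmul 0 f g hp, zero_mul, sg_zero, one_smul, TensorProduct.map_tmul]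

theorem koszulMap_mem_homDeg {m n : ℤ} {f : P.carrier →ₗ[k] P'.carrier}
    {g : Q.carrier →ₗ[k] Q'.carrier} (hf : f ∈ homDeg m P P') (hg : g ∈ homDeg n Q Q') :
    koszulMap n f g ∈ homDeg (m + n) (P.outer Q) (P'.outer Q') := by
  refine mem_homDeg_outer (fun x y p hp q hq => ?_) (fun i j x _ a ha b hb p hp q _ => ?_)
  · rw [koszulMap_tmul n f g hp]
    exact Submodule.smul_mem _ _ (tmul_mem_tensorGr (hf.1 x.1 x.2 p hp) (hg.1 y.1 y.2 q hq)
      (Prod.ext (by simp only [Prod.fst_add]; ring) rfl))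
  · obtain ⟨x₁, x₂⟩ := x
    rw [outerAct_tmul P Q a hb hp, map_smul, koszulMap_tmul n f g (P.act_mem ha hp),
      koszulMap_tmul n f g hp, hf.2 i a ha, hg.2 j b hb, map_smul,
      outerAct_tmul P' Q' a hb (hf.1 x₁ x₂ p hp), TensorProduct.tmul_smul,
      ← TensorProduct.smul_tmul']
    simp only [smul_smul]
    congr 1
    simp only [mul_add, add_mul, sg_add, mul_comm j m]
    linear_combination (-(sg k (j * x₁) * sg k (n * i) * sg k (n * x₁) * sg k (n * j) *
      sg k (m * i))) * sg_mul_self k (m * j)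

theorem homD_koszulMap {m : ℤ} (n : ℤ) {f : P.carrier →ₗ[k] P'.carrier} (hf : f ∈ homDeg m P P')
    (g : Q.carrier →ₗ[k] Q'.carrier) :
    homD (m + n) (P.outer Q) (P'.outer Q') (koszulMap n f g) =
      koszulMap n (homD m P P' f) g + sg k m • koszulMap (n + 1) f (homD n Q Q' g) := by
  refine outer_ext fun x y p hp q _ => ?_
  obtain ⟨x₁, x₂⟩ := x
  rw [homD_apply, tensorD_tmul _ _ _ _ hp, LinearMap.add_apply, LinearMap.smul_apply, map_add,
    map_smul]
  simp only [koszulMap_tmul _ _ _ hp, koszulMap_tmul _ _ _ (P.d_mem hp), map_smul,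
    tensorD_tmul _ _ _ _ (hf.1 x₁ x₂ p hp), homD_apply, TensorProduct.sub_tmul,
    TensorProduct.tmul_sub, TensorProduct.tmul_smul, ← TensorProduct.smul_tmul', sg_add, mul_add,
    add_mul, mul_one, one_mul]
  have hn := sg_mul_self k n
  match_scalars
  · ring
  · ring
  · linear_combination (-(sg k m * sg k (n * x₁))) * hn
  · ring

theorem koszulMap_mem_homZ {m n : ℤ} {f : P.carrier →ₗ[k] P'.carrier}
    {g : Q.carrier →ₗ[k] Q'.carrier} (hf : f ∈ homZ m P P') (hg : g ∈ homZ n Q Q') :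
    koszulMap n f g ∈ homZ (m + n) (P.outer Q) (P'.outer Q') := by
  refine ⟨koszulMap_mem_homDeg hf.1 hg.1, LinearMap.mem_ker.2 ?_⟩
  rw [homD_koszulMap n hf.1, LinearMap.mem_ker.1 hf.2, LinearMap.mem_ker.1 hg.2]
  simp [koszulMap]

theorem koszulMap_mem_homB_left {m n : ℤ} {f : P.carrier →ₗ[k] P'.carrier}
    {g : Q.carrier →ₗ[k] Q'.carrier} (hf : f ∈ homB m P P') (hg : g ∈ homZ n Q Q') :
    koszulMap n f g ∈ homB (m + n) (P.outer Q) (P'.outer Q') := by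
  obtain ⟨s, hs, rfl⟩ := hf
  rw [homB, add_sub_right_comm]
  refine ⟨koszulMap n s g, koszulMap_mem_homDeg hs hg.1, ?_⟩
  rw [homD_koszulMap n hs, LinearMap.mem_ker.1 hg.2]
  simp [koszulMap]

theorem koszulMap_mem_homB_right {m n : ℤ} {f : P.carrier →ₗ[k] P'.carrier}
    {g : Q.carrier →ₗ[k] Q'.carrier} (hf : f ∈ homZ m P P') (hg : g ∈ homB n Q Q') :
    koszulMap n f g ∈ homB (m + n) (P.outer Q) (P'.outer Q') := by
  obtain ⟨s, hs, rfl⟩ := hg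
  rw [homB, add_sub_assoc]
  refine ⟨sg k m • koszulMap (n - 1) f s, Submodule.smul_mem _ _ (koszulMap_mem_homDeg hf.1 hs), ?_⟩
  rw [map_smul, homD_koszulMap (n - 1) hf.1, LinearMap.mem_ker.1 hf.2, sub_add_cancel, smul_add,
    smul_smul, sg_mul_self, one_smul]
  simp [koszulMap]

theorem map_mem_homZ_outer {f : P.carrier →ₗ[k] P'.carrier} {g : Q.carrier →ₗ[k] Q'.carrier}
    (hf : f ∈ homZ 0 P P') (hg : g ∈ homZ 0 Q Q') :
    TensorProduct.map f g ∈ homZ 0 (P.outer Q) (P'.outer Q') := by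
  have := koszulMap_mem_homZ hf hg
  rwa [koszulMap_zero, add_zero] at this

theorem map_mem_homB_outer_left {f : P.carrier →ₗ[k] P'.carrier} {g : Q.carrier →ₗ[k] Q'.carrier}
    (hf : f ∈ homB 0 P P') (hg : g ∈ homZ 0 Q Q') :
    TensorProduct.map f g ∈ homB 0 (P.outer Q) (P'.outer Q') := by
  have := koszulMap_mem_homB_left hf hg
  rwa [koszulMap_zero, add_zero] at this

theorem map_mem_homB_outer_right {f : P.carrier →ₗ[k] P'.carrier} {g : Q.carrier →ₗ[k] Q'.carrier}
    (hf : f ∈ homZ 0 P P') (hg : g ∈ homB 0 Q Q') :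
    TensorProduct.map f g ∈ homB 0 (P.outer Q) (P'.outer Q') := by
  have := koszulMap_mem_homB_right hf hg
  rwa [koszulMap_zero, add_zero] at this

theorem map_sub_id_mem_homB_outer {f : P.carrier →ₗ[k] P.carrier} {g : Q.carrier →ₗ[k] Q.carrier}
    (hf : f - LinearMap.id ∈ homB 0 P P) (hg : g ∈ homZ 0 Q Q)
    (hg' : g - LinearMap.id ∈ homB 0 Q Q) :
    TensorProduct.map f g - LinearMap.id ∈ homB 0 (P.outer Q) (P.outer Q) := by
  have decomposition : TensorProduct.map f g - LinearMap.id =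
      TensorProduct.map (f - LinearMap.id) g +
        TensorProduct.map LinearMap.id (g - LinearMap.id) := by
    refine TensorProduct.ext' fun p q => ?_
    simp [TensorProduct.sub_tmul, TensorProduct.tmul_sub]
  rw [decomposition]
  exact Submodule.add_mem _ (map_mem_homB_outer_left hf hg)
    (map_mem_homB_outer_right (id_mem_homZ P) hg')

theorem HtpyEquiv.outer (hP : HtpyEquiv P P') (hQ : HtpyEquiv Q Q') :
    HtpyEquiv (P.outer Q) (P'.outer Q') := by
  obtain ⟨f, hf, f', hf', hff', hf'f⟩ := hP
  obtain ⟨g, hg, g', hg', hgg', hg'g⟩ := hQ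
  refine ⟨_, map_mem_homZ_outer hf hg, _, map_mem_homZ_outer hf' hg', ?_, ?_⟩
  · rw [← TensorProduct.map_comp]
    exact map_sub_id_mem_homB_outer hff' (comp_mem_homZ hg' hg) hgg'
  · rw [← TensorProduct.map_comp]
    exact map_sub_id_mem_homB_outer hf'f (comp_mem_homZ hg hg') hg'g

theorem IsContractible.outer_left (h : P.IsContractible) (Q : DGMod B) :
    (P.outer Q).IsContractible := by
  have := map_mem_homB_outer_left h (id_mem_homZ Q)
  rwa [TensorProduct.map_id] at this

theorem IsContractible.outer_right (P : DGMod A) (h : Q.IsContractible) :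
    (P.outer Q).IsContractible := by
  have := map_mem_homB_outer_right (id_mem_homZ P) h
  rwa [TensorProduct.map_id] at this

end Outer

/-! ### Restriction and extension of scalars -/

section Restrict

variable {A C : DGAlg k} (φ : DGHom A C) {M N : DGMod C}

theorem mem_homZ_restrict {f : M.carrier →ₗ[k] N.carrier} (hf : f ∈ homZ 0 M N) :
    f ∈ homZ 0 (restrict φ M) (restrict φ N) :=
  mem_homZ_zero (fun _ _ hm => homZ_map_mem hf hm) (fun _ m => homZ_act hf _ m)
    fun m => homZ_comm (M := M) (N := N) hf m

theorem mem_homB_restrict {n : ℤ} {f : M.carrier →ₗ[k] N.carrier} (hf : f ∈ homB n M N) :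
    f ∈ homB n (restrict φ M) (restrict φ N) := by
  obtain ⟨s, hs, rfl⟩ := hf
  exact ⟨s, ⟨hs.1, fun i a ha m => hs.2 i _ (φ.map_mem ha) m⟩, rfl⟩

theorem HtpyEquiv.restrict (h : HtpyEquiv M N) : HtpyEquiv (restrict φ M) (restrict φ N) := by
  obtain ⟨f, hf, g, hg, hfg, hgf⟩ := h
  exact ⟨f, mem_homZ_restrict φ hf, g, mem_homZ_restrict φ hg, mem_homB_restrict φ hfg,
    mem_homB_restrict φ hgf⟩

theorem IsContractible.restrict (h : M.IsContractible) : (restrict φ M).IsContractible :=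
  mem_homB_restrict φ h

end Restrict

section Extend

variable {A C : DGAlg k} (φ : DGHom A C) (M : DGMod A)

/-- The unit `M → C ⊗_A M` of the adjunction between extension and restriction of scalars. -/
def toExtend : M.carrier →ₗ[k] (extend φ M).carrier :=
  (extRel φ M).mkQ.comp (TensorProduct.mk k C.carrier M.carrier 1)

theorem mkQ_tmul_eq_act_toExtend (c : C.carrier) (m : M.carrier) :
    (extRel φ M).mkQ (c ⊗ₜ m) = (extend φ M).act c (toExtend φ M m) := by
  change _ = (extRel φ M).mkQ ((c * 1) ⊗ₜ m)
  rw [mul_one]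

theorem toExtend_act (a : A.carrier) (m : M.carrier) :
    toExtend φ M (M.act a m) = (extend φ M).act (φ.toAlgHom a) (toExtend φ M m) := by
  rw [← mkQ_tmul_eq_act_toExtend]
  have h := rel_mem_extRel φ M 1 a m
  rw [one_mul] at h
  exact ((Submodule.Quotient.eq _).2 h).symm

theorem toExtend_mem {x : ℤ × ℤ} {m : M.carrier} (hm : m ∈ M.gr x) :
    toExtend φ M m ∈ (extend φ M).gr x :=
  Submodule.mem_map_of_mem (tmul_mem_tensorGr C.one_mem hm (by simp))

theorem d_mkQ_tmul {i : ℤ} {c : C.carrier} (hc : c ∈ C.gr i) (m : M.carrier) :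
    (extend φ M).d ((extRel φ M).mkQ (c ⊗ₜ m)) =
      (extRel φ M).mkQ (C.d c ⊗ₜ m) + sg k i • (extRel φ M).mkQ (c ⊗ₜ M.d m) := by
  change (extRel φ M).mkQ (tensorD C.internal (sg k) C.d M.d (c ⊗ₜ m)) = _
  rw [tensorD_tmul _ _ _ _ hc, map_add, map_smul]

theorem d_toExtend (m : M.carrier) : (extend φ M).d (toExtend φ M m) = toExtend φ M (M.d m) := by
  refine (d_mkQ_tmul φ M C.one_mem m).trans ?_
  rw [C.d_one, TensorProduct.zero_tmul, map_zero, zero_add, sg_zero, one_smul]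
  rfl

variable {φ M} {N : DGMod C}

theorem comp_toExtend_mem_homZ {n : ℤ} {f : (extend φ M).carrier →ₗ[k] N.carrier}
    (hf : f ∈ homZ n (extend φ M) N) : f.comp (toExtend φ M) ∈ homZ n M (restrict φ N) := by
  refine ⟨⟨fun p q m hm => hf.1.1 p q _ (toExtend_mem φ M hm), fun i a ha m => ?_⟩,
    LinearMap.mem_ker.2 (LinearMap.ext fun m => ?_)⟩
  · rw [LinearMap.comp_apply, toExtend_act, hf.1.2 i _ (φ.map_mem ha)]
    rfl
  · rw [homD_apply, LinearMap.comp_apply, LinearMap.comp_apply, LinearMap.zero_apply, sub_eq_zero,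
      ← d_toExtend]
    exact homZ_d_apply hf _

/-- The map `c ⊗ m ↦ (-1) ^ (n * deg c) c s(m)` induced by a homogeneous map `s` of degree `n`. -/
def extendHom {n : ℤ} {s : M.carrier →ₗ[k] N.carrier} (hs : s ∈ homDeg n M (restrict φ N)) :
    (extend φ M).carrier →ₗ[k] N.carrier :=
  (extRel φ M).liftQ (TensorProduct.lift
      ((LinearMap.lcomp k N.carrier s).comp (N.act.comp (C.epsPow n)).toLinearMap)) (by
    refine extRel_le φ M fun i j x c _ a ha m _ => ?_
    rw [LinearMap.mem_ker, map_sub, sub_eq_zero, TensorProduct.lift.tmul, TensorProduct.lift.tmul]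
    change N.act (C.epsPow n (c * φ.toAlgHom a)) (s m) = N.act (C.epsPow n c) (s (M.act a m))
    rw [hs.2 j a ha m, map_mul, C.epsPow_of_mem n (φ.map_mem ha), map_mul, map_smul, map_smul,
      mul_comm j n, mul_smul_comm]
    rfl)

theorem extendHom_mkQ_tmul {n : ℤ} {s : M.carrier →ₗ[k] N.carrier}
    (hs : s ∈ homDeg n M (restrict φ N)) {i : ℤ} {c : C.carrier} (hc : c ∈ C.gr i)
    (m : M.carrier) :
    extendHom hs ((extRel φ M).mkQ (c ⊗ₜ m)) = sg k (i * n) • N.act c (s m) := by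
  change N.act (C.epsPow n c) (s m) = _
  rw [C.epsPow_of_mem n hc, map_smul, LinearMap.smul_apply]

theorem extend_hom_ext {V : Type*} [AddCommGroup V] [Module k V]
    {f g : (extend φ M).carrier →ₗ[k] V}
    (h : ∀ i, ∀ c ∈ C.gr i, ∀ m,
      f ((extRel φ M).mkQ (c ⊗ₜ m)) = g ((extRel φ M).mkQ (c ⊗ₜ m))) : f = g :=
  Submodule.linearMap_qext _ <| TensorProduct.ext <| LOTCat.hom_ext C.internal fun i c hc =>
    LinearMap.ext (h i c hc)

theorem extendHom_mem_homDeg {n : ℤ} {s : M.carrier →ₗ[k] N.carrier}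
    (hs : s ∈ homDeg n M (restrict φ N)) : extendHom hs ∈ homDeg n (extend φ M) N := by
  refine ⟨fun p q z hz => ?_, fun i c hc z => ?_⟩
  · obtain ⟨z, hz, rfl⟩ := hz
    refine (Submodule.span_le (p := (N.gr (p + n, q)).comap
      ((extendHom hs).comp (extRel φ M).mkQ))).2 ?_ hz
    rintro _ ⟨i, ⟨x₁, x₂⟩, c, hc, m, hm, hx, rfl⟩
    obtain ⟨rfl, rfl⟩ := Prod.mk.inj hx
    rw [SetLike.mem_coe, Submodule.mem_comap, LinearMap.comp_apply, extendHom_mkQ_tmul hs hc]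
    have := N.act_mem hc (hs.1 _ _ m hm)
    rw [← add_assoc] at this
    exact Submodule.smul_mem _ _ this
  · refine LinearMap.congr_fun (f := (extendHom hs).comp ((extend φ M).act c))
      (g := sg k (n * i) • (N.act c).comp (extendHom hs))
      (extend_hom_ext fun j c' hc' m => ?_) z
    rw [LinearMap.comp_apply, LinearMap.smul_apply, LinearMap.comp_apply,
      extendHom_mkQ_tmul hs hc']
    change extendHom hs ((extRel φ M).mkQ ((c * c') ⊗ₜ m)) = _
    rw [extendHom_mkQ_tmul hs (C.mul_mem hc hc'), map_mul, Module.End.mul_apply, map_smul,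
      smul_smul, add_mul, sg_add, mul_comm n i]

theorem homD_extendHom_mkQ_tmul {n : ℤ} {s : M.carrier →ₗ[k] N.carrier}
    (hs : s ∈ homDeg n M (restrict φ N)) {i : ℤ} {c : C.carrier} (hc : c ∈ C.gr i)
    (m : M.carrier) :
    homD n (extend φ M) N (extendHom hs) ((extRel φ M).mkQ (c ⊗ₜ m)) =
      sg k (i * (n + 1)) • N.act c (homD n M (restrict φ N) s m) := by
  rw [homD_apply, homD_apply, d_mkQ_tmul φ M hc, map_add, map_smul,
    extendHom_mkQ_tmul hs (C.d_mem hc), extendHom_mkQ_tmul hs hc, extendHom_mkQ_tmul hs hc,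
    map_smul, N.leibniz hc, map_sub, map_smul, sg_succ_mul, sg_mul_succ]
  match_scalars
  · linear_combination (-sg k (i * n)) * sg_mul_self k n
  · ring
  · ring

theorem IsProjective.extend {P : DGMod A} (hP : P.IsProjective) (φ : DGHom A C) :
    (extend φ P).IsProjective := by
  intro N hN n f hf
  obtain ⟨s, hs, hsf⟩ := hP (restrict φ N) hN n (comp_toExtend_mem_homZ hf)
  refine ⟨extendHom hs, extendHom_mem_homDeg hs, extend_hom_ext fun i c hc m => ?_⟩
  rw [homD_extendHom_mkQ_tmul hs hc, hsf, sub_add_cancel, mul_comm, mkQ_tmul_eq_act_toExtend,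
    hf.1.2 i c hc, LinearMap.comp_apply]

end Extend

end DGMod

theorem DGMod.IsAcyclic.hasFiniteHomology {A : DGAlg k} {M : DGMod A} (hM : M.IsAcyclic) :
    M.HasFiniteHomology := by
  have subsingleton_homology (x : ℤ × ℤ) : Subsingleton (homology M x) := by
    refine Submodule.Quotient.subsingleton_iff.2 (eq_top_iff.2 fun m _ => ?_)
    exact hM m m.2.2
  refine ⟨fun x => inferInstance, ?_⟩
  have homologyDim_eq_zero : homologyDim M = 0 :=
    funext fun x => Module.finrank_zero_of_subsingleton
  rw [homologyDim_eq_zero, Function.support_zero]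
  exact Set.finite_empty

namespace DGAlg

open DGMod

variable {A B C : DGAlg k}

/-! ### Tensor products and change of rings for the base field -/

theorem IsAcyclic.tensor_left (hA : A.IsAcyclic) (B : DGAlg k) : (A.tensor B).IsAcyclic := by
  obtain ⟨s, hs, hd⟩ := hA
  refine ⟨tm A B s 1, tm_mem hs B.one_mem (by norm_num), ?_⟩
  rw [tensorDiff_tm hs, hd, B.d_one, tm_zero_right, smul_zero, add_zero]
  rfl

theorem IsAcyclic.tensor_right (A : DGAlg k) (hB : B.IsAcyclic) : (A.tensor B).IsAcyclic := by
  obtain ⟨s, hs, hd⟩ := hB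
  refine ⟨tm A B 1 s, tm_mem A.one_mem hs (by norm_num), ?_⟩
  rw [tensorDiff_tm A.one_mem, hd, A.d_one, tm_zero_left, sg_zero, one_smul, zero_add]
  rfl

namespace IsBaseField

variable (hA : A.IsBaseField) (hB : B.IsBaseField) (hC : C.IsBaseField)

include hA hB in
theorem tensor : (A.tensor B).IsBaseField := by
  refine ⟨?_, fun z => ?_⟩
  · let F : GradedTensorProduct k A.gr B.gr →ₗ[k] k :=
      (TensorProduct.lid k k).toLinearMap ∘ₗ
        TensorProduct.map hA.equiv.symm.toLinearMap hB.equiv.symm.toLinearMap ∘ₗ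
          (GradedTensorProduct.of k A.gr B.gr).symm.toLinearMap
    have F_one : F 1 = 1 := by
      change hA.equiv.symm 1 • hB.equiv.symm 1 = 1
      rw [map_one, map_one, smul_eq_mul, mul_one]
    intro c c' h
    have := congrArg F h
    rw [Algebra.algebraMap_eq_smul_one, Algebra.algebraMap_eq_smul_one, map_smul, map_smul,
      F_one] at this
    simpa using this
  · refine tm_induction (p := fun z => ∃ c, algebraMap k (GradedTensorProduct k A.gr B.gr) c = z)
      ⟨0, map_zero _⟩ ?_ (fun i j a _ b _ => ?_) z
    · rintro _ _ ⟨c, rfl⟩ ⟨c', rfl⟩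
      exact ⟨c + c', map_add _ _ _⟩
    · obtain ⟨c, rfl⟩ := hA.exists_eq_smul_one a
      obtain ⟨c', rfl⟩ := hB.exists_eq_smul_one b
      refine ⟨c * c', ?_⟩
      rw [tm_smul_left, tm_smul_right, smul_smul, Algebra.algebraMap_eq_smul_one]
      rfl

include hA in
theorem isPerf_congr {P P' : DGMod A} (h : HtpyEquiv P P') (hP : P'.IsPerf) : P.IsPerf := by
  obtain ⟨I, _, deg, h'⟩ := hA.exists_htpyEquiv_of_isPerf hP
  exact hA.isPerf_of_htpyEquiv (h.trans h')

section Outer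

variable {I J : Type u} (deg : I → ℤ × ℤ) (deg' : J → ℤ × ℤ)

theorem finsuppTensorFinsupp'_mem_freeMod_gr {x : ℤ × ℤ} {z : (I →₀ k) ⊗[k] (J →₀ k)}
    (hz : z ∈ ((hA.freeMod deg).outer (hB.freeMod deg')).gr x) :
    finsuppTensorFinsupp' k I J z ∈
      ((hA.tensor hB).freeMod fun i : I × J => deg i.1 + deg' i.2).gr x := by
  refine (Submodule.span_le (p := Submodule.comap (finsuppTensorFinsupp' k I J).toLinearMap
    (((hA.tensor hB).freeMod fun i : I × J => deg i.1 + deg' i.2).gr x))).2 ?_ hz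
  rintro _ ⟨y, y', v, hv, w, hw, rfl, rfl⟩
  refine ((hA.tensor hB).mem_freeMod_gr (deg := fun i : I × J => deg i.1 + deg' i.2)).2 ?_
  rintro ⟨i, j⟩ hij
  rw [LinearEquiv.coe_coe, finsuppTensorFinsupp'_apply_apply] at hij
  rw [hA.mem_freeMod_gr.1 hv i (left_ne_zero_of_mul hij),
    hB.mem_freeMod_gr.1 hw j (right_ne_zero_of_mul hij)]

theorem finsuppTensorFinsupp'_symm_mem_outer_gr {x : ℤ × ℤ} {v : I × J →₀ k}
    (hv : v ∈ ((hA.tensor hB).freeMod fun i : I × J => deg i.1 + deg' i.2).gr x) :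
    (finsuppTensorFinsupp' k I J).symm v ∈
      ((hA.freeMod deg).outer (hB.freeMod deg')).gr x := by
  refine (hA.tensor hB).freeMod_gr_le (S := Submodule.comap
    (finsuppTensorFinsupp' k I J).symm.toLinearMap
    (((hA.freeMod deg).outer (hB.freeMod deg')).gr x)) ?_ hv
  rintro ⟨i, j⟩ rfl
  rw [Submodule.mem_comap, LinearEquiv.coe_coe,
    finsuppTensorFinsupp'_symm_single_eq_single_one_tmul]
  exact tmul_mem_tensorGr (Finsupp.single_mem_supported k 1 rfl)
    (Finsupp.single_mem_supported k 1 rfl) rfl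

theorem outer_freeMod_d : ((hA.freeMod deg).outer (hB.freeMod deg')).d = 0 :=
  outer_ext fun x y p hp q _ => by rw [tensorD_tmul _ _ _ _ hp]; simp

theorem outer_freeMod_htpyEquiv : HtpyEquiv ((hA.freeMod deg).outer (hB.freeMod deg'))
    ((hA.tensor hB).freeMod fun i : I × J => deg i.1 + deg' i.2) := by
  refine (hA.tensor hB).htpyEquiv_of_linearEquiv (finsuppTensorFinsupp' k I J)
    (fun _ _ => hA.finsuppTensorFinsupp'_mem_freeMod_gr hB deg deg')
    (fun _ _ => hA.finsuppTensorFinsupp'_symm_mem_outer_gr hB deg deg') fun z => ?_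
  rw [outer_freeMod_d, LinearMap.zero_apply, LinearMap.zero_apply, map_zero]

variable {P : DGMod A} {Q : DGMod B}

include hA hB

theorem outer_isPerf (hP : P.IsPerf) (hQ : Q.IsPerf) : (P.outer Q).IsPerf := by
  obtain ⟨I, _, deg, h⟩ := hA.exists_htpyEquiv_of_isPerf hP
  obtain ⟨J, _, deg', h'⟩ := hB.exists_htpyEquiv_of_isPerf hQ
  exact (hA.tensor hB).isPerf_of_htpyEquiv
    ((h.outer h').trans (hA.outer_freeMod_htpyEquiv hB deg deg'))

theorem euler_outer (hP : P.IsPerf) (hQ : Q.IsPerf) :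
    euler (P.outer Q) = euler P * euler Q := by
  obtain ⟨I, _, deg, h⟩ := hA.exists_htpyEquiv_of_isPerf hP
  obtain ⟨J, _, deg', h'⟩ := hB.exists_htpyEquiv_of_isPerf hQ
  rw [((h.outer h').trans (hA.outer_freeMod_htpyEquiv hB deg deg')).euler_eq, h.euler_eq,
    h'.euler_eq, euler_freeMod, euler_freeMod, euler_freeMod, Fintype.sum_prod_type,
    Finset.sum_mul_sum]
  simp only [eulerMonomial_add]

end Outer

include hA hC in
theorem restrict_isPerf (φ : DGHom A C) {P : DGMod C} (hP : P.IsPerf) :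
    (restrict φ P).IsPerf := by
  obtain ⟨I, _, deg, h⟩ := hC.exists_htpyEquiv_of_isPerf hP
  exact hA.isPerf_of_htpyEquiv ((h.restrict φ).trans (hA.htpyEquiv_of_linearEquiv
    (N := hA.freeMod deg) (LinearEquiv.refl k _) (fun _ _ h => h) (fun _ _ h => h) fun _ => rfl))

/-- The homomorphism between two dg algebras which are equal to the base field. -/
def homFrom : DGHom C A where
  toAlgHom := (Algebra.ofId k A.carrier).comp hC.equiv.symm.toAlgHom
  map_mem := by
    intro i c hc
    by_cases hi : i = 0
    · subst hi
      exact hA.mem_gr_zero _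
    · rw [hC.eq_zero_of_mem_gr hi hc, map_zero]
      exact Submodule.zero_mem _
  map_d c := by rw [hC.d_eq_zero, hA.d_eq_zero, map_zero]

section Extend

variable (φ : DGHom A C) (M : DGMod A)

/-- Over the base field, the evaluation `C ⊗_A M → M`, `c ⊗ m ↦ c m`. -/
def ofExtend : (extend φ M).carrier →ₗ[k] M.carrier :=
  (extRel φ M).liftQ
    (TensorProduct.lift ((LinearMap.lsmul k M.carrier).comp hC.equiv.symm.toLinearMap)) <| by
      refine Submodule.span_le.2 ?_
      rintro _ ⟨c, a, m, rfl⟩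
      obtain ⟨r, rfl⟩ := hA.exists_eq_smul_one a
      rw [SetLike.mem_coe, LinearMap.mem_ker]
      simp [smul_smul]

theorem ofExtend_mkQ_tmul (c : C.carrier) (m : M.carrier) :
    hA.ofExtend hC φ M ((extRel φ M).mkQ (c ⊗ₜ m)) = hC.equiv.symm c • m := rfl

theorem ofExtend_toExtend (m : M.carrier) : hA.ofExtend hC φ M (toExtend φ M m) = m := by
  refine (hA.ofExtend_mkQ_tmul hC φ M 1 m).trans ?_
  rw [map_one, one_smul]

theorem toExtend_ofExtend (z : (extend φ M).carrier) :
    toExtend φ M (hA.ofExtend hC φ M z) = z := by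
  refine LinearMap.congr_fun (f := (toExtend φ M).comp (hA.ofExtend hC φ M)) (g := LinearMap.id)
    (extend_hom_ext fun i c _ m => ?_) z
  obtain ⟨r, rfl⟩ := hC.exists_eq_smul_one c
  rw [LinearMap.comp_apply, ofExtend_mkQ_tmul, map_smul, map_smul, map_one, smul_eq_mul, mul_one,
    ← TensorProduct.smul_tmul', map_smul]
  rfl

theorem ofExtend_mem {x : ℤ × ℤ} {z : (extend φ M).carrier} (hz : z ∈ (extend φ M).gr x) :
    hA.ofExtend hC φ M z ∈ M.gr x := by
  obtain ⟨z, hz, rfl⟩ := hz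
  refine (Submodule.span_le
    (p := (M.gr x).comap ((hA.ofExtend hC φ M).comp (extRel φ M).mkQ))).2 ?_ hz
  rintro _ ⟨i, y, c, hc, m, hm, rfl, rfl⟩
  rw [SetLike.mem_coe, Submodule.mem_comap, LinearMap.comp_apply, ofExtend_mkQ_tmul]
  by_cases hi : i = 0
  · subst hi
    simp only [zero_add]
    exact Submodule.smul_mem _ _ hm
  · rw [hC.eq_zero_of_mem_gr hi hc, map_zero, zero_smul]
    exact Submodule.zero_mem _

theorem extend_htpyEquiv : HtpyEquiv (extend φ M) (restrict (hA.homFrom hC) M) :=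
  (hC.htpyEquiv_of_linearEquiv (M := restrict (hA.homFrom hC) M) (N := extend φ M)
    (LinearEquiv.ofLinearMap (toExtend φ M) (hA.ofExtend hC φ M)
      (LinearMap.ext (hA.toExtend_ofExtend hC φ M)) (LinearMap.ext (hA.ofExtend_toExtend hC φ M)))
    (fun _ _ hm => toExtend_mem φ M hm) (fun _ _ hz => hA.ofExtend_mem hC φ M hz)
    fun m => d_toExtend φ M m).symm

include hA hC

theorem extend_isPerf {P : DGMod A} (hP : P.IsPerf) : (extend φ P).IsPerf :=
  hC.isPerf_congr (hA.extend_htpyEquiv hC φ P) (hC.restrict_isPerf hA _ hP)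

theorem euler_extend : euler (extend φ M) = euler M :=
  (hA.extend_htpyEquiv hC φ M).euler_eq

end Extend

end IsBaseField

end DGAlg

/-! ### Euler characteristics and Grothendieck groups -/

/-- Properness, in the form that the Euler characteristic requires: the homology of every compact
projective module is finite-dimensional. -/
class DGAlg.IsProper (A : DGAlg k) : Prop where
  hasFiniteHomology {P : DGMod A} : P.IsPerf → P.HasFiniteHomology

/-- Dg algebras which are either the base field or acyclic: the class, closed under tensor products,
to which all the `H⁻ₙ` belong. -/
class DGAlg.IsBaseFieldOrAcyclic (A : DGAlg k) : Prop where
  isBaseField_or_isAcyclic : A.IsBaseField ∨ A.IsAcyclic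

theorem DGAlg.isBaseField_or_isAcyclic (A : DGAlg k) [h : A.IsBaseFieldOrAcyclic] :
    A.IsBaseField ∨ A.IsAcyclic :=
  h.isBaseField_or_isAcyclic

instance (A : DGAlg k) [A.IsBaseFieldOrAcyclic] : A.IsProper where
  hasFiniteHomology {P} hP := by
    rcases A.isBaseField_or_isAcyclic with hA | hA
    · exact hA.hasFiniteHomology hP
    · exact (hA.isAcyclic P).hasFiniteHomology

instance (A B : DGAlg k) [A.IsBaseFieldOrAcyclic] [B.IsBaseFieldOrAcyclic] :
    (A.tensor B).IsBaseFieldOrAcyclic where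
  isBaseField_or_isAcyclic := by
    rcases A.isBaseField_or_isAcyclic with hA | hA
    · exact B.isBaseField_or_isAcyclic.imp hA.tensor fun hB => hB.tensor_right A
    · exact .inr (hA.tensor_left B)

theorem DGHom.isAcyclic_or_isBaseField {A C : DGAlg k} [A.IsBaseFieldOrAcyclic]
    [C.IsBaseFieldOrAcyclic] (φ : DGHom A C) : C.IsAcyclic ∨ A.IsBaseField ∧ C.IsBaseField := by
  rcases C.isBaseField_or_isAcyclic with hC | hC
  · exact .inr ⟨A.isBaseField_or_isAcyclic.resolve_right fun hA =>
      hC.not_isAcyclic (hA.of_dgHom φ), hC⟩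
  · exact .inl hC

section IsPerf

open DGMod

variable {A B C : DGAlg k} [A.IsBaseFieldOrAcyclic] [B.IsBaseFieldOrAcyclic]
  [C.IsBaseFieldOrAcyclic] (φ : DGHom A C)

theorem DGMod.IsPerf.outer {P : DGMod A} {Q : DGMod B} (hP : P.IsPerf) (hQ : Q.IsPerf) :
    (P.outer Q).IsPerf := by
  rcases A.isBaseField_or_isAcyclic with hA | hA
  · rcases B.isBaseField_or_isAcyclic with hB | hB
    · exact hA.outer_isPerf hB hP hQ
    · exact ((hB.isContractible hQ.1).outer_right P).isPerf
  · exact ((hA.isContractible hP.1).outer_left Q).isPerf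

theorem DGMod.IsPerf.extend {P : DGMod A} (hP : P.IsPerf) : (extend φ P).IsPerf := by
  rcases φ.isAcyclic_or_isBaseField with hC | ⟨hA, hC⟩
  · exact hC.isPerf (hP.1.extend φ)
  · exact hA.extend_isPerf hC φ hP

theorem DGMod.IsPerf.restrict {P : DGMod C} (hP : P.IsPerf) : (restrict φ P).IsPerf := by
  rcases φ.isAcyclic_or_isBaseField with hC | ⟨hA, hC⟩
  · exact ((hC.isContractible hP.1).restrict φ).isPerf
  · exact hA.restrict_isPerf hC φ hP

end IsPerf

namespace K0

variable {A B C : DGAlg k}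

/-- The Euler characteristic of the homology, as a functional on the Grothendieck group. -/
def euler [A.IsProper] : K0 A →ₗ[Zq] Zq :=
  lift (fun P _ => P.euler) (fun {P} _ _ _ h => h.euler_eq.trans P.euler_shift)
    (fun h₁ h₂ h₃ h => h.euler_eq (DGAlg.IsProper.hasFiniteHomology h₁)
      (DGAlg.IsProper.hasFiniteHomology h₂) (DGAlg.IsProper.hasFiniteHomology h₃))
    fun n {P} _ _ _ h => h.euler_eq.trans (DGMod.euler_qshift n P)

theorem euler_cls [A.IsProper] (P : DGMod A) (hP : P.IsPerf) : euler (cls P hP) = P.euler :=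
  lift_cls hP

variable (A) in
/-- The class of the free module of rank one. -/
def regular : K0 A := cls (DGMod.regular A) (DGMod.regular_isPerf A)

section BaseFieldOrAcyclic

variable [A.IsBaseFieldOrAcyclic] [B.IsBaseFieldOrAcyclic] [C.IsBaseFieldOrAcyclic]
  (φ : DGHom A C)

theorem cls_eq_euler_smul {P : DGMod A} (hP : P.IsPerf) : cls P hP = P.euler • regular A := by
  rcases A.isBaseField_or_isAcyclic with hA | hA
  · exact hA.cls_eq_euler_smul hP
  · exact hA.subsingleton_K0.elim _ _

theorem euler_smul_regular (x : K0 A) : euler x • regular A = x := by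
  refine LinearMap.congr_fun (f := (LinearMap.toSpanSingleton Zq _ (regular A)).comp euler)
    (g := LinearMap.id) (hom_ext fun P hP => ?_) x
  rw [LinearMap.comp_apply, euler_cls, LinearMap.toSpanSingleton_apply, LinearMap.id_apply,
    cls_eq_euler_smul]

theorem euler_regular (hA : A.IsBaseField) : euler (regular A) = 1 :=
  (euler_cls _ _).trans hA.euler_regular

theorem euler_injective : Function.Injective (euler : K0 A → Zq) := fun x y h => by
  rw [← euler_smul_regular x, h, euler_smul_regular]

/-- The isomorphism `K₀(k) ≃ ℤ[q, q⁻¹]` given by the Euler characteristic. -/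
def eulerEquiv (hA : A.IsBaseField) : K0 A ≃ₗ[Zq] Zq :=
  .ofLinearMap euler (LinearMap.toSpanSingleton Zq _ (regular A))
    (LinearMap.ext_ring (by simp [euler_regular hA]))
    (LinearMap.ext euler_smul_regular)

theorem eulerEquiv_symm_one (hA : A.IsBaseField) : (eulerEquiv hA).symm 1 = regular A :=
  one_smul Zq (regular A)

theorem cls_extend {P : DGMod A} (hP : P.IsPerf) :
    cls (P.extend φ) (hP.extend φ) = euler (cls P hP) • regular C := by
  rcases φ.isAcyclic_or_isBaseField with hC | ⟨hA, hC⟩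
  · exact hC.subsingleton_K0.elim _ _
  · rw [cls_eq_euler_smul (hP.extend φ), hA.euler_extend hC φ P, euler_cls]

/-- The map on Grothendieck groups induced by extension of scalars. -/
def extend : K0 A →ₗ[Zq] K0 C :=
  lift (fun P hP => cls (P.extend φ) (hP.extend φ))
    (fun hP hP' h => by
      rw [cls_extend φ hP, cls_extend φ hP', cls_shift hP hP' h, map_neg, neg_smul])
    (fun h₁ h₂ h₃ h => by
      rw [cls_extend φ h₁, cls_extend φ h₂, cls_extend φ h₃, cls_triangle h₁ h₂ h₃ h, map_add,
        add_smul])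
    fun n _ _ hP hP' h => by
      rw [cls_extend φ hP, cls_extend φ hP', cls_qshift n hP hP' h, map_smul, smul_assoc]

theorem extend_cls {P : DGMod A} (hP : P.IsPerf) :
    extend φ (cls P hP) = cls (P.extend φ) (hP.extend φ) :=
  lift_cls hP

theorem extend_apply (x : K0 A) : extend φ x = euler x • regular C :=
  LinearMap.congr_fun (g := (LinearMap.toSpanSingleton Zq _ (regular C)).comp euler)
    (hom_ext fun _ hP => (extend_cls φ hP).trans (cls_extend φ hP)) x

theorem cls_restrict {P : DGMod C} (hP : P.IsPerf) :
    cls (P.restrict φ) (hP.restrict φ) = euler (cls P hP) • regular A := by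
  rw [cls_eq_euler_smul (hP.restrict φ), euler_cls]
  rfl

/-- The map on Grothendieck groups induced by restriction of scalars. -/
def restrict : K0 C →ₗ[Zq] K0 A :=
  lift (fun P hP => cls (P.restrict φ) (hP.restrict φ))
    (fun hP hP' h => by
      rw [cls_restrict φ hP, cls_restrict φ hP', cls_shift hP hP' h, map_neg, neg_smul])
    (fun h₁ h₂ h₃ h => by
      rw [cls_restrict φ h₁, cls_restrict φ h₂, cls_restrict φ h₃, cls_triangle h₁ h₂ h₃ h, map_add,
        add_smul])
    fun n _ _ hP hP' h => by
      rw [cls_restrict φ hP, cls_restrict φ hP', cls_qshift n hP hP' h, map_smul, smul_assoc]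

theorem restrict_cls {P : DGMod C} (hP : P.IsPerf) :
    restrict φ (cls P hP) = cls (P.restrict φ) (hP.restrict φ) :=
  lift_cls hP

theorem restrict_apply (x : K0 C) : restrict φ x = euler x • regular A :=
  LinearMap.congr_fun (g := (LinearMap.toSpanSingleton Zq _ (regular A)).comp euler)
    (hom_ext fun _ hP => (restrict_cls φ hP).trans (cls_restrict φ hP)) x

/-- The bilinear map on Grothendieck groups induced by the outer tensor product. -/
def outer : K0 A →ₗ[Zq] K0 B →ₗ[Zq] K0 (A.tensor B) :=
  ((LinearMap.mul Zq Zq).compl₁₂ euler euler).compr₂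
    (LinearMap.toSpanSingleton Zq _ (regular (A.tensor B)))

theorem outer_apply (x : K0 A) (y : K0 B) :
    outer x y = (euler x * euler y) • regular (A.tensor B) := rfl

theorem outer_cls {P : DGMod A} (hP : P.IsPerf) {Q : DGMod B} (hQ : Q.IsPerf) :
    outer (cls P hP) (cls Q hQ) = cls (P.outer Q) (hP.outer hQ) := by
  rcases A.isBaseField_or_isAcyclic with hA | hA
  · rcases B.isBaseField_or_isAcyclic with hB | hB
    · rw [cls_eq_euler_smul (hP.outer hQ), hA.euler_outer hB hP hQ, outer_apply, euler_cls,
        euler_cls]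
    · exact (hB.tensor_right A).subsingleton_K0.elim _ _
  · exact (hA.tensor_left B).subsingleton_K0.elim _ _

theorem euler_outer (x : K0 A) (y : K0 B) : euler (outer x y) = euler x * euler y := by
  rw [outer_apply, map_smul, smul_eq_mul]
  rcases A.isBaseField_or_isAcyclic with hA | hA
  · rcases B.isBaseField_or_isAcyclic with hB | hB
    · rw [euler_regular (hA.tensor hB), mul_one]
    · rw [hB.subsingleton_K0.elim y 0, map_zero, mul_zero, zero_mul]
  · rw [hA.subsingleton_K0.elim x 0, map_zero, zero_mul, zero_mul]

theorem outer_regular : outer (regular A) (regular B) = regular (A.tensor B) := by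
  rw [outer_apply]
  rcases A.isBaseField_or_isAcyclic with hA | hA
  · rcases B.isBaseField_or_isAcyclic with hB | hB
    · rw [euler_regular hA, euler_regular hB, one_mul, one_smul]
    · exact (hB.tensor_right A).subsingleton_K0.elim _ _
  · exact (hA.tensor_left B).subsingleton_K0.elim _ _

variable (A B) in
/-- The Künneth isomorphism induced by the outer tensor product. -/
def outerEquiv : K0 A ⊗[Zq] K0 B ≃ₗ[Zq] K0 (A.tensor B) :=
  .ofLinearMap (TensorProduct.lift outer)
    ((LinearMap.toSpanSingleton Zq _ (regular A ⊗ₜ[Zq] regular B)).comp euler)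
    (LinearMap.ext fun z => by
      simp only [LinearMap.comp_apply, LinearMap.toSpanSingleton_apply, map_smul,
        TensorProduct.lift.tmul, outer_regular, euler_smul_regular, LinearMap.id_apply])
    (TensorProduct.ext' fun x y => by
      simp only [LinearMap.comp_apply, LinearMap.toSpanSingleton_apply, TensorProduct.lift.tmul,
        euler_outer, LinearMap.id_apply, ← TensorProduct.smul_tmul_smul, euler_smul_regular])

theorem outerEquiv_tmul (x : K0 A) (y : K0 B) : outerEquiv A B (x ⊗ₜ[Zq] y) = outer x y := rfl

theorem outerEquiv_symm_apply (z : K0 (A.tensor B)) :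
    (outerEquiv A B).symm z = euler z • (regular A ⊗ₜ[Zq] regular B) := rfl

end BaseFieldOrAcyclic

end K0

/-! ### The algebras `H⁻ₙ` -/

theorem isEmpty_LIdx {n : ℕ} (hn : n ≤ 1) : IsEmpty (LIdx n) :=
  ⟨fun i => by have := i.2; omega⟩

theorem LOT_isBaseField {n : ℕ} (hn : n ≤ 1) : (LOT k n).IsBaseField := by
  have := isEmpty_LIdx hn
  let counit : LOTAlg k n →ₐ[k] k := LOTlift k isEmptyElim isEmptyElim isEmptyElim isEmptyElim
  refine ⟨fun c c' h => ?_, fun x => ?_⟩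
  · exact (counit.commutes c).symm.trans ((congrArg counit h).trans (counit.commutes c'))
  · have span_le : Submodule.span k (Set.range (word k (n := n))) ≤
        LinearMap.range (Algebra.linearMap k (LOTAlg k n)) := by
      rw [Submodule.span_le]
      rintro _ ⟨l, rfl⟩
      cases l with
      | nil => exact ⟨1, map_one (algebraMap k (LOTAlg k n))⟩
      | cons i l => exact isEmptyElim i
    exact span_le (LOT_span k x)

theorem LOT_isAcyclic {n : ℕ} (hn : 2 ≤ n) : (LOT k n).IsAcyclic := by
  have h := word_mem k [(⟨0, by omega⟩ : LIdx n)]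
  rw [word_cons, word_nil, mul_one] at h
  exact ⟨_, h, LOTd_sig k _⟩

instance (n : ℕ) : (LOT k n).IsBaseFieldOrAcyclic where
  isBaseField_or_isAcyclic :=
    (Nat.lt_or_ge 1 n).elim (fun hn => .inr (LOT_isAcyclic hn)) fun hn => .inl (LOT_isBaseField hn)

/-! ### The algebra `ℤ[q, q⁻¹, E₁] / (E₁²)` -/

theorem UZ_linearIndependent {a b : Zq} (h : a • (1 : UZ) + b • E₁ = 0) : a = 0 ∧ b = 0 := by
  have h_dual := congrArg (UZlift (B := DualNumber Zq) DualNumber.eps DualNumber.eps_mul_eps) h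
  rw [map_add, map_smul, map_smul, map_one, UZlift_E₁, map_zero] at h_dual
  exact ⟨by simpa using congrArg TrivSqZeroExt.fst h_dual,
    by simpa using congrArg TrivSqZeroExt.snd h_dual⟩

theorem E₁_pow_eq_zero {n : ℕ} (hn : 2 ≤ n) : E₁ ^ n = 0 :=
  pow_eq_zero_of_le hn ((pow_two E₁).trans E₁_sq)

theorem UZΔ_one : UZΔ 1 = 1 ⊗ₜ[Zq] 1 := by
  rw [UZΔ, LinearMap.comp_apply, AlgHom.toLinearMap_apply, map_one]
  rfl

theorem UZΔ_E₁ : UZΔ E₁ = E₁ ⊗ₜ[Zq] 1 + 1 ⊗ₜ[Zq] E₁ := by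
  rw [UZΔ, LinearMap.comp_apply, AlgHom.toLinearMap_apply, UZcomul, UZlift_E₁]
  rfl

theorem UZΔ_E₁_pow {n : ℕ} (hn : n ≤ 1) :
    UZΔ (E₁ ^ n) = ∑ p ∈ Finset.HasAntidiagonal.antidiagonal n, (E₁ ^ p.1) ⊗ₜ[Zq] (E₁ ^ p.2) := by
  interval_cases n
  · rw [pow_zero, UZΔ_one]
    simp
  · rw [pow_one, UZΔ_E₁]
    simp [Finset.Nat.antidiagonal_succ, add_comm]

/-! ### The integral form of `U_q^+(gl(1|1))` -/

section IntegralForm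

open Polynomial

theorem UQ_root_mul_root :
    AdjoinRoot.root ((X : Qq[X]) ^ 2) * AdjoinRoot.root ((X : Qq[X]) ^ 2) = 0 := by
  have h := AdjoinRoot.eval₂_root ((X : Qq[X]) ^ 2)
  rw [eval₂_pow, eval₂_X] at h
  exact (pow_two _).symm.trans h

/-- The map from `ℚ(q)[E₁] / (E₁²)` to the dual numbers over `ℚ(q)`, which reads off
coefficients. -/
def UQtoDual : UQ →+* DualNumber Qq :=
  AdjoinRoot.lift (algebraMap Qq (DualNumber Qq)) DualNumber.eps
    (by rw [eval₂_pow, eval₂_X, pow_two, DualNumber.eps_mul_eps])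

theorem UQtoDual_algebraMap (c : Zq) : UQtoDual (algebraMap Zq UQ c) =
    algebraMap Qq (DualNumber Qq) (algebraMap Zq Qq c) := by
  rw [IsScalarTower.algebraMap_apply Zq Qq UQ, AdjoinRoot.algebraMap_eq]
  exact AdjoinRoot.lift_of _

theorem UQtoDual_root : UQtoDual (AdjoinRoot.root _) = DualNumber.eps :=
  AdjoinRoot.lift_root _

theorem UQ_linearIndependent {a b : Zq}
    (h : algebraMap Zq UQ a + algebraMap Zq UQ b * AdjoinRoot.root _ = 0) : a = 0 ∧ b = 0 := by
  have h_dual := congrArg UQtoDual h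
  rw [map_add, map_mul, UQtoDual_algebraMap, UQtoDual_algebraMap, UQtoDual_root, map_zero]
    at h_dual
  have ha : algebraMap Zq Qq a = 0 := by
    simpa [TrivSqZeroExt.algebraMap_eq_inl] using congrArg TrivSqZeroExt.fst h_dual
  have hb : algebraMap Zq Qq b = 0 := by
    simpa [TrivSqZeroExt.algebraMap_eq_inl] using congrArg TrivSqZeroExt.snd h_dual
  exact ⟨IsFractionRing.to_map_eq_zero_iff.1 ha, IsFractionRing.to_map_eq_zero_iff.1 hb⟩

/-- The inclusion of `ℤ[q, q⁻¹, E₁] / (E₁²)` into `ℚ(q)[E₁] / (E₁²)`. -/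
def UZtoUQ : UZ →ₐ[Zq] UQ := UZlift _ UQ_root_mul_root

theorem UZtoUQ_E₁ : UZtoUQ E₁ = AdjoinRoot.root _ := UZlift_E₁ _ UQ_root_mul_root

theorem UZtoUQ_apply (a b : Zq) : UZtoUQ (a • (1 : UZ) + b • E₁) =
    algebraMap Zq UQ a + algebraMap Zq UQ b * AdjoinRoot.root _ := by
  rw [Algebra.smul_def, Algebra.smul_def, mul_one, map_add, map_mul, AlgHom.commutes,
    AlgHom.commutes, UZtoUQ_E₁]

theorem UZtoUQ_injective : Function.Injective UZtoUQ := by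
  rw [injective_iff_map_eq_zero]
  intro x hx
  obtain ⟨a, b, rfl⟩ := UZ_span x
  rw [UZtoUQ_apply] at hx
  obtain ⟨rfl, rfl⟩ := UQ_linearIndependent hx
  rw [zero_smul, zero_smul, add_zero]

theorem UZtoUQ_range : UZtoUQ.range = UQint := by
  refine le_antisymm ?_ (Algebra.adjoin_le ?_)
  · rintro _ ⟨x, rfl⟩
    obtain ⟨a, b, rfl⟩ := UZ_span x
    change UZtoUQ (a • 1 + b • E₁) ∈ UQint
    rw [UZtoUQ_apply]
    exact Subalgebra.add_mem _ (Subalgebra.algebraMap_mem _ a)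
      (Subalgebra.mul_mem _ (Subalgebra.algebraMap_mem _ b) (Algebra.subset_adjoin rfl))
  · rintro _ rfl
    exact ⟨E₁, UZtoUQ_E₁⟩

/-- The identification of `ℤ[q, q⁻¹, E₁] / (E₁²)` with the integral form of `U_q^+(gl(1|1))`. -/
def UZequivUQint : UZ ≃ₐ[Zq] UQint :=
  (AlgEquiv.ofInjective UZtoUQ UZtoUQ_injective).trans (Subalgebra.equivOfEq _ _ UZtoUQ_range)

theorem UZequivUQint_E₁ : (UZequivUQint E₁ : UQ) = AdjoinRoot.root _ := UZtoUQ_E₁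

end IntegralForm

/-! ### The categorification of `ℤ[q, q⁻¹, E₁] / (E₁²)` -/

variable (k) in
/-- The inclusion `K₀(H⁻ₙ) → K₀(H⁻)`. -/
abbrev K0incl (n : ℕ) : K0 (LOT k n) →ₗ[Zq] ⨁ n : ℕ, K0 (LOT k n) :=
  DirectSum.lof Zq ℕ (fun n => K0 (LOT k n)) n

variable (k) in
/-- The map `K₀(H⁻) → ℤ[q, q⁻¹, E₁] / (E₁²)` determined by `[H⁻ₙ] ↦ E₁ ^ n` for `n ≤ 1`. -/
def K0toUZ : (⨁ n : ℕ, K0 (LOT k n)) →ₗ[Zq] UZ :=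
  DirectSum.toModule Zq ℕ UZ fun n => (LinearMap.toSpanSingleton Zq UZ (E₁ ^ n)).comp K0.euler

theorem K0toUZ_incl {n : ℕ} (x : K0 (LOT k n)) :
    K0toUZ k (K0incl k n x) = K0.euler x • E₁ ^ n :=
  DirectSum.toModule_lof _ _ _

theorem K0incl_zero_add_K0incl_one (x : ⨁ n : ℕ, K0 (LOT k n)) :
    K0incl k 0 (x 0) + K0incl k 1 (x 1) = x := by
  refine DFinsupp.ext fun n => ?_
  rw [DirectSum.add_apply]
  match n with
  | 0 =>
    rw [DirectSum.lof_apply, DirectSum.lof_eq_of, DirectSum.of_eq_of_ne _ _ _ (by decide),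
      add_zero]
  | 1 =>
    rw [DirectSum.lof_apply, DirectSum.lof_eq_of, DirectSum.of_eq_of_ne _ _ _ (by decide),
      zero_add]
  | n + 2 => exact (LOT_isAcyclic (by omega)).subsingleton_K0.elim _ _

theorem K0toUZ_injective : Function.Injective (K0toUZ k) := by
  intro x y hxy
  rw [← K0incl_zero_add_K0incl_one x, ← K0incl_zero_add_K0incl_one y] at hxy ⊢
  simp only [map_add, K0toUZ_incl, pow_zero, pow_one] at hxy
  rw [← sub_eq_zero, add_sub_add_comm, ← sub_smul, ← sub_smul] at hxy
  obtain ⟨euler_zero, euler_one⟩ := UZ_linearIndependent hxy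
  rw [K0.euler_injective (sub_eq_zero.1 euler_zero), K0.euler_injective (sub_eq_zero.1 euler_one)]

theorem K0toUZ_surjective : Function.Surjective (K0toUZ k) := by
  intro y
  obtain ⟨a, b, rfl⟩ := UZ_span y
  refine ⟨K0incl k 0 (a • K0.regular _) + K0incl k 1 (b • K0.regular _), ?_⟩
  simp only [map_add, K0toUZ_incl, map_smul, K0.euler_regular (LOT_isBaseField zero_le_one),
    K0.euler_regular (LOT_isBaseField le_rfl), one_smul, pow_zero, pow_one]

variable (k) in
/-- The isomorphism of `K₀(H⁻)` with `ℤ[q, q⁻¹, E₁] / (E₁²)`. -/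
def K0equivUZ : (⨁ n : ℕ, K0 (LOT k n)) ≃ₗ[Zq] UZ :=
  .ofBijective (K0toUZ k) ⟨K0toUZ_injective, K0toUZ_surjective⟩

theorem K0equivUZ_incl {n : ℕ} (x : K0 (LOT k n)) :
    K0equivUZ k (K0incl k n x) = K0.euler x • E₁ ^ n :=
  K0toUZ_incl x

theorem K0equivUZ_regular {n : ℕ} (hn : n ≤ 1) :
    K0equivUZ k (K0incl k n (K0.regular _)) = E₁ ^ n := by
  rw [K0equivUZ_incl, K0.euler_regular (LOT_isBaseField hn), one_smul]

section

variable {n m N : ℕ} (h : n + m = N)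

/-- The multiplication on Grothendieck groups induced by induction. -/
def K0ind : K0 (LOT k n) →ₗ[Zq] K0 (LOT k m) →ₗ[Zq] K0 (LOT k N) :=
  K0.outer.compr₂ (K0.extend (LOTincl k h))

/-- The comultiplication on Grothendieck groups induced by restriction. -/
abbrev K0res : K0 (LOT k N) →ₗ[Zq] K0 ((LOT k n).tensor (LOT k m)) :=
  K0.restrict (LOTincl k h)

theorem K0ind_cls {P : DGMod (LOT k n)} {Q : DGMod (LOT k m)} (hP : P.IsPerf) (hQ : Q.IsPerf) :
    K0ind h (K0.cls P hP) (K0.cls Q hQ) = K0.cls (Ind h P Q) ((hP.outer hQ).extend _) := by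
  rw [K0ind, LinearMap.compr₂_apply, K0.outer_cls, K0.extend_cls]
  rfl

theorem K0equivUZ_ind (x : K0 (LOT k n)) (y : K0 (LOT k m)) :
    K0equivUZ k (K0incl k N (K0ind h x y)) =
      K0equivUZ k (K0incl k n x) * K0equivUZ k (K0incl k m y) := by
  rw [K0equivUZ_incl, K0equivUZ_incl, K0equivUZ_incl, smul_mul_smul_comm, ← pow_add, h]
  rcases Nat.lt_or_ge 1 N with hN | hN
  · rw [E₁_pow_eq_zero hN, smul_zero, smul_zero]
  · rw [K0ind, LinearMap.compr₂_apply, K0.extend_apply, map_smul, K0.euler_outer,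
      K0.euler_regular (LOT_isBaseField hN), smul_eq_mul, mul_one]

theorem UZΔ_K0equivUZ (x : K0 (LOT k N)) : UZΔ (K0equivUZ k (K0incl k N x)) =
    ∑ p : Finset.HasAntidiagonal.antidiagonal N,
      TensorProduct.map ((K0equivUZ k).toLinearMap.comp (K0incl k p.1.1))
        ((K0equivUZ k).toLinearMap.comp (K0incl k p.1.2))
        ((K0.outerEquiv (LOT k p.1.1) (LOT k p.1.2)).symm
          (K0res (Finset.HasAntidiagonal.mem_antidiagonal.1 p.2) x)) := by
  rcases Nat.lt_or_ge 1 N with hN | hN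
  · rw [(LOT_isAcyclic hN).subsingleton_K0.elim x 0]
    simp only [map_zero, Finset.sum_const_zero]
  · rw [K0equivUZ_incl, map_smul, UZΔ_E₁_pow hN, ← Finset.sum_coe_sort, Finset.smul_sum]
    refine Finset.sum_congr rfl fun p _ => ?_
    have hp := Finset.HasAntidiagonal.mem_antidiagonal.1 p.2
    rw [K0.outerEquiv_symm_apply, K0.restrict_apply, map_smul, map_smul, smul_eq_mul,
      K0.euler_regular ((LOT_isBaseField (by omega)).tensor (LOT_isBaseField (by omega))),
      mul_one, TensorProduct.map_tmul]
    simp only [LinearMap.comp_apply, LinearEquiv.coe_coe]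
    rw [K0equivUZ_regular (by omega), K0equivUZ_regular (by omega)]

end

end LOTCat

end

theorem mainTheorem2 (k : Type u) [Field k] :
    -- free modules, inductions, outer tensor products and restrictions are compact projective
    ∃ (hfree : ∀ n : ℕ, (DGMod.regular (LOT k n)).IsPerf)
      (hInd : ∀ {n m N : ℕ} (h : n + m = N) (P : DGMod (LOT k n)) (Q : DGMod (LOT k m)),
        P.IsPerf → Q.IsPerf → (Ind h P Q).IsPerf)
      (hOuter : ∀ {n m : ℕ} (P : DGMod (LOT k n)) (Q : DGMod (LOT k m)),
        P.IsPerf → Q.IsPerf → (P.outer Q).IsPerf)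
      (hRes : ∀ {n m N : ℕ} (h : n + m = N) (P : DGMod (LOT k N)), P.IsPerf →
        (Res (n := n) (m := m) h P).IsPerf),
    -- the groups K₀(H⁻ₙ)
    (∃ e : Zq ≃ₗ[Zq] K0 (LOT k 0), e 1 = K0.cls (DGMod.regular (LOT k 0)) (hfree 0)) ∧
    (∃ e : Zq ≃ₗ[Zq] K0 (LOT k 1), e 1 = K0.cls (DGMod.regular (LOT k 1)) (hfree 1)) ∧
    (∀ n : ℕ, 2 ≤ n → Subsingleton (K0 (LOT k n))) ∧
    -- induction and restriction descend to K₀, and K₀(H⁻ₙ ⊗ H⁻ₘ) = K₀(H⁻ₙ) ⊗ K₀(H⁻ₘ)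
    ∃ (M : ∀ {n m N : ℕ}, n + m = N → (K0 (LOT k n) →ₗ[Zq] K0 (LOT k m) →ₗ[Zq] K0 (LOT k N)))
      (X : ∀ n m : ℕ,
        (K0 (LOT k n) ⊗[Zq] K0 (LOT k m)) ≃ₗ[Zq] K0 ((LOT k n).tensor (LOT k m)))
      (D : ∀ {n m N : ℕ}, n + m = N → (K0 (LOT k N) →ₗ[Zq] K0 ((LOT k n).tensor (LOT k m)))),
      (∀ {n m N : ℕ} (h : n + m = N) (P : DGMod (LOT k n)) (Q : DGMod (LOT k m))
        (hP : P.IsPerf) (hQ : Q.IsPerf),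
        M h (K0.cls P hP) (K0.cls Q hQ) = K0.cls (Ind h P Q) (hInd h P Q hP hQ)) ∧
      (∀ (n m : ℕ) (P : DGMod (LOT k n)) (Q : DGMod (LOT k m)) (hP : P.IsPerf) (hQ : Q.IsPerf),
        X n m (K0.cls P hP ⊗ₜ[Zq] K0.cls Q hQ) = K0.cls (P.outer Q) (hOuter P Q hP hQ)) ∧
      (∀ {n m N : ℕ} (h : n + m = N) (P : DGMod (LOT k N)) (hP : P.IsPerf),
        D (n := n) (m := m) h (K0.cls P hP) = K0.cls (Res h P) (hRes h P hP)) ∧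
      -- the isomorphism with ℤ[q, q⁻¹, E₁] / (E₁²), compatible with units, generators,
      -- multiplication and comultiplication
      (∃ φ : (⨁ n : ℕ, K0 (LOT k n)) ≃ₗ[Zq] UZ,
        φ (DirectSum.lof Zq ℕ (fun n => K0 (LOT k n)) 0
          (K0.cls (DGMod.regular (LOT k 0)) (hfree 0))) = 1 ∧
        φ (DirectSum.lof Zq ℕ (fun n => K0 (LOT k n)) 1
          (K0.cls (DGMod.regular (LOT k 1)) (hfree 1))) = E₁ ∧
        (∀ {n m N : ℕ} (h : n + m = N) (x : K0 (LOT k n)) (y : K0 (LOT k m)),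
          φ (DirectSum.lof Zq ℕ (fun n => K0 (LOT k n)) N (M h x y)) =
            φ (DirectSum.lof Zq ℕ (fun n => K0 (LOT k n)) n x) *
              φ (DirectSum.lof Zq ℕ (fun n => K0 (LOT k n)) m y)) ∧
        (∀ (N : ℕ) (x : K0 (LOT k N)),
          UZΔ (φ (DirectSum.lof Zq ℕ (fun n => K0 (LOT k n)) N x)) =
            ∑ p : Finset.HasAntidiagonal.antidiagonal N,
              TensorProduct.map
                (φ.toLinearMap.comp (DirectSum.lof Zq ℕ (fun n => K0 (LOT k n)) p.1.1))
                (φ.toLinearMap.comp (DirectSum.lof Zq ℕ (fun n => K0 (LOT k n)) p.1.2))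
                ((X p.1.1 p.1.2).symm (D (Finset.HasAntidiagonal.mem_antidiagonal.1 p.2) x)))) ∧
      -- ℤ[q, q⁻¹, E₁] / (E₁²) is the integral form of the positive half of quantum gl(1|1)
      (∃ ψ : UZ ≃ₐ[Zq] UQint, (ψ E₁ : UQ) = AdjoinRoot.root _) := by
  refine ⟨fun n => DGMod.regular_isPerf _, fun h P Q hP hQ => (hP.outer hQ).extend _,
    fun P Q hP hQ => hP.outer hQ, fun h P hP => hP.restrict _,
    ⟨(K0.eulerEquiv (LOT_isBaseField zero_le_one)).symm, K0.eulerEquiv_symm_one _⟩,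
    ⟨(K0.eulerEquiv (LOT_isBaseField le_rfl)).symm, K0.eulerEquiv_symm_one _⟩,
    fun n hn => (LOT_isAcyclic hn).subsingleton_K0,
    K0ind, fun n m => K0.outerEquiv _ _, K0res, ?ind_cls, ?outer_cls, ?res_cls, ?categorification,
    UZequivUQint, UZequivUQint_E₁⟩
  case ind_cls => exact fun h P Q hP hQ => K0ind_cls h hP hQ
  case outer_cls => exact fun n m P Q hP hQ => (K0.outerEquiv_tmul _ _).trans (K0.outer_cls hP hQ)
  case res_cls => exact fun h P hP => K0.restrict_cls _ hP
  case categorification =>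
    exact ⟨K0equivUZ k, K0equivUZ_regular zero_le_one,
      (K0equivUZ_regular le_rfl).trans (pow_one _), K0equivUZ_ind, fun N x => UZΔ_K0equivUZ x⟩
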